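/- Let $\beta\in\mathbb C$ with $\beta^4=1$. Let $H=\mathsf Q(2,\beta)$ be the symplectic fermion quasi-Hopf algebra with two pairs of fermions: the unital $\mathbb C$-algebra generated by $\mathsf K,\mathsf f_1^\pm,\mathsf f_2^\pm$ with relations $\{\mathsf f_i^\pm,\mathsf K\}=0$, $\{\mathsf f_i^+,\mathsf f_j^-\}=\delta_{ij}e_1$, $\{\mathsf f_i^\pm,\mathsf f_j^\pm\}=0$, $\mathsf K^4=1$, where $e_0=\tfrac12(1+\mathsf K^2)$, $e_1=\tfrac12(1-\mathsf K^2)$. Its coproduct, counit and antipode are determined by $\Delta(\mathsf K)=\mathsf K\otimes\mathsf K-2\,e_1\mathsf K\otimes e_1\mathsf K$, $\Delta(\mathsf f_i^\pm)=\mathsf f_i^\pm\otimes 1+\omega_\pm\otimes\mathsf f_i^\pm$ with $\omega_\pm=(e_0\pm i e_1)\mathsf K$, $\varepsilon(\mathsf K)=1$, $\varepsilon(\mathsf f_i^\pm)=0$, $S(\mathsf K)=\mathsf K$, $S(\mathsf f_i^\pm)=\mathsf f_i^\pm(e_0\pm i e_1)\mathsf K$. With $\boldsymbol\beta_\pm=e_0+\beta^2(\pm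 i\mathsf K)^2e_1$, the coassociator and its inverse are $\Phi^{\pm1}=1\otimes1\otimes1+e_1\otimes e_1\otimes\{e_0(\mathsf K^2-1)+e_1(\boldsymbol\beta_\pm-1)\}$, the evaluation and coevaluation elements are $\boldsymbol\alpha=1$ and $\boldsymbol\beta=\boldsymbol\beta_+$, and the pivot is $g=(e_0+i\,e_1\mathsf K^2)\mathsf K=g^{-1}$. Let $A\subset H$ be the subalgebra generated by $\mathsf K,\mathsf f_1^+,\mathsf f_1^-$; it is a quasi-Hopf subalgebra containing $g$. Modules are finite-dimensional left modules. With $\Psi=\Phi^{-1}$, $q^R=\Psi_1\otimes S^{-1}(\boldsymbol\alpha\Psi_3)\Psi_2$, $p^R=\Phi_1\otimes\Phi_2\boldsymbol\beta S(\Phi_3)$, $q^L=S(\Phi_1)\boldsymbol\alpha\Phi_2\otimes\Phi_3$, $p^L=\Psi_2S^{-1}(\Psi_1\boldsymbol\beta)\otimes\Psi_3$, a right (resp. left) symmetrised cointegral of $A$ is a non-zero $\widehat\lambda\in A^*$ with $(\widehat\lambda\otimes\mathrm{id})(q^R\Delta(h)p^R)=\widehat\lambda(h)g^{-1}$ (resp.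 $(\mathrm{id}\otimes\widehat\lambda)(q^L\Delta(h)p^L)=\widehat\lambda(h)g$) for all $h\in A$. A right (resp. left) modified trace on the ideal $\mathrm{Proj}(A\text{-mod})$ of projective modules is a family of linear maps $t_P:\mathrm{End}_A(P)\to\mathbb C$ that is cyclic, $t_P(vu)=t_{P'}(uv)$ for $u:P\to P'$, $v:P'\to P$, and compatible with the right (resp. left) partial trace: $t_{P\otimes V}(f)=t_P(\mathrm{ptr}^r_V(f))$ (resp. $t_{V\otimes P}(f)=t_P(\mathrm{ptr}^l_V(f))$), where $V$ is any module and partial traces are formed with the associator given by $\Phi$ and the dualities given by $S,\boldsymbol\alpha,\boldsymbol\beta,g$. It corresponds to $\widehat\lambda\in A^*$ if $t_P(f)=\widehat\lambda\big((\iota\circ f\circ\pi)(1)\big)$ whenever $\iota:P\to A$, $\pi:A\to P$ are module maps with $\pi\iota=\mathrm{id}_P$. Then the following hold. 1. The elements $(\mathsf f_1^+)^s(\mathsf f_1^-)^t\mathsf K^m$ with $s,t\in\{0,1\}$, $m\in\{0,1,2,3\}$ form a basis of $A$. The linear forms on $A$ with $$\widehat\lambda^{A,r}(\mathsf f_1^+\mathsf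 f_1^-\mathsf K^m)=\delta_{m,1}-i\beta^2\delta_{m,3},\qquad \widehat\lambda^{A,l}(\mathsf f_1^+\mathsf f_1^-\mathsf K^m)=\delta_{m,1}+i\beta^2\delta_{m,3}$$ and value $0$ on all other basis vectors are a right, respectively a left, symmetrised cointegral of $A$. 2. There are a right modified trace $t^{A,r}$ and a left modified trace $t^{A,l}$ on $\mathrm{Proj}(A\text{-mod})$ corresponding to $\widehat\lambda^{A,r}$ and $\widehat\lambda^{A,l}$. They are proportional (with a non-zero factor) on the projective modules of grade $0$ (on which $e_0$ acts as the identity), and also on those of grade $1$ (on which $e_1$ acts as the identity), but they are not proportional on all of $\mathrm{Proj}(A\text{-mod})$. 3. $A$ admits no ribbon structure: there are no R-matrix $R\in A\otimes A$ and ribbon element $v\in A$ (non-zero, central, $S(v)=v$, $\Delta(v)=(R_{21}R)^{-1}(v\otimes v)$). In particular, the pivotal structure given by $g$ does not extend to a ribbon structure. 4. Every projective $H$-module $X$ is projective as an $A$-module, and the pullback traces vanish on it: $t^{A,r}_{\mathrm{Res}X}(f)=0=t^{A,l}_{\mathrm{Res}X}(f)$ for every $f\in\mathrm{End}_H(X)$.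 -/

import Mathlib

open scoped TensorProduct

noncomputable section

/-! ## Structure maps of a pivotal quasi-Hopf algebra -/

/-- The structure maps and elements of a pivotal quasi-Hopf algebra over `ℂ`: coproduct, counit,
(bijective) antipode, coassociator and its inverse, evaluation element `α`, coevaluation element
`β`, and the pivot `g` with its inverse. It is only used for the two explicit algebras below. -/
structure QuasiHopfData (A : Type) [Ring A] [Algebra ℂ A] where
  Δ : A →ₐ[ℂ] A ⊗[ℂ] A
  ε : A →ₐ[ℂ] ℂ
  S : A ≃ₐ[ℂ] Aᵐᵒᵖ
  Φ : A ⊗[ℂ] (A ⊗[ℂ] A)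
  Φinv : A ⊗[ℂ] (A ⊗[ℂ] A)
  α : A
  β : A
  g : A
  ginv : A

namespace QuasiHopfData

variable {A : Type} [Ring A] [Algebra ℂ A] (Q : QuasiHopfData A)

/-- The antipode as a linear map `A → A`. -/
def antipode : A →ₗ[ℂ] A := (MulOpposite.opLinearEquiv ℂ).symm.toLinearMap ∘ₗ Q.S.toLinearMap

/-- The inverse antipode as a linear map `A → A`. -/
def antipodeInv : A →ₗ[ℂ] A := Q.S.symm.toLinearMap ∘ₗ (MulOpposite.opLinearEquiv ℂ).toLinearMap

theorem antipode_antipodeInv (a : A) : Q.antipode (Q.antipodeInv a) = a := by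
  simp [antipode, antipodeInv]

theorem antipodeInv_antipode (a : A) : Q.antipodeInv (Q.antipode a) = a := by
  simp [antipode, antipodeInv]

theorem antipode_mul (a b : A) : Q.antipode (a * b) = Q.antipode b * Q.antipode a := by
  simp [antipode]

theorem antipode_algebraMap (c : ℂ) : Q.antipode (algebraMap ℂ A c) = algebraMap ℂ A c :=
  congrArg MulOpposite.unop (Q.S.commutes c)

/-- `q^R = Ψ₁ ⊗ S⁻¹(α Ψ₃) Ψ₂` with `Ψ = Φ⁻¹`. -/
def qR : A ⊗[ℂ] A :=
  TensorProduct.map LinearMap.id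
    (LinearMap.mul' ℂ A ∘ₗ (TensorProduct.comm ℂ A A).toLinearMap ∘ₗ
      TensorProduct.map LinearMap.id (Q.antipodeInv ∘ₗ LinearMap.mulLeft ℂ Q.α)) Q.Φinv

/-- `p^R = Φ₁ ⊗ Φ₂ β S(Φ₃)`. -/
def pR : A ⊗[ℂ] A :=
  TensorProduct.map LinearMap.id
    (LinearMap.mul' ℂ A ∘ₗ
      TensorProduct.map LinearMap.id (LinearMap.mulLeft ℂ Q.β ∘ₗ Q.antipode)) Q.Φ

/-- `q^L = S(Φ₁) α Φ₂ ⊗ Φ₃`. -/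
def qL : A ⊗[ℂ] A :=
  TensorProduct.map
    (LinearMap.mul' ℂ A ∘ₗ
      TensorProduct.map (LinearMap.mulRight ℂ Q.α ∘ₗ Q.antipode) LinearMap.id)
    LinearMap.id ((TensorProduct.assoc ℂ A A A).symm Q.Φ)

/-- `p^L = Ψ₂ S⁻¹(Ψ₁ β) ⊗ Ψ₃` with `Ψ = Φ⁻¹`. -/
def pL : A ⊗[ℂ] A :=
  TensorProduct.map
    (LinearMap.mul' ℂ A ∘ₗ (TensorProduct.comm ℂ A A).toLinearMap ∘ₗ
      TensorProduct.map (Q.antipodeInv ∘ₗ LinearMap.mulRight ℂ Q.β) LinearMap.id)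
    LinearMap.id ((TensorProduct.assoc ℂ A A A).symm Q.Φinv)

/-- A right symmetrised cointegral: a non-zero linear form `lam` with
`(lam ⊗ id)(q^R Δ(h) p^R) = lam(h) g⁻¹` for all `h`. -/
def IsRightSymCointegral (lam : A →ₗ[ℂ] ℂ) : Prop :=
  lam ≠ 0 ∧ ∀ h : A,
    TensorProduct.lid ℂ A (lam.rTensor A (Q.qR * Q.Δ h * Q.pR)) = lam h • Q.ginv

/-- A left symmetrised cointegral: a non-zero linear form `lam` with
`(id ⊗ lam)(q^L Δ(h) p^L) = lam(h) g` for all `h`. -/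
def IsLeftSymCointegral (lam : A →ₗ[ℂ] ℂ) : Prop :=
  lam ≠ 0 ∧ ∀ h : A,
    TensorProduct.rid ℂ A (lam.lTensor A (Q.qL * Q.Δ h * Q.pL)) = lam h • Q.g

/-! ### R-matrices and ribbon elements -/

/-- `a ⊗ b ⊗ c ↦ b ⊗ a ⊗ c`. -/
def swap12 : A ⊗[ℂ] (A ⊗[ℂ] A) ≃ₐ[ℂ] A ⊗[ℂ] (A ⊗[ℂ] A) :=
  Algebra.TensorProduct.leftComm ℂ A A A

/-- `a ⊗ b ⊗ c ↦ a ⊗ c ⊗ b`. -/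
def swap23 : A ⊗[ℂ] (A ⊗[ℂ] A) ≃ₐ[ℂ] A ⊗[ℂ] (A ⊗[ℂ] A) :=
  Algebra.TensorProduct.congr AlgEquiv.refl (Algebra.TensorProduct.comm ℂ A A)

/-- `R₁₂ = R ⊗ 1`. -/
def leg12 : A ⊗[ℂ] A →ₐ[ℂ] A ⊗[ℂ] (A ⊗[ℂ] A) :=
  Algebra.TensorProduct.map (AlgHom.id ℂ A) Algebra.TensorProduct.includeLeft

/-- `R₁₃ = R₁ ⊗ 1 ⊗ R₂`. -/
def leg13 : A ⊗[ℂ] A →ₐ[ℂ] A ⊗[ℂ] (A ⊗[ℂ] A) :=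
  Algebra.TensorProduct.map (AlgHom.id ℂ A) Algebra.TensorProduct.includeRight

/-- `R₂₃ = 1 ⊗ R`. -/
def leg23 : A ⊗[ℂ] A →ₐ[ℂ] A ⊗[ℂ] (A ⊗[ℂ] A) := Algebra.TensorProduct.includeRight

/-- `R` is an R-matrix. With `Φ_{ijk} = Φ_i ⊗ Φ_j ⊗ Φ_k` and `Ψ = Φ⁻¹`:
`(Δ ⊗ id)(R) = Ψ₂₃₁ R₁₃ Φ₁₃₂ R₂₃ Ψ`, `(id ⊗ Δ)(R) = Φ₃₁₂ R₁₃ Ψ₂₁₃ R₁₂ Φ`, and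
`R Δ(h) = Δᶜᵒᵖ(h) R` for all `h`. -/
structure IsRMatrix (R : A ⊗[ℂ] A) : Prop where
  isUnit : IsUnit R
  hexagon_left :
    Algebra.TensorProduct.assoc ℂ ℂ ℂ A A A
        (Algebra.TensorProduct.map Q.Δ (AlgHom.id ℂ A) R) =
      swap23 (swap12 Q.Φinv) * leg13 R * swap23 Q.Φ * leg23 R * Q.Φinv
  hexagon_right :
    Algebra.TensorProduct.map (AlgHom.id ℂ A) Q.Δ R =
      swap12 (swap23 Q.Φ) * leg13 R * swap12 Q.Φinv * leg12 R * Q.Φ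
  intertwine : ∀ h : A, R * Q.Δ h = Algebra.TensorProduct.comm ℂ A A (Q.Δ h) * R

/-- `v` is a ribbon element with respect to `R`: it is non-zero and central,
`Δ(v) = M⁻¹ (v ⊗ v)` for the monodromy `M = R₂₁ R`, and `S(v) = v`. -/
structure IsRibbonElement (R : A ⊗[ℂ] A) (v : A) : Prop where
  ne_zero : v ≠ 0
  central : ∀ a : A, a * v = v * a
  monodromy : Algebra.TensorProduct.comm ℂ A A R * R * Q.Δ v = v ⊗ₜ[ℂ] v
  antipode_eq : Q.antipode v = v

/-- The quasi-Hopf algebra admits a ribbon structure. -/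
def AdmitsRibbonStructure : Prop :=
  ∃ (R : A ⊗[ℂ] A) (v : A), Q.IsRMatrix R ∧ Q.IsRibbonElement R v

end QuasiHopfData

/-! ## Finite-dimensional modules -/

/-- A finite-dimensional left module over a `ℂ`-algebra `A`. -/
structure FDMod (A : Type) [Ring A] [Algebra ℂ A] where
  carrier : Type
  [addCommGroup : AddCommGroup carrier]
  [module : Module ℂ carrier]
  [finiteDimensional : FiniteDimensional ℂ carrier]
  ρ : A →ₐ[ℂ] Module.End ℂ carrier

attribute [instance] FDMod.addCommGroup FDMod.module FDMod.finiteDimensional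

namespace FDMod

variable {A : Type} [Ring A] [Algebra ℂ A]

/-- The space of `A`-module morphisms. -/
def Hom (X Y : FDMod A) : Submodule ℂ (X.carrier →ₗ[ℂ] Y.carrier) where
  carrier := {f | ∀ a : A, f ∘ₗ X.ρ a = Y.ρ a ∘ₗ f}
  zero_mem' := fun a => by simp
  add_mem' := fun {f g} hf hg a => by
    exact (LinearMap.add_comp _ _ _).trans
      ((congrArg₂ (· + ·) (hf a) (hg a)).trans (LinearMap.comp_add _ _ _).symm)
  smul_mem' := fun c f hf a => by
    exact (LinearMap.smul_comp _ _ _).trans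
      ((congrArg (c • ·) (hf a)).trans (LinearMap.comp_smul _ _ _).symm)

/-- Composition of module morphisms. -/
def comp {X Y Z : FDMod A} (g : Hom Y Z) (f : Hom X Y) : Hom X Z :=
  ⟨g.1 ∘ₗ f.1, fun a => by
    rw [LinearMap.comp_assoc, f.2 a, ← LinearMap.comp_assoc, g.2 a, LinearMap.comp_assoc]⟩

/-- Projectivity as an `A`-module. -/
def IsProjective (X : FDMod A) : Prop :=
  letI : Module A X.carrier := Module.compHom X.carrier (X.ρ : A →+* Module.End ℂ X.carrier)
  Module.Projective A X.carrier

/-- The action of `A ⊗ A` on `X ⊗ Y`. -/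
def act₂ (X Y : FDMod A) : A ⊗[ℂ] A →ₐ[ℂ] Module.End ℂ (X.carrier ⊗[ℂ] Y.carrier) :=
  (Module.endTensorEndAlgHom (R := ℂ) (S := ℂ) (A := ℂ)).comp (Algebra.TensorProduct.map X.ρ Y.ρ)

/-- The action of `A ⊗ A ⊗ A` on `X ⊗ (Y ⊗ Z)`. -/
def act₃ (X Y Z : FDMod A) : A ⊗[ℂ] (A ⊗[ℂ] A) →ₐ[ℂ]
    Module.End ℂ (X.carrier ⊗[ℂ] (Y.carrier ⊗[ℂ] Z.carrier)) :=
  (Module.endTensorEndAlgHom (R := ℂ) (S := ℂ) (A := ℂ)).comp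
    (Algebra.TensorProduct.map X.ρ (act₂ Y Z))

/-- The tensor product of modules, with action through the coproduct. -/
abbrev tensor (Q : QuasiHopfData A) (X Y : FDMod A) : FDMod A where
  carrier := X.carrier ⊗[ℂ] Y.carrier
  ρ := (act₂ X Y).comp Q.Δ

/-- The dual module: `(a.φ)(v) = φ(S(a).v)`. -/
abbrev dual (Q : QuasiHopfData A) (V : FDMod A) : FDMod A where
  carrier := Module.Dual ℂ V.carrier
  ρ := AlgHom.ofLinearMap
    (Module.Dual.transpose ∘ₗ V.ρ.toLinearMap ∘ₗ Q.antipode)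
    (by
      ext φ v
      simp [QuasiHopfData.antipode, Module.Dual.transpose])
    (fun a b => by
      ext φ v
      simp [QuasiHopfData.antipode, Module.Dual.transpose])

/-- Left coevaluation `coev_V(1) = ∑ β.vᵢ ⊗ vⁱ ∈ V ⊗ V*`. -/
def coev (Q : QuasiHopfData A) (V : FDMod A) : V.carrier ⊗[ℂ] Module.Dual ℂ V.carrier :=
  (V.ρ Q.β).rTensor (Module.Dual ℂ V.carrier) (coevaluation ℂ V.carrier 1)

/-- Left evaluation `ev_V(φ ⊗ v) = φ(α.v)`. -/
def ev (Q : QuasiHopfData A) (V : FDMod A) : Module.Dual ℂ V.carrier ⊗[ℂ] V.carrier →ₗ[ℂ] ℂ :=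
  contractLeft ℂ V.carrier ∘ₗ (V.ρ Q.α).lTensor (Module.Dual ℂ V.carrier)

/-- Right coevaluation from the pivot: `∑ vⁱ ⊗ S⁻¹(g β).vᵢ ∈ V* ⊗ V`. -/
def coevPiv (Q : QuasiHopfData A) (V : FDMod A) : Module.Dual ℂ V.carrier ⊗[ℂ] V.carrier :=
  (V.ρ (Q.antipodeInv (Q.g * Q.β))).lTensor (Module.Dual ℂ V.carrier)
    (TensorProduct.comm ℂ V.carrier (Module.Dual ℂ V.carrier) (coevaluation ℂ V.carrier 1))

/-- Right evaluation from the pivot: `v ⊗ φ ↦ φ(S(α) g.v)`. -/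
def evPiv (Q : QuasiHopfData A) (V : FDMod A) :
    V.carrier ⊗[ℂ] Module.Dual ℂ V.carrier →ₗ[ℂ] ℂ :=
  contractRight ℂ V.carrier ∘ₗ
    (V.ρ (Q.antipode Q.α * Q.g)).rTensor (Module.Dual ℂ V.carrier)

/-- The right partial trace over `V` of an endomorphism of `X ⊗ V`, i.e. the composition
`X → X ⊗ (V ⊗ V*) → (X ⊗ V) ⊗ V* → (X ⊗ V) ⊗ V* → X ⊗ (V ⊗ V*) → X`. -/
def rightPartialTrace (Q : QuasiHopfData A) (X V : FDMod A)
    (f : Module.End ℂ (X.carrier ⊗[ℂ] V.carrier)) : Module.End ℂ X.carrier :=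
  (TensorProduct.rid ℂ X.carrier).toLinearMap ∘ₗ
  (evPiv Q V).lTensor X.carrier ∘ₗ
  act₃ X V (dual Q V) Q.Φinv ∘ₗ
  (TensorProduct.assoc ℂ X.carrier V.carrier (Module.Dual ℂ V.carrier)).toLinearMap ∘ₗ
  f.rTensor (Module.Dual ℂ V.carrier) ∘ₗ
  (TensorProduct.assoc ℂ X.carrier V.carrier (Module.Dual ℂ V.carrier)).symm.toLinearMap ∘ₗ
  act₃ X V (dual Q V) Q.Φ ∘ₗ
  (TensorProduct.mk ℂ X.carrier (V.carrier ⊗[ℂ] Module.Dual ℂ V.carrier)).flip (coev Q V)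

/-- The left partial trace over `V` of an endomorphism of `V ⊗ X`, i.e. the composition
`X → (V* ⊗ V) ⊗ X → V* ⊗ (V ⊗ X) → V* ⊗ (V ⊗ X) → (V* ⊗ V) ⊗ X → X`. -/
def leftPartialTrace (Q : QuasiHopfData A) (X V : FDMod A)
    (f : Module.End ℂ (V.carrier ⊗[ℂ] X.carrier)) : Module.End ℂ X.carrier :=
  (TensorProduct.lid ℂ X.carrier).toLinearMap ∘ₗ
  (ev Q V).rTensor X.carrier ∘ₗ
  (TensorProduct.assoc ℂ (Module.Dual ℂ V.carrier) V.carrier X.carrier).symm.toLinearMap ∘ₗ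
  act₃ (dual Q V) V X Q.Φ ∘ₗ
  f.lTensor (Module.Dual ℂ V.carrier) ∘ₗ
  act₃ (dual Q V) V X Q.Φinv ∘ₗ
  (TensorProduct.assoc ℂ (Module.Dual ℂ V.carrier) V.carrier X.carrier).toLinearMap ∘ₗ
  TensorProduct.mk ℂ (Module.Dual ℂ V.carrier ⊗[ℂ] V.carrier) X.carrier (coevPiv Q V)

end FDMod

/-! ## Modified traces -/

/-- A family of linear maps `t_X : End_A(X) → ℂ`, indexed by the modules `X` in `I`. -/
abbrev TraceFamily {A : Type} [Ring A] [Algebra ℂ A] (I : FDMod A → Prop) : Type 1 :=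
  ∀ X : FDMod A, I X → (FDMod.Hom X X →ₗ[ℂ] ℂ)

namespace TraceFamily

variable {A : Type} [Ring A] [Algebra ℂ A] {I : FDMod A → Prop}

/-- Cyclicity: `t_X(g ∘ f) = t_Y(f ∘ g)` for `f : X → Y`, `g : Y → X`. -/
def IsCyclic (t : TraceFamily I) : Prop :=
  ∀ (X Y : FDMod A) (hX : I X) (hY : I Y) (f : FDMod.Hom X Y) (g : FDMod.Hom Y X),
    t X hX (FDMod.comp g f) = t Y hY (FDMod.comp f g)

/-- A right modified trace: cyclic, and for `X ∈ I` and every `V`, one has `X ⊗ V ∈ I` and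
`t_{X ⊗ V}(f)` equals `t_X` of the right partial trace of `f`. -/
def IsRightModifiedTrace (Q : QuasiHopfData A) (t : TraceFamily I) : Prop :=
  t.IsCyclic ∧
  ∀ (X V : FDMod A) (hX : I X), ∃ hXV : I (FDMod.tensor Q X V),
    ∀ f : FDMod.Hom (FDMod.tensor Q X V) (FDMod.tensor Q X V),
      ∃ hf : FDMod.rightPartialTrace Q X V f.1 ∈ FDMod.Hom X X,
        t (FDMod.tensor Q X V) hXV f = t X hX ⟨FDMod.rightPartialTrace Q X V f.1, hf⟩

/-- A left modified trace: cyclic, and for `X ∈ I` and every `V`, one has `V ⊗ X ∈ I` and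
`t_{V ⊗ X}(f)` equals `t_X` of the left partial trace of `f`. -/
def IsLeftModifiedTrace (Q : QuasiHopfData A) (t : TraceFamily I) : Prop :=
  t.IsCyclic ∧
  ∀ (X V : FDMod A) (hX : I X), ∃ hVX : I (FDMod.tensor Q V X),
    ∀ f : FDMod.Hom (FDMod.tensor Q V X) (FDMod.tensor Q V X),
      ∃ hf : FDMod.leftPartialTrace Q X V f.1 ∈ FDMod.Hom X X,
        t (FDMod.tensor Q V X) hVX f = t X hX ⟨FDMod.leftPartialTrace Q X V f.1, hf⟩

/-- The trace family `t` corresponds to the linear form `lam`: on a direct summand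
`i : P → A`, `p : A → P`, `p ∘ i = id`, of the regular module,
`t_P(f) = lam((i ∘ f ∘ p)(1))`. -/
def CorrespondsTo (t : TraceFamily I) (lam : A →ₗ[ℂ] ℂ) : Prop :=
  ∀ (P : FDMod A) (hP : I P) (i : P.carrier →ₗ[ℂ] A) (p : A →ₗ[ℂ] P.carrier),
    (∀ a x, i (P.ρ a x) = a * i x) → (∀ a b, p (a * b) = P.ρ a (p b)) →
    p ∘ₗ i = LinearMap.id →
    ∀ f : FDMod.Hom P P, t P hP f = lam (i (f.1 (p 1)))

end TraceFamily

/-! ## Subalgebras: restriction of structure, of modules, and pullback of traces -/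

section Restriction

variable {H : Type} [Ring H] [Algebra ℂ H]

/-- The inclusion `A ⊗ A → H ⊗ H`. -/
def Subalgebra.incl₂ (A : Subalgebra ℂ H) : A ⊗[ℂ] A →ₐ[ℂ] H ⊗[ℂ] H :=
  Algebra.TensorProduct.map A.val A.val

/-- The inclusion `A ⊗ A ⊗ A → H ⊗ H ⊗ H`. -/
def Subalgebra.incl₃ (A : Subalgebra ℂ H) : A ⊗[ℂ] (A ⊗[ℂ] A) →ₐ[ℂ] H ⊗[ℂ] (H ⊗[ℂ] H) :=
  Algebra.TensorProduct.map A.val A.incl₂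

theorem Subalgebra.incl₂_injective (A : Subalgebra ℂ H) : Function.Injective A.incl₂ :=
  TensorProduct.map_injective_of_flat_flat A.val.toLinearMap A.val.toLinearMap
    Subtype.val_injective Subtype.val_injective

/-- A subalgebra closed under all structure maps and containing all structure elements of a
pivotal quasi-Hopf algebra. -/
structure QuasiHopfData.IsSub (Q : QuasiHopfData H) (A : Subalgebra ℂ H) : Prop where
  Δ_mem : ∀ a ∈ A, Q.Δ a ∈ A.incl₂.range
  S_mem : ∀ a ∈ A, Q.antipode a ∈ A
  Sinv_mem : ∀ a ∈ A, Q.antipodeInv a ∈ A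
  Φ_mem : Q.Φ ∈ A.incl₃.range
  Φinv_mem : Q.Φinv ∈ A.incl₃.range
  α_mem : Q.α ∈ A
  β_mem : Q.β ∈ A
  g_mem : Q.g ∈ A
  ginv_mem : Q.ginv ∈ A

/-- The structure inherited by a quasi-Hopf subalgebra containing the pivot. -/
def QuasiHopfData.restrict (Q : QuasiHopfData H) (A : Subalgebra ℂ H) (h : Q.IsSub A) :
    QuasiHopfData A where
  Δ := ((AlgEquiv.ofInjective A.incl₂ A.incl₂_injective).symm : A.incl₂.range →ₐ[ℂ] _).comp
    ((Q.Δ.comp A.val).codRestrict A.incl₂.range fun a => h.Δ_mem a a.2)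
  ε := Q.ε.comp A.val
  S :=
    { toFun := fun a => MulOpposite.op ⟨Q.antipode a, h.S_mem a a.2⟩
      invFun := fun a => ⟨Q.antipodeInv a.unop, h.Sinv_mem a.unop a.unop.2⟩
      left_inv := fun a => Subtype.ext (Q.antipodeInv_antipode a)
      right_inv := fun a =>
        MulOpposite.unop_injective (Subtype.ext (Q.antipode_antipodeInv a.unop))
      map_mul' := fun a b =>
        MulOpposite.unop_injective (Subtype.ext (Q.antipode_mul a b))
      map_add' := fun a b =>
        MulOpposite.unop_injective (Subtype.ext (Q.antipode.map_add a b))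
      commutes' := fun c =>
        MulOpposite.unop_injective (Subtype.ext (Q.antipode_algebraMap c)) }
  Φ := h.Φ_mem.choose
  Φinv := h.Φinv_mem.choose
  α := ⟨Q.α, h.α_mem⟩
  β := ⟨Q.β, h.β_mem⟩
  g := ⟨Q.g, h.g_mem⟩
  ginv := ⟨Q.ginv, h.ginv_mem⟩

/-- Restriction of an `H`-module to a subalgebra `A`. -/
def FDMod.res (A : Subalgebra ℂ H) (X : FDMod H) : FDMod A where
  carrier := X.carrier
  ρ := X.ρ.comp A.val

/-- Restriction of an `H`-endomorphism to a subalgebra `A`. -/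
def FDMod.resEnd (A : Subalgebra ℂ H) (X : FDMod H) (f : FDMod.Hom X X) :
    FDMod.Hom (X.res A) (X.res A) :=
  ⟨f.1, fun a => f.2 a⟩

/-- The pullback `(Res^* t)_X(f) = t_{Res X}(Res f)` of a trace family along restriction, for
`H`-modules `X` with `Res X ∈ I`. -/
def TraceFamily.pullback {A : Subalgebra ℂ H} {I : FDMod A → Prop} (t : TraceFamily I)
    (X : FDMod H) (hX : I (X.res A)) (f : FDMod.Hom X X) : ℂ :=
  t (X.res A) hX (FDMod.resEnd A X f)

end Restriction


/-! ## The symplectic fermion algebras -/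

section Idempotents

variable {B : Type} [Ring B] [Algebra ℂ B]

/-- `e₀ = (1 + k²)/2`. -/
def idem0 (k : B) : B := (1 / 2 : ℂ) • (1 + k ^ 2)

/-- `e₁ = (1 - k²)/2`. -/
def idem1 (k : B) : B := (1 / 2 : ℂ) • (1 - k ^ 2)

/-- `(e₀ + y e₁) k`. -/
def twistK (y : ℂ) (k : B) : B := (idem0 k + y • idem1 k) * k

theorem idem0_add_idem1 (k : B) : idem0 k + idem1 k = 1 := by
  simp only [idem0, idem1]; module

theorem idem0_sub_idem1 (k : B) : idem0 k - idem1 k = k ^ 2 := by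
  simp only [idem0, idem1]; module

theorem idem0_comm (k : B) : k * idem0 k = idem0 k * k := by
  simp only [idem0, mul_smul_comm, smul_mul_assoc, mul_add, add_mul, mul_one, one_mul,
    (Commute.self_pow k 2).eq]

theorem idem1_comm (k : B) : k * idem1 k = idem1 k * k := by
  simp only [idem1, mul_smul_comm, smul_mul_assoc, mul_sub, sub_mul, mul_one, one_mul,
    (Commute.self_pow k 2).eq]

theorem idem1_mul_self {k : B} (hk : k ^ 4 = 1) : idem1 k * idem1 k = idem1 k := by
  have h : k ^ 2 * k ^ 2 = 1 := by rw [← pow_add]; exact hk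
  simp only [idem1, mul_smul_comm, smul_mul_assoc, mul_sub, sub_mul, mul_one, one_mul, h]
  module

theorem idem1_mul_sq {k : B} (hk : k ^ 4 = 1) : idem1 k * k ^ 2 = - idem1 k := by
  have h : k ^ 2 * k ^ 2 = 1 := by rw [← pow_add]; exact hk
  simp only [idem1, smul_mul_assoc, sub_mul, one_mul, h]
  module

theorem idem1_anticomm {k f : B} (h : f * k + k * f = 0) : f * idem1 k = idem1 k * f := by
  have h1 : f * k = - (k * f) := eq_neg_of_add_eq_zero_left h
  have h2 : f * k ^ 2 = k ^ 2 * f := by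
    rw [pow_two, ← mul_assoc, h1, neg_mul, mul_assoc, h1, mul_neg, neg_neg, mul_assoc]
  simp only [idem1, mul_smul_comm, smul_mul_assoc, mul_sub, sub_mul, mul_one, one_mul, h2]

theorem twistK_eq (y : ℂ) (k : B) : twistK y k = (1 + (y - 1) • idem1 k) * k := by
  have h : idem0 k = 1 - idem1 k := eq_sub_of_add_eq (idem0_add_idem1 k)
  rw [twistK, h]
  congr 1
  module

theorem twistK_mul {k : B} (hk : k ^ 4 = 1) (y z : ℂ) :
    twistK y k * twistK z k = k ^ 2 + (1 - y * z) • idem1 k := by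
  have h1 : twistK y k * twistK z k =
      (1 + (y - 1) • idem1 k) * (1 + (z - 1) • idem1 k) * k ^ 2 := by
    have hc : k * (1 + (z - 1) • idem1 k) = (1 + (z - 1) • idem1 k) * k := by
      simp only [mul_add, add_mul, mul_one, one_mul, mul_smul_comm, smul_mul_assoc, idem1_comm]
    rw [twistK_eq, twistK_eq, pow_two, mul_assoc, ← mul_assoc k, hc]
    simp only [mul_assoc]
  rw [h1]
  simp only [mul_add, add_mul, mul_one, one_mul, mul_smul_comm, smul_mul_assoc,
    idem1_mul_self hk, idem1_mul_sq hk]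
  module

theorem twistK_comm {k : B} (hk : k ^ 4 = 1) (y z : ℂ) :
    twistK y k * twistK z k = twistK z k * twistK y k := by
  rw [twistK_mul hk, twistK_mul hk, mul_comm y z]

theorem twistK_sq {k : B} (hk : k ^ 4 = 1) {y : ℂ} (hy : y * y = 1) :
    twistK y k ^ 2 = k ^ 2 := by
  rw [pow_two, twistK_mul hk, hy]
  simp

theorem twistK_anticomm {k f : B} (h : f * k + k * f = 0) (y : ℂ) :
    f * twistK y k = - (twistK y k * f) := by
  have h1 : f * k = - (k * f) := eq_neg_of_add_eq_zero_left h
  rw [twistK_eq, ← mul_assoc]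
  have h2 : f * (1 + (y - 1) • idem1 k) = (1 + (y - 1) • idem1 k) * f := by
    simp only [mul_add, add_mul, mul_one, one_mul, mul_smul_comm, smul_mul_assoc,
      idem1_anticomm h]
  rw [h2, mul_assoc, h1, mul_neg, mul_assoc]

end Idempotents

/-- Generators of the symplectic fermion algebra: `K`, and `f i true = f_i^+`,
`f i false = f_i^-`. -/
inductive SFGen (N : ℕ) : Type
  | K : SFGen N
  | f (i : Fin N) (s : Bool) : SFGen N

/-- The defining relations: `{f_i^±, K} = 0`, `{f_i^+, f_j^-} = δ_{ij} e₁`, `{f_i^±, f_j^±} = 0`,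
`K⁴ = 1`. -/
inductive SFRel (N : ℕ) : FreeAlgebra ℂ (SFGen N) → FreeAlgebra ℂ (SFGen N) → Prop
  | K_pow : SFRel N (FreeAlgebra.ι ℂ SFGen.K ^ 4) 1
  | f_K (i : Fin N) (s : Bool) : SFRel N
      (FreeAlgebra.ι ℂ (SFGen.f i s) * FreeAlgebra.ι ℂ SFGen.K +
        FreeAlgebra.ι ℂ SFGen.K * FreeAlgebra.ι ℂ (SFGen.f i s)) 0
  | f_f (i j : Fin N) (s t : Bool) : SFRel N
      (FreeAlgebra.ι ℂ (SFGen.f i s) * FreeAlgebra.ι ℂ (SFGen.f j t) +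
        FreeAlgebra.ι ℂ (SFGen.f j t) * FreeAlgebra.ι ℂ (SFGen.f i s))
      (if i = j ∧ s ≠ t then idem1 (FreeAlgebra.ι ℂ SFGen.K) else 0)

/-- The algebra underlying the symplectic fermion quasi-Hopf algebra with `N` pairs of fermions. -/
def SF (N : ℕ) : Type := RingQuot (SFRel N)

instance SF.instRing (N : ℕ) : Ring (SF N) := inferInstanceAs (Ring (RingQuot (SFRel N)))

instance SF.instAlgebra (N : ℕ) : Algebra ℂ (SF N) :=
  inferInstanceAs (Algebra ℂ (RingQuot (SFRel N)))

namespace SF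

variable {N : ℕ}

/-- The quotient map from the free algebra. -/
def mk (N : ℕ) : FreeAlgebra ℂ (SFGen N) →ₐ[ℂ] SF N := RingQuot.mkAlgHom ℂ (SFRel N)

theorem mk_rel {x y : FreeAlgebra ℂ (SFGen N)} (h : SFRel N x y) : mk N x = mk N y :=
  RingQuot.mkAlgHom_rel ℂ h

/-- The generator `K`. -/
def K : SF N := mk N (FreeAlgebra.ι ℂ SFGen.K)

/-- The generator `f_i^±` (`true` for `+`, `false` for `-`). -/
def f (i : Fin N) (s : Bool) : SF N := mk N (FreeAlgebra.ι ℂ (SFGen.f i s))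

theorem map_idem1 {B C : Type} [Ring B] [Algebra ℂ B] [Ring C] [Algebra ℂ C]
    (φ : B →ₐ[ℂ] C) (k : B) : φ (idem1 k) = idem1 (φ k) := by
  simp [idem1]

theorem K_pow : (K : SF N) ^ 4 = 1 := by
  have h := mk_rel (SFRel.K_pow (N := N))
  simpa [K] using h

theorem f_K (i : Fin N) (s : Bool) : f i s * K + K * f i s = 0 := by
  have h := mk_rel (SFRel.f_K i s)
  simpa [K, f] using h

theorem f_f (i j : Fin N) (s t : Bool) :
    f i s * f j t + f j t * f i s = if i = j ∧ s ≠ t then idem1 (K : SF N) else 0 := by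
  have h := mk_rel (SFRel.f_f i j s t)
  rw [map_add, map_mul, map_mul, apply_ite (mk N), map_idem1,
    map_zero] at h
  exact h

/-- The universal property of the presentation. -/
def lift {B : Type} [Ring B] [Algebra ℂ B] (k : B) (φ : Fin N → Bool → B) (hk : k ^ 4 = 1)
    (hf : ∀ i s, φ i s * k + k * φ i s = 0)
    (hff : ∀ i j s t, φ i s * φ j t + φ j t * φ i s =
      if i = j ∧ s ≠ t then idem1 k else 0) : SF N →ₐ[ℂ] B :=
  RingQuot.liftAlgHom ℂ
    ⟨FreeAlgebra.lift ℂ (fun x : SFGen N => match x with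
      | SFGen.K => k
      | SFGen.f i s => φ i s), by
      intro x y h
      cases h with
      | K_pow => simpa using hk
      | f_K i s => simpa using hf i s
      | f_f i j s t =>
        rw [map_add, map_mul, map_mul, apply_ite (FreeAlgebra.lift ℂ _), map_idem1, map_zero]
        simpa using hff i j s t⟩

section lift

variable {B : Type} [Ring B] [Algebra ℂ B] (k : B) (φ : Fin N → Bool → B) (hk : k ^ 4 = 1)
    (hf : ∀ i s, φ i s * k + k * φ i s = 0)
    (hff : ∀ i j s t, φ i s * φ j t + φ j t * φ i s =
      if i = j ∧ s ≠ t then idem1 k else 0)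

theorem lift_K : lift k φ hk hf hff K = k :=
  (RingQuot.liftAlgHom_mkAlgHom_apply ℂ _ _ _).trans (FreeAlgebra.lift_ι_apply _ _)

theorem lift_f (i : Fin N) (s : Bool) : lift k φ hk hf hff (f i s) = φ i s :=
  (RingQuot.liftAlgHom_mkAlgHom_apply ℂ _ _ _).trans (FreeAlgebra.lift_ι_apply _ _)

end lift

theorem algHom_ext {B : Type} [Ring B] [Algebra ℂ B] {φ ψ : SF N →ₐ[ℂ] B}
    (hK : φ K = ψ K) (hf : ∀ i s, φ (f i s) = ψ (f i s)) : φ = ψ := by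
  apply RingQuot.ringQuot_ext'
  apply FreeAlgebra.hom_ext
  funext x
  cases x with
  | K => exact hK
  | f i s => exact hf i s

/-- `e₀ = (1 + K²)/2`. -/
def e0 : SF N := idem0 K

/-- `e₁ = (1 - K²)/2`. -/
def e1 : SF N := idem1 K

/-- The sign `±1` as a complex number. -/
def sgn (s : Bool) : ℂ := if s then 1 else -1

/-- `ω_± = (e₀ ± i e₁) K`. -/
def ω (s : Bool) : SF N := (e0 + (sgn s * Complex.I) • e1) * K

/-- `Δ(K) = K ⊗ K - (1 + (-1)^N) e₁ K ⊗ e₁ K`. -/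
def ΔK : SF N ⊗[ℂ] SF N := K ⊗ₜ K - (1 + (-1) ^ N : ℂ) • ((e1 * K) ⊗ₜ (e1 * K))

/-- `Δ(f_i^±) = f_i^± ⊗ 1 + ω_± ⊗ f_i^±`. -/
def Δf (i : Fin N) (s : Bool) : SF N ⊗[ℂ] SF N := f i s ⊗ₜ 1 + ω s ⊗ₜ f i s

/-- `S(K) = S⁻¹(K) = (e₀ + (-1)^N e₁) K`. -/
def SK : SF N := (e0 + ((-1) ^ N : ℂ) • e1) * K

/-- `S(f_i^±) = f_i^± (e₀ ± (-1)^N i e₁) K`. -/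
def Sf (i : Fin N) (s : Bool) : SF N := f i s * (e0 + (sgn s * (-1) ^ N * Complex.I) • e1) * K

/-- `S⁻¹(f_i^±) = ω_± f_i^±`. -/
def Sinvf (i : Fin N) (s : Bool) : SF N := ω s * f i s

theorem neg_one_sq_pow : ((-1 : ℂ) ^ N) * (-1) ^ N = 1 := by
  rw [← mul_pow]; simp

theorem sgn_mul_of_ne {s t : Bool} (h : s ≠ t) :
    (sgn s * Complex.I) * (sgn t * Complex.I) = 1 := by
  have hI := Complex.I_mul_I
  cases s <;> cases t <;> simp [sgn] at h ⊢

theorem ΔK_eq : (ΔK : SF N ⊗[ℂ] SF N) =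
    (1 - (1 + (-1) ^ N : ℂ) • ((e1 : SF N) ⊗ₜ (e1 : SF N))) * (K ⊗ₜ K) := by
  rw [ΔK, sub_mul, one_mul, smul_mul_assoc, Algebra.TensorProduct.tmul_mul_tmul]

theorem ΔK_sq : (ΔK : SF N ⊗[ℂ] SF N) ^ 2 = (K ^ 2) ⊗ₜ (K ^ 2) := by
  have hp : ((e1 : SF N) ⊗ₜ[ℂ] (e1 : SF N)) * (e1 ⊗ₜ e1) = e1 ⊗ₜ e1 := by
    rw [Algebra.TensorProduct.tmul_mul_tmul, e1, idem1_mul_self K_pow]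
  have hc : ((K : SF N) ⊗ₜ[ℂ] (K : SF N)) * (e1 ⊗ₜ e1) = (e1 ⊗ₜ e1) * (K ⊗ₜ K) := by
    rw [Algebra.TensorProduct.tmul_mul_tmul, Algebra.TensorProduct.tmul_mul_tmul, e1, idem1_comm]
  have hu : ((K : SF N) ⊗ₜ[ℂ] (K : SF N)) * (K ⊗ₜ K) = (K ^ 2) ⊗ₜ (K ^ 2) := by
    rw [Algebra.TensorProduct.tmul_mul_tmul, pow_two]
  have hcc : ((K : SF N) ⊗ₜ[ℂ] (K : SF N)) * (1 - (1 + (-1) ^ N : ℂ) • ((e1 : SF N) ⊗ₜ (e1 : SF N))) =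
      (1 - (1 + (-1) ^ N : ℂ) • ((e1 : SF N) ⊗ₜ (e1 : SF N))) * (K ⊗ₜ K) := by
    rw [mul_sub, sub_mul, mul_one, one_mul, mul_smul_comm, smul_mul_assoc, hc]
  have h1 : (1 - (1 + (-1) ^ N : ℂ) • ((e1 : SF N) ⊗ₜ[ℂ] (e1 : SF N))) *
      (1 - (1 + (-1) ^ N : ℂ) • ((e1 : SF N) ⊗ₜ (e1 : SF N))) = 1 := by
    have hN : ((1 + (-1) ^ N : ℂ)) * (1 + (-1) ^ N) = 2 * (1 + (-1) ^ N) := by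
      linear_combination neg_one_sq_pow (N := N)
    generalize (1 + (-1) ^ N : ℂ) = c at hN
    have h3 : c • (c • ((e1 : SF N) ⊗ₜ[ℂ] (e1 : SF N))) = (2 : ℂ) • (c • (e1 ⊗ₜ[ℂ] e1)) := by
      rw [smul_smul, smul_smul, hN]
    simp only [mul_sub, sub_mul, mul_one, one_mul, mul_smul_comm, smul_mul_assoc, hp]
    rw [smul_sub, h3]
    module
  rw [ΔK_eq, pow_two, mul_assoc, ← mul_assoc ((K : SF N) ⊗ₜ[ℂ] (K : SF N)), hcc, ← mul_assoc, ← mul_assoc, h1,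
    one_mul, hu]

/-- The coproduct. -/
def comul : SF N →ₐ[ℂ] SF N ⊗[ℂ] SF N :=
  lift ΔK Δf
    (by
      have h : (ΔK : SF N ⊗[ℂ] SF N) ^ 4 = ((ΔK : SF N ⊗[ℂ] SF N) ^ 2) ^ 2 := by rw [← pow_mul]
      rw [h, ΔK_sq, pow_two, Algebra.TensorProduct.tmul_mul_tmul, ← pow_add, K_pow]
      rfl)
    (by
      intro i s
      have hfe : f i s * (e1 : SF N) = e1 * f i s := idem1_anticomm (f_K i s)
      have hωe : ω s * (e1 : SF N) = e1 * ω s := by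
        change twistK _ K * idem1 K = idem1 K * twistK _ K
        rw [twistK_eq, mul_assoc, idem1_comm, ← mul_assoc, ← mul_assoc]
        congr 1
        simp only [mul_add, add_mul, mul_one, one_mul, mul_smul_comm, smul_mul_assoc]
      have hωK : ω s * (K : SF N) = K * ω s := by
        have h := twistK_comm (B := SF N) K_pow (sgn s * Complex.I) 1
        have h1 : twistK 1 (K : SF N) = K := by rw [twistK_eq]; simp
        rw [h1] at h
        exact h
      have hp : Δf i s * ((e1 : SF N) ⊗ₜ[ℂ] (e1 : SF N)) = (e1 ⊗ₜ e1) * Δf i s := by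
        simp only [Δf, mul_add, add_mul, Algebra.TensorProduct.tmul_mul_tmul, hfe, hωe, mul_one,
          one_mul]
      have hu : Δf i s * ((K : SF N) ⊗ₜ[ℂ] (K : SF N)) + (K ⊗ₜ K) * Δf i s = 0 := by
        simp only [Δf, mul_add, add_mul, Algebra.TensorProduct.tmul_mul_tmul, mul_one, one_mul]
        rw [eq_neg_of_add_eq_zero_left (f_K i s), hωK, TensorProduct.neg_tmul,
          TensorProduct.tmul_neg]
        abel
      have hcc : Δf i s * (1 - (1 + (-1) ^ N : ℂ) • ((e1 : SF N) ⊗ₜ (e1 : SF N))) =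
          (1 - (1 + (-1) ^ N : ℂ) • ((e1 : SF N) ⊗ₜ (e1 : SF N))) * Δf i s := by
        rw [mul_sub, sub_mul, mul_one, one_mul, mul_smul_comm, smul_mul_assoc, hp]
      rw [ΔK_eq, ← mul_assoc, hcc, mul_assoc, mul_assoc, ← mul_add, hu, mul_zero])
    (by
      intro i j s t
      have h1 : f i s * ω t = - (ω t * f i s) := twistK_anticomm (f_K i s) _
      have h2 : f j t * ω s = - (ω s * f j t) := twistK_anticomm (f_K j t) _
      have h3 : (ω t : SF N) * ω s = ω s * ω t := twistK_comm K_pow _ _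
      have h4 : Δf i s * Δf j t + Δf j t * Δf i s =
          (f i s * f j t + f j t * f i s) ⊗ₜ[ℂ] (1 : SF N) +
            (ω s * ω t) ⊗ₜ[ℂ] (f i s * f j t + f j t * f i s) := by
        simp only [Δf, mul_add, add_mul, Algebra.TensorProduct.tmul_mul_tmul, mul_one, one_mul,
          h1, h2, h3, TensorProduct.neg_tmul, TensorProduct.add_tmul, TensorProduct.tmul_add]
        abel
      rw [h4, f_f]
      split_ifs with h
      · have h5 : (ω s : SF N) * ω t = K ^ 2 := by
          change twistK _ K * twistK _ K = K ^ 2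
          rw [twistK_mul K_pow, sgn_mul_of_ne h.2]
          simp
        rw [h5]
        have h6 : idem1 (ΔK : SF N ⊗[ℂ] SF N) =
            (1 / 2 : ℂ) • (1 ⊗ₜ 1 - (K ^ 2) ⊗ₜ (K ^ 2)) := by
          rw [idem1, ΔK_sq]; rfl
        rw [h6, idem1, TensorProduct.tmul_smul, ← TensorProduct.smul_tmul',
          TensorProduct.tmul_sub, TensorProduct.sub_tmul]
        module
      · simp)

/-- The counit. -/
def counit : SF N →ₐ[ℂ] ℂ :=
  lift 1 (fun _ _ => 0) (by simp) (by simp) (by simp [idem1])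

theorem SK_sq : (SK : SF N) ^ 2 = K ^ 2 := twistK_sq K_pow neg_one_sq_pow

theorem idem1_op (k : SF N) : idem1 (MulOpposite.op k) = MulOpposite.op (idem1 k) := by
  simp [idem1]

theorem SK_pow : (SK : SF N) ^ 4 = 1 := by
  have h : (SK : SF N) ^ 4 = (SK ^ 2) ^ 2 := by rw [← pow_mul]
  rw [h, SK_sq, ← pow_mul, K_pow]

theorem idem1_SK : idem1 (SK : SF N) = idem1 K := by
  rw [idem1, idem1, SK_sq]

theorem Sf_eq (i : Fin N) (s : Bool) :
    Sf i s = f i s * twistK (sgn s * (-1) ^ N * Complex.I) K := mul_assoc _ _ _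

theorem Sf_mul (i j : Fin N) (s t : Bool) (y z : ℂ) :
    (f j t * twistK z K) * (f i s * twistK y K) + (f i s * twistK y K) * (f j t * twistK z K) =
      - ((f i s * f j t + f j t * f i s) * (twistK y (K : SF N) * twistK z K)) := by
  have h1 : twistK z K * f i s = - (f i s * twistK z K) := by
    rw [twistK_anticomm (f_K i s), neg_neg]
  have h2 : twistK y K * f j t = - (f j t * twistK y K) := by
    rw [twistK_anticomm (f_K j t), neg_neg]
  have a1 : (f j t * twistK z K) * (f i s * twistK y K) =
      - ((f j t * f i s) * (twistK y (K : SF N) * twistK z K)) := by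
    rw [mul_assoc, ← mul_assoc (twistK z K), h1, neg_mul, mul_neg, twistK_comm K_pow y z]
    simp only [mul_assoc]
  have a2 : (f i s * twistK y K) * (f j t * twistK z K) =
      - ((f i s * f j t) * (twistK y (K : SF N) * twistK z K)) := by
    rw [mul_assoc, ← mul_assoc (twistK y K), h2, neg_mul, mul_neg]
    simp only [mul_assoc]
  rw [a1, a2, add_mul]
  abel

theorem Sf_rel (i j : Fin N) (s t : Bool) (y z : ℂ) (hyz : s ≠ t → y * z = 1) :
    (f j t * twistK z K) * (f i s * twistK y K) + (f i s * twistK y K) * (f j t * twistK z K) =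
      if i = j ∧ s ≠ t then idem1 (SK : SF N) else 0 := by
  rw [Sf_mul, f_f]
  split_ifs with h
  · rw [twistK_mul K_pow, hyz h.2, sub_self, zero_smul, add_zero, idem1_mul_sq K_pow, neg_neg,
      idem1_SK]
  · simp

theorem Sf_SK (i : Fin N) (s : Bool) (y : ℂ) :
    SK * (f i s * twistK y K) + (f i s * twistK y K) * SK = 0 := by
  have h1 : SK * f i s = - (f i s * SK) := by
    rw [show f i s * SK = - (SK * f i s) from twistK_anticomm (f_K i s) _, neg_neg]
  have h2 : twistK y (K : SF N) * SK = SK * twistK y K := twistK_comm K_pow _ _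
  rw [← mul_assoc, h1, mul_assoc, h2, ← mul_assoc]
  simp [mul_assoc]

/-- The antipode, as an algebra map to the opposite algebra. -/
def antipodeHom : SF N →ₐ[ℂ] (SF N)ᵐᵒᵖ :=
  lift (MulOpposite.op SK) (fun i s => MulOpposite.op (Sf i s))
    (by rw [← MulOpposite.op_pow, SK_pow, MulOpposite.op_one])
    (by
      intro i s
      rw [← MulOpposite.op_mul, ← MulOpposite.op_mul, ← MulOpposite.op_add, Sf_eq, Sf_SK,
        MulOpposite.op_zero])
    (by
      intro i j s t
      rw [← MulOpposite.op_mul, ← MulOpposite.op_mul, ← MulOpposite.op_add, Sf_eq, Sf_eq,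
        Sf_rel, idem1_op]
      · split_ifs <;> simp
      · intro h
        linear_combination (sgn s * Complex.I * (sgn t * Complex.I)) * neg_one_sq_pow (N := N) +
          sgn_mul_of_ne h)

theorem Sinvf_neg (i : Fin N) (s : Bool) :
    Sinvf i s = - (f i s * twistK (sgn s * Complex.I) (K : SF N)) := by
  have h : f i s * ω s = - (ω s * f i s) := twistK_anticomm (f_K i s) _
  rw [Sinvf, ← neg_neg (ω s * f i s), ← h]
  rfl

/-- The inverse antipode, as an algebra map to the opposite algebra. -/
def antipodeInvHom : SF N →ₐ[ℂ] (SF N)ᵐᵒᵖ :=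
  lift (MulOpposite.op SK) (fun i s => MulOpposite.op (Sinvf i s))
    (by rw [← MulOpposite.op_pow, SK_pow, MulOpposite.op_one])
    (by
      intro i s
      rw [← MulOpposite.op_mul, ← MulOpposite.op_mul, ← MulOpposite.op_add, Sinvf_neg, mul_neg,
        neg_mul, ← neg_add, Sf_SK, neg_zero, MulOpposite.op_zero])
    (by
      intro i j s t
      rw [← MulOpposite.op_mul, ← MulOpposite.op_mul, ← MulOpposite.op_add, Sinvf_neg, Sinvf_neg,
        neg_mul_neg, neg_mul_neg, Sf_rel, idem1_op]
      · split_ifs <;> simp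
      · intro h
        exact sgn_mul_of_ne h)

theorem antipodeHom_K : antipodeHom (K : SF N) = MulOpposite.op SK := lift_K _ _ _ _ _

theorem antipodeHom_f (i : Fin N) (s : Bool) :
    antipodeHom (f i s) = MulOpposite.op (Sf i s) := lift_f _ _ _ _ _ i s

theorem antipodeInvHom_K : antipodeInvHom (K : SF N) = MulOpposite.op SK := lift_K _ _ _ _ _

theorem antipodeInvHom_f (i : Fin N) (s : Bool) :
    antipodeInvHom (f i s) = MulOpposite.op (Sinvf i s) := lift_f _ _ _ _ _ i s

theorem map_twistK_op (φ : SF N →ₐ[ℂ] (SF N)ᵐᵒᵖ) (hφ : φ K = MulOpposite.op SK) (y : ℂ) :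
    (φ (twistK y K)).unop = SK * (1 + (y - 1) • idem1 K) := by
  rw [twistK_eq, map_mul, map_add, map_one, map_smul, map_idem1, hφ, idem1_op, idem1_SK]
  simp

theorem SK_mul (y : ℂ) : (SK : SF N) * (1 + (y - 1) • idem1 K) = twistK ((-1) ^ N * y) K := by
  change twistK _ K * _ = _
  rw [twistK_eq, twistK_eq]
  have hc : (K : SF N) * (1 + (y - 1) • idem1 K) = (1 + (y - 1) • idem1 K) * K := by
    simp only [mul_add, add_mul, mul_one, one_mul, mul_smul_comm, smul_mul_assoc, idem1_comm]
  rw [mul_assoc, hc, ← mul_assoc]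
  congr 1
  simp only [mul_add, add_mul, mul_one, one_mul, mul_smul_comm, smul_mul_assoc,
    idem1_mul_self K_pow]
  module

theorem twistK_mul_eq_one {y z : ℂ} (h : y * z = -1) :
    twistK y (K : SF N) * twistK z K = 1 := by
  rw [twistK_mul K_pow, h, ← idem0_sub_idem1, ← idem0_add_idem1 (K : SF N)]
  module

theorem twistK_one : twistK 1 (K : SF N) = K := by
  rw [twistK_eq]; simp

theorem sgn_I_sq (s : Bool) : (sgn s * Complex.I) * (sgn s * Complex.I) = -1 := by
  cases s <;> simp [sgn]

/-- The antipode as an algebra isomorphism to the opposite algebra. -/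
def antipodeEquiv : SF N ≃ₐ[ℂ] (SF N)ᵐᵒᵖ :=
  AlgEquiv.ofAlgHom antipodeHom (AlgHom.opComm antipodeInvHom)
    (by
      have h : (AlgHom.opComm antipodeHom).comp antipodeInvHom = AlgHom.id ℂ (SF N) := by
        apply algHom_ext
        · rw [AlgHom.comp_apply, antipodeInvHom_K]
          change (antipodeHom (twistK _ K)).unop = K
          rw [map_twistK_op _ antipodeHom_K, SK_mul, neg_one_sq_pow, twistK_one]
        · intro i s
          rw [AlgHom.comp_apply, antipodeInvHom_f]
          change (antipodeHom (twistK _ K * f i s)).unop = f i s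
          rw [map_mul, MulOpposite.unop_mul, map_twistK_op _ antipodeHom_K, SK_mul,
            antipodeHom_f, MulOpposite.unop_op, Sf_eq, mul_assoc, twistK_mul_eq_one, mul_one]
          linear_combination (sgn s * Complex.I * (sgn s * Complex.I)) *
            neg_one_sq_pow (N := N) + sgn_I_sq s
      apply AlgHom.ext
      intro a
      exact MulOpposite.unop_injective (DFunLike.congr_fun h a.unop))
    (by
      apply algHom_ext
      · rw [AlgHom.comp_apply, antipodeHom_K]
        change (antipodeInvHom (twistK _ K)).unop = K
        rw [map_twistK_op _ antipodeInvHom_K, SK_mul, neg_one_sq_pow, twistK_one]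
      · intro i s
        rw [AlgHom.comp_apply, antipodeHom_f]
        change (antipodeInvHom (Sf i s)).unop = f i s
        rw [Sf_eq, map_mul, MulOpposite.unop_mul, map_twistK_op _ antipodeInvHom_K, SK_mul,
          antipodeInvHom_f, MulOpposite.unop_op, Sinvf, ← mul_assoc]
        change twistK _ K * twistK _ K * f i s = f i s
        rw [twistK_mul_eq_one, one_mul]
        linear_combination (sgn s * Complex.I * (sgn s * Complex.I)) *
          neg_one_sq_pow (N := N) + sgn_I_sq s)

/-- `𝛃_± = e₀ + β² (± i K)^N e₁`. -/
def bb (β : ℂ) (s : Bool) : SF N := e0 + (β ^ 2) • (((sgn s * Complex.I) • K) ^ N * e1)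

/-- The coassociator (`true`) and its inverse (`false`):
`Φ^{±1} = 1 ⊗ 1 ⊗ 1 + e₁ ⊗ e₁ ⊗ (e₀ (K^N - 1) + e₁ (𝛃_± - 1))`. -/
def coassociator (β : ℂ) (s : Bool) : SF N ⊗[ℂ] (SF N ⊗[ℂ] SF N) :=
  1 + e1 ⊗ₜ (e1 ⊗ₜ (e0 * (K ^ N - 1) + e1 * (bb β s - 1)))

/-- The pivot `g = (e₀ + (-i)^{N+1} e₁ K^N) K`, which satisfies `g⁻¹ = g`. -/
def pivot : SF N := (e0 + ((-Complex.I) ^ (N + 1)) • (e1 * K ^ N)) * K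

/-- The structure of the symplectic fermion quasi-Hopf algebra `Q(N, β)`, where
`β⁴ = (-1)^N`. -/
def quasiHopf (N : ℕ) (β : ℂ) : QuasiHopfData (SF N) where
  Δ := comul
  ε := counit
  S := antipodeEquiv
  Φ := coassociator β true
  Φinv := coassociator β false
  α := 1
  β := bb β true
  g := pivot
  ginv := pivot

/-! ### The subalgebra `A ⊂ Q(2, β)` -/

/-- The subalgebra of `Q(2, β)` generated by `K`, `f_1^+` and `f_1^-`. -/
def subA : Subalgebra ℂ (SF 2) := Algebra.adjoin ℂ {K, f 0 true, f 0 false}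

theorem K_mem : (K : SF 2) ∈ subA := Algebra.subset_adjoin (by simp)

theorem f_mem (s : Bool) : (f 0 s : SF 2) ∈ subA :=
  Algebra.subset_adjoin (by cases s <;> simp)

theorem e0_mem : (e0 : SF 2) ∈ subA :=
  subA.smul_mem (subA.add_mem subA.one_mem (subA.pow_mem K_mem 2)) _

theorem e1_mem : (e1 : SF 2) ∈ subA :=
  subA.smul_mem (subA.sub_mem subA.one_mem (subA.pow_mem K_mem 2)) _

theorem ω_mem (s : Bool) : (ω s : SF 2) ∈ subA :=
  subA.mul_mem (subA.add_mem e0_mem (subA.smul_mem e1_mem _)) K_mem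

theorem bb_mem (β : ℂ) (s : Bool) : (bb β s : SF 2) ∈ subA :=
  subA.add_mem e0_mem
    (subA.smul_mem (subA.mul_mem (subA.pow_mem (subA.smul_mem K_mem _) _) e1_mem) _)

theorem pivot_mem : (pivot : SF 2) ∈ subA :=
  subA.mul_mem
    (subA.add_mem e0_mem (subA.smul_mem (subA.mul_mem e1_mem (subA.pow_mem K_mem _)) _)) K_mem

theorem SK_mem : (SK : SF 2) ∈ subA :=
  subA.mul_mem (subA.add_mem e0_mem (subA.smul_mem e1_mem _)) K_mem

theorem tmul_mem {x y : SF 2} (hx : x ∈ subA) (hy : y ∈ subA) :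
    x ⊗ₜ[ℂ] y ∈ subA.incl₂.range :=
  ⟨⟨x, hx⟩ ⊗ₜ ⟨y, hy⟩, rfl⟩

theorem tmul_mem₃ {x y z : SF 2} (hx : x ∈ subA) (hy : y ∈ subA) (hz : z ∈ subA) :
    x ⊗ₜ[ℂ] (y ⊗ₜ[ℂ] z) ∈ subA.incl₃.range :=
  ⟨⟨x, hx⟩ ⊗ₜ (⟨y, hy⟩ ⊗ₜ ⟨z, hz⟩), rfl⟩

theorem coassociator_mem (β : ℂ) (s : Bool) :
    (coassociator β s : SF 2 ⊗[ℂ] (SF 2 ⊗[ℂ] SF 2)) ∈ subA.incl₃.range :=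
  Subalgebra.add_mem _ (Subalgebra.one_mem _)
    (tmul_mem₃ e1_mem e1_mem
      (subA.add_mem
        (subA.mul_mem e0_mem (subA.sub_mem (subA.pow_mem K_mem _) subA.one_mem))
        (subA.mul_mem e1_mem (subA.sub_mem (bb_mem β s) subA.one_mem))))

theorem isSub_of_gens (φ : SF 2 →ₐ[ℂ] (SF 2)ᵐᵒᵖ) (hK : (φ K).unop ∈ subA)
    (hf : ∀ s, (φ (f 0 s)).unop ∈ subA) (a : SF 2) (ha : a ∈ subA) : (φ a).unop ∈ subA := by
  refine Algebra.adjoin_induction (p := fun a _ => (φ a).unop ∈ subA) ?_ ?_ ?_ ?_ ha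
  · intro x hx
    rcases hx with rfl | rfl | rfl
    · exact hK
    · exact hf true
    · exact hf false
  · intro c
    rw [AlgHom.commutes]
    exact subA.algebraMap_mem c
  · intro x y _ _ hx hy
    rw [map_add]
    exact subA.add_mem hx hy
  · intro x y _ _ hx hy
    rw [map_mul]
    exact subA.mul_mem hy hx

/-- `A` is a quasi-Hopf subalgebra of `Q(2, β)` containing the pivot. -/
theorem isSub_subA (β : ℂ) : (quasiHopf 2 β).IsSub subA where
  Δ_mem := by
    intro a ha
    have h : subA ≤ (subA.incl₂.range).comap comul := by
      refine Algebra.adjoin_le ?_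
      have hf : ∀ s, comul (f 0 s : SF 2) ∈ subA.incl₂.range := by
        intro s
        rw [show comul (f 0 s : SF 2) = Δf 0 s from lift_f _ _ _ _ _ 0 s]
        exact Subalgebra.add_mem _ (tmul_mem (f_mem s) subA.one_mem)
          (tmul_mem (ω_mem s) (f_mem s))
      rintro x (rfl | rfl | rfl)
      · change comul (K : SF 2) ∈ subA.incl₂.range
        rw [show comul (K : SF 2) = ΔK from lift_K _ _ _ _ _]
        exact Subalgebra.sub_mem _ (tmul_mem K_mem K_mem)
          (Subalgebra.smul_mem _ (tmul_mem (subA.mul_mem e1_mem K_mem)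
            (subA.mul_mem e1_mem K_mem)) _)
      · exact hf true
      · exact hf false
    exact h ha
  S_mem := isSub_of_gens antipodeHom
    (by rw [antipodeHom_K]; exact SK_mem)
    (by
      intro s
      rw [antipodeHom_f]
      exact subA.mul_mem
        (subA.mul_mem (f_mem s) (subA.add_mem e0_mem (subA.smul_mem e1_mem _))) K_mem)
  Sinv_mem := isSub_of_gens antipodeInvHom
    (by rw [antipodeInvHom_K]; exact SK_mem)
    (by
      intro s
      rw [antipodeInvHom_f]
      exact subA.mul_mem (ω_mem s) (f_mem s))
  Φ_mem := coassociator_mem β true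
  Φinv_mem := coassociator_mem β false
  α_mem := subA.one_mem
  β_mem := bb_mem β true
  g_mem := pivot_mem
  ginv_mem := pivot_mem

/-- The pivotal quasi-Hopf algebra structure of `A`. -/
def quasiHopfA (β : ℂ) : QuasiHopfData subA := (quasiHopf 2 β).restrict subA (isSub_subA β)

/-- `K` as an element of `A`. -/
def KA : subA := ⟨K, K_mem⟩

/-- `f_1^±` as an element of `A`. -/
def fA (s : Bool) : subA := ⟨f 0 s, f_mem s⟩

/-- An `A`-module has grade `0` if `e₀` acts as the identity. -/
def IsGrade0 (X : FDMod subA) : Prop := X.ρ (idem0 KA) = 1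

/-- An `A`-module has grade `1` if `e₁` acts as the identity. -/
def IsGrade1 (X : FDMod subA) : Prop := X.ρ (idem1 KA) = 1

end SF

end

/-! Written in the generators ω_± and f_±, the coproduct of A is that of an ordinary Hopf algebra:
ω_± are commuting grouplike involutions with ω_+ω_- = K², and f_± are skew-primitive. All that
remains of the quasi structure is Φ = Φ⁻¹ = 1 + (β² - 1) e₁⊗e₁⊗e₁, a central involution because
(β²)² = 1. The pivot is ω_-, and 𝛃 g = ω_t with sgn t = -β².

Cointegrals. Let λ_s be a form supported on f_+f_-ω_s. Expanding Δ(f_+f_-y) gives (λ_s⊗id)Δ = λ_s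
ω_s and (id⊗λ_s)Δ = λ_s ω_{-s}. The signs in q and p cancel, so λ_t is a right and λ_{-t} a left
symmetrised cointegral; these are the two stated forms. They are symmetric (`IsTopForm.symm`).

Traces. A symmetric form λ defines the Hattori–Stallings trace ∑ λ(φ_k(f(x_k))) of a projective
module with dual basis (x_k, φ_k), and it is cyclic. On X⊗V the coordinates involve the antipode,
and the cointegral identity turns the trace on X⊗V into the trace on X of a partial trace weighted
by c = 𝛃 g = S(c) (`DualBasis.trace_tensor`). The categorical partial trace differs from this one by
conjugation with 1 + (β² - 1) e₁⊗e₁, which is harmless because endomorphisms commute with Δ(K²) =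
K²⊗K² (`partialTrace_conj`). The left version is the right one for the opposite coproduct. Finally
λ_s(aK²) is proportional to λ_{-s}(a), and K² is 1 on grade 0 and -1 on grade 1: the two
proportionality factors are opposite.

Restriction. Q(2,β) is generated over A by 1, f_2^+, f_2^-, f_2^+f_2^-. Restricted traces are sums
of λ(tr M(h)), where M(h) is the matrix of right multiplication by h. An element a of A has matrix
diag(a, πa, πa, a), with π the parity automorphism; since λ∘π = -λ, everything vanishes.

No ribbon structure. Let ε be the counit, χ the character K ↦ -1, and d_σ the skew derivations dual
to f_σ. All kill e₁A, so slicing the hexagons with them removes the coassociator. The slice r =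
(χ⊗id)R is an involution equal to some ω_s on the block Ae₁. A ribbon element would force r' =
(id⊗χ)R to agree with r on that block. Then (d_s⊗id)R = 0 while (id⊗d_{-s})R = 2f_s, so that
(d_s⊗d_{-s})(R) would be both 0 and 2. -/

noncomputable section

namespace SF

/-! ### Generators and relations of the subalgebra -/

/-- The grouplike element `ω_±` as an element of `A`. -/
def wA (s : Bool) : subA := twistK (sgn s * Complex.I) KA

theorem KA_pow : KA ^ 4 = 1 := Subtype.ext K_pow

theorem fA_mul_KA (s : Bool) : fA s * KA = -(KA * fA s) :=
  eq_neg_of_add_eq_zero_left (Subtype.ext (f_K 0 s))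

theorem fA_mul_fA (s : Bool) : fA s * fA s = 0 := by
  have h := f_f (N := 2) 0 0 s s
  have h2 : (2 : ℂ) • (f (N := 2) 0 s * f 0 s) = 0 := by
    rw [two_smul, h]; simp
  exact Subtype.ext ((smul_eq_zero.1 h2).resolve_left two_ne_zero)

theorem fA_true_mul_false : fA true * fA false + fA false * fA true = idem1 KA := by
  have h := f_f (N := 2) 0 0 true false
  rw [if_pos ⟨rfl, by simp⟩] at h
  exact Subtype.ext (h.trans (map_idem1 subA.val KA).symm)

theorem fA_mul_fA_not (s : Bool) : fA s * fA (!s) + fA (!s) * fA s = idem1 KA := by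
  cases s
  · rw [← fA_true_mul_false, add_comm]; rfl
  · exact fA_true_mul_false

theorem wA_comm (s t : Bool) : wA s * wA t = wA t * wA s := twistK_comm KA_pow _ _

/-- On `e₁` the factor `(±i)² = -1` compensates `K² = -1`; on `e₀` already `K² = 1`. This is the
gain of `ω_±` over `K`, which has order four. -/
theorem wA_mul_self (s : Bool) : wA s * wA s = 1 := by
  rw [wA, twistK_mul KA_pow, sgn_I_sq, ← idem0_sub_idem1, ← idem0_add_idem1 KA]
  module

theorem wA_mul_not (s : Bool) : wA s * wA (!s) = KA ^ 2 := by
  rw [wA, wA, twistK_mul KA_pow, sgn_mul_of_ne (by simp)]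
  simp

theorem fA_mul_wA (s t : Bool) : fA s * wA t = -(wA t * fA s) :=
  twistK_anticomm (Subtype.ext (f_K 0 s)) _

theorem fA_mul_idem1 (s : Bool) : fA s * idem1 KA = idem1 KA * fA s :=
  idem1_anticomm (Subtype.ext (f_K 0 s))

theorem idem1_eq : idem1 KA = (1 / 2 : ℂ) • (1 - wA true * wA false) := by
  rw [show wA true * wA false = KA ^ 2 from wA_mul_not true]; rfl

theorem KA_cube : idem1 KA * KA = (1 / 2 : ℂ) • (KA - KA ^ 3) := by
  rw [idem1, smul_mul_assoc, sub_mul, one_mul, ← pow_succ]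

theorem wA_eq (s : Bool) :
    wA s = ((1 + sgn s * Complex.I) / 2) • KA + ((1 - sgn s * Complex.I) / 2) • KA ^ 3 := by
  rw [wA, twistK_eq, add_mul, one_mul, smul_mul_assoc, KA_cube]
  module

theorem sgn_true : sgn true = 1 := rfl

theorem sgn_false : sgn false = -1 := rfl

/-- Inverts `wA_eq`, a linear system in `K` and `K³`; nothing is lost by replacing `K` with `ω_±`.
-/
theorem KA_eq :
    KA = ((1 - Complex.I) / 2) • wA true + ((1 + Complex.I) / 2) • wA false := by
  have hI := Complex.I_mul_I
  rw [wA_eq, wA_eq, sgn_true, sgn_false]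
  match_scalars
  · linear_combination (1 / 2) * hI
  · linear_combination (-1 / 2) * hI

theorem KA_cube_eq :
    KA ^ 3 = ((1 + Complex.I) / 2) • wA true + ((1 - Complex.I) / 2) • wA false := by
  have h : wA true + wA false = KA + KA ^ 3 := by
    rw [wA_eq, wA_eq]; simp only [sgn, if_true]; simp; module
  rw [eq_sub_of_add_eq' h.symm, KA_eq]
  module

theorem KA_sq_eq : KA ^ 2 = wA true * wA false := (wA_mul_not true).symm

/-- `A` is generated by `ω_±` and `f_±`. -/
theorem adjoin_wA_fA :
    Algebra.adjoin ℂ {x : subA | (∃ s, x = wA s) ∨ ∃ s, x = fA s} = ⊤ := by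
  set C := Algebra.adjoin ℂ {x : subA | (∃ s, x = wA s) ∨ ∃ s, x = fA s}
  have hw : ∀ s, wA s ∈ C := fun s => Algebra.subset_adjoin (Or.inl ⟨s, rfl⟩)
  have hf : ∀ s, fA s ∈ C := fun s => Algebra.subset_adjoin (Or.inr ⟨s, rfl⟩)
  have hK : KA ∈ C := by
    rw [KA_eq]
    exact C.add_mem (C.smul_mem (hw _) _) (C.smul_mem (hw _) _)
  have h1 : subA ≤ C.map subA.val := by
    refine Algebra.adjoin_le ?_
    rintro x (rfl | rfl | rfl)
    · exact ⟨KA, hK, rfl⟩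
    · exact ⟨fA true, hf true, rfl⟩
    · exact ⟨fA false, hf false, rfl⟩
  rw [eq_top_iff]
  intro x _
  obtain ⟨y, hy, hyx⟩ := h1 x.2
  rwa [← show y = x from Subtype.ext hyx]

/-- Induction over the generators `ω_±` and `f_±` of `A`. -/
theorem subA_induction {p : subA → Prop} (hw : ∀ s, p (wA s)) (hf : ∀ s, p (fA s))
    (hc : ∀ c, p (algebraMap ℂ subA c)) (hadd : ∀ x y, p x → p y → p (x + y))
    (hmul : ∀ x y, p x → p y → p (x * y)) (a : subA) : p a := by
  have ha : a ∈ Algebra.adjoin ℂ {x : subA | (∃ s, x = wA s) ∨ ∃ s, x = fA s} := by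
    rw [adjoin_wA_fA]; trivial
  refine Algebra.adjoin_induction (p := fun a _ => p a) ?_ hc (fun x y _ _ => hadd x y)
    (fun x y _ _ => hmul x y) ha
  rintro x (⟨s, rfl⟩ | ⟨s, rfl⟩)
  exacts [hw s, hf s]

/-- An element commutes with all of `A` if it commutes with `ω_±` and `f_±`. -/
theorem subA_central {x : subA} (hw : ∀ s, x * wA s = wA s * x) (hf : ∀ s, x * fA s = fA s * x)
    (a : subA) : x * a = a * x := by
  refine subA_induction (p := fun a => x * a = a * x) hw hf (fun c => ?_) ?_ ?_ a
  · exact (Algebra.commutes c x).symm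
  · intro a b ha hb; rw [mul_add, add_mul, ha, hb]
  · intro a b ha hb; rw [← mul_assoc, ha, mul_assoc, hb, mul_assoc]

theorem idem1_central (a : subA) : idem1 KA * a = a * idem1 KA := by
  refine subA_central (fun s => ?_) (fun s => (fA_mul_idem1 s).symm) a
  rw [idem1_eq]
  simp only [smul_mul_assoc, mul_smul_comm, sub_mul, mul_sub, one_mul, mul_one]
  rw [mul_assoc, wA_comm false s, ← mul_assoc, wA_comm true s, mul_assoc]

theorem idem0_central (a : subA) : idem0 KA * a = a * idem0 KA := by
  rw [eq_sub_of_add_eq (idem0_add_idem1 KA), sub_mul, mul_sub, idem1_central, one_mul, mul_one]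

theorem idem1_sq : idem1 KA * idem1 KA = idem1 KA := idem1_mul_self KA_pow

theorem idem0_mul_idem1 : idem0 KA * idem1 KA = 0 := by
  rw [eq_sub_of_add_eq (idem0_add_idem1 KA), sub_mul, idem1_sq, one_mul, sub_self]

theorem idem1_mul_idem0 : idem1 KA * idem0 KA = 0 := by
  rw [idem1_central, idem0_mul_idem1]

theorem idem0_sq : idem0 KA * idem0 KA = idem0 KA := by
  conv_lhs => rw [eq_sub_of_add_eq (idem0_add_idem1 KA)]
  rw [sub_mul, one_mul, ← eq_sub_of_add_eq (idem0_add_idem1 KA), idem1_mul_idem0, sub_zero]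

/-! ### The structure maps of the subalgebra -/

variable (β : ℂ)

theorem incl₂_Δ (a : subA) : subA.incl₂ ((quasiHopfA β).Δ a) = comul (a : SF 2) := by
  have h := AlgEquiv.apply_symm_apply (AlgEquiv.ofInjective subA.incl₂ subA.incl₂_injective)
    (((quasiHopf 2 β).Δ.comp subA.val).codRestrict subA.incl₂.range
      (fun a => (isSub_subA β).Δ_mem a a.2) a)
  exact congrArg Subtype.val h

theorem incl₂_tmul (a b : subA) : subA.incl₂ (a ⊗ₜ b) = (a : SF 2) ⊗ₜ[ℂ] (b : SF 2) := rfl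

theorem Δ_KA : (quasiHopfA β).Δ KA =
    KA ⊗ₜ KA - (2 : ℂ) • ((idem1 KA * KA) ⊗ₜ[ℂ] (idem1 KA * KA)) := by
  apply subA.incl₂_injective
  rw [incl₂_Δ, map_sub, map_smul, incl₂_tmul, incl₂_tmul]
  rw [show comul ((KA : subA) : SF 2) = ΔK from lift_K _ _ _ _ _, ΔK]
  have h : ((idem1 KA * KA : subA) : SF 2) = e1 * K :=
    (map_mul subA.val _ _).trans (congrArg (· * K) (map_idem1 subA.val KA))
  rw [h]
  norm_num
  rfl

theorem wA_coe (s : Bool) : ((wA s : subA) : SF 2) = ω s := by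
  change subA.val ((idem0 KA + (sgn s * Complex.I) • idem1 KA) * KA) = _
  rw [map_mul, map_add, map_smul, map_idem1]
  simp only [idem0, map_smul, map_add, map_one, map_pow]
  rfl

theorem Δ_fA (s : Bool) : (quasiHopfA β).Δ (fA s) = fA s ⊗ₜ 1 + wA s ⊗ₜ fA s := by
  apply subA.incl₂_injective
  rw [incl₂_Δ, map_add, incl₂_tmul, incl₂_tmul, wA_coe]
  exact lift_f _ _ _ _ _ 0 s

theorem Δ_KA_sq : (quasiHopfA β).Δ (KA ^ 2) = (KA ^ 2) ⊗ₜ (KA ^ 2) := by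
  apply subA.incl₂_injective
  rw [incl₂_Δ, incl₂_tmul]
  change comul (K ^ 2) = (K ^ 2) ⊗ₜ (K ^ 2)
  rw [map_pow, show comul (K : SF 2) = ΔK from lift_K _ _ _ _ _, ΔK_sq]

theorem Δ_idem1 : (quasiHopfA β).Δ (idem1 KA) =
    idem1 KA ⊗ₜ idem0 KA + idem0 KA ⊗ₜ idem1 KA := by
  rw [idem1, idem0, map_smul, map_sub, Δ_KA_sq, map_one]
  simp only [← TensorProduct.smul_tmul', TensorProduct.tmul_smul, TensorProduct.add_tmul,
    TensorProduct.sub_tmul, TensorProduct.tmul_add, TensorProduct.tmul_sub,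
    Algebra.TensorProduct.one_def]
  module

/-- On the corner `e₁ ⊗ e₁` the correction in `Δ(K)` replaces `K ⊗ K` by its negative, which is
exactly `(±i)² (K ⊗ K)`; on the mixed corners both sides carry one factor `±i`. -/
theorem Δ_wA (s : Bool) : (quasiHopfA β).Δ (wA s) = wA s ⊗ₜ wA s := by
  have h1 : (quasiHopfA β).Δ (wA s) = (1 + (sgn s * Complex.I - 1) •
      (idem1 KA ⊗ₜ[ℂ] idem0 KA + idem0 KA ⊗ₜ idem1 KA)) *
      ((1 - (2 : ℂ) • (idem1 KA ⊗ₜ idem1 KA)) * (KA ⊗ₜ KA)) := by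
    rw [wA, twistK_eq, map_mul, map_add, map_smul, Δ_idem1, map_one, Δ_KA, sub_mul, one_mul,
      smul_mul_assoc, Algebra.TensorProduct.tmul_mul_tmul]
  have h2 : wA s ⊗ₜ[ℂ] wA s = ((1 + (sgn s * Complex.I - 1) • idem1 KA) ⊗ₜ[ℂ]
      (1 + (sgn s * Complex.I - 1) • idem1 KA)) * (KA ⊗ₜ KA) := by
    rw [wA, twistK_eq, Algebra.TensorProduct.tmul_mul_tmul]
  rw [h1, h2, ← mul_assoc]
  congr 1
  have h0 : idem0 KA = 1 - idem1 KA := eq_sub_of_add_eq (idem0_add_idem1 KA)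
  have hc := sgn_I_sq s
  generalize sgn s * Complex.I = y at hc ⊢
  simp only [h0, TensorProduct.add_tmul, TensorProduct.tmul_add, TensorProduct.sub_tmul,
    TensorProduct.tmul_sub, add_mul, mul_sub, sub_mul, smul_mul_assoc, mul_smul_comm,
    Algebra.TensorProduct.tmul_mul_tmul, idem1_sq, mul_one, one_mul, smul_add, smul_sub,
    TensorProduct.tmul_smul, ← TensorProduct.smul_tmul', smul_smul,
    Algebra.TensorProduct.one_def]
  rw [hc]
  module

theorem antipode_KA : (quasiHopfA β).antipode KA = KA := by
  apply Subtype.ext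
  change (antipodeHom (K : SF 2)).unop = K
  rw [antipodeHom_K]
  change twistK _ K = K
  simp [twistK_eq]

theorem antipode_fA (s : Bool) : (quasiHopfA β).antipode (fA s) = fA s * wA s := by
  apply Subtype.ext
  change (antipodeHom (f 0 s : SF 2)).unop = f 0 s * ((wA s : subA) : SF 2)
  rw [antipodeHom_f, wA_coe]
  change f 0 s * (e0 + (sgn s * (-1) ^ 2 * Complex.I) • e1) * K = f 0 s * ω s
  rw [ω, mul_assoc]
  norm_num

theorem antipodeInv_fA (s : Bool) : (quasiHopfA β).antipodeInv (fA s) = wA s * fA s := by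
  apply Subtype.ext
  change (antipodeInvHom (f 0 s : SF 2)).unop = ((wA s : subA) : SF 2) * f 0 s
  rw [antipodeInvHom_f, wA_coe]
  rfl

end SF

/-! ### Antipode, coassociator, pivot and coevaluation element of `A` -/

namespace QuasiHopfData

variable {A : Type} [Ring A] [Algebra ℂ A] (Q : QuasiHopfData A)

theorem antipode_one : Q.antipode 1 = 1 := by simp [antipode]

theorem antipode_pow (a : A) (n : ℕ) : Q.antipode (a ^ n) = Q.antipode a ^ n := by
  simp [antipode]

theorem antipodeInv_of_eq {a b : A} (h : Q.antipode a = b) : Q.antipodeInv b = a := by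
  rw [← h, antipodeInv_antipode]

end QuasiHopfData

namespace SF

variable (β : ℂ)

theorem antipode_idem1 : (quasiHopfA β).antipode (idem1 KA) = idem1 KA := by
  rw [idem1, map_smul, map_sub, QuasiHopfData.antipode_one, QuasiHopfData.antipode_pow,
    antipode_KA]

theorem antipode_wA (s : Bool) : (quasiHopfA β).antipode (wA s) = wA s := by
  rw [wA, twistK_eq, QuasiHopfData.antipode_mul, map_add, map_smul, QuasiHopfData.antipode_one,
    antipode_idem1, antipode_KA, mul_add, add_mul, mul_one, one_mul, mul_smul_comm,
    smul_mul_assoc, idem1_comm]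

theorem antipodeInv_wA (s : Bool) : (quasiHopfA β).antipodeInv (wA s) = wA s :=
  QuasiHopfData.antipodeInv_of_eq _ (antipode_wA β s)

theorem incl₃_injective : Function.Injective subA.incl₃ :=
  TensorProduct.map_injective_of_flat_flat subA.val.toLinearMap subA.incl₂.toLinearMap
    Subtype.val_injective subA.incl₂_injective

/-- On `e₁` one has `(±iK)² = 1`, so the choice of sign disappears: `𝛃_+` and `𝛃_-` both act as `β²`
there. -/
theorem e1_mul_bb (s : Bool) : (e1 : SF 2) * (bb β s - 1) = (β ^ 2 - 1) • e1 := by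
  have h0 : (e1 : SF 2) * e0 = 0 := by
    have h : (e0 : SF 2) = 1 - e1 := eq_sub_of_add_eq (idem0_add_idem1 K)
    rw [h, mul_sub, mul_one, e1, idem1_mul_self K_pow, sub_self]
  have h2 : (e1 : SF 2) * (K ^ 2 * e1) = - e1 := by
    rw [← mul_assoc, e1, idem1_mul_sq K_pow, neg_mul, idem1_mul_self K_pow]
  rw [mul_sub, mul_one, bb, mul_add, h0, zero_add, mul_smul_comm, smul_pow, smul_mul_assoc,
    mul_smul_comm, h2, pow_two (sgn s * Complex.I), sgn_I_sq]
  module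

/-- The `e₀`-part of the third leg vanishes because `K² = 1` on `e₀`. The outcome does not depend on
`s`, so `Φ` and `Φ⁻¹` are the same element. -/
theorem coassociator_eq (s : Bool) : (coassociator β s : SF 2 ⊗[ℂ] (SF 2 ⊗[ℂ] SF 2)) =
    1 + (β ^ 2 - 1) • (e1 ⊗ₜ (e1 ⊗ₜ e1)) := by
  have h0 : (e0 : SF 2) * (K ^ 2 - 1) = 0 := by
    have h1 : ((K : SF 2) ^ 2) * K ^ 2 = 1 := by rw [← pow_add]; exact K_pow
    rw [e0, idem0, smul_mul_assoc, add_mul, one_mul, mul_sub, h1, mul_one]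
    simp
  rw [coassociator, h0, zero_add, e1_mul_bb]
  simp only [TensorProduct.tmul_smul]

theorem incl₃_one : subA.incl₃ 1 = 1 := subA.incl₃.map_one'

theorem incl₃_idem : subA.incl₃ (idem1 KA ⊗ₜ (idem1 KA ⊗ₜ idem1 KA)) =
    (e1 : SF 2) ⊗ₜ[ℂ] ((e1 : SF 2) ⊗ₜ[ℂ] (e1 : SF 2)) := by
  have h : ((idem1 KA : subA) : SF 2) = e1 := map_idem1 subA.val KA
  change ((idem1 KA : subA) : SF 2) ⊗ₜ[ℂ] (((idem1 KA : subA) : SF 2) ⊗ₜ[ℂ]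
    ((idem1 KA : subA) : SF 2)) = _
  rw [h]

theorem Φ_eq : (quasiHopfA β).Φ =
    1 + (β ^ 2 - 1) • (idem1 KA ⊗ₜ (idem1 KA ⊗ₜ idem1 KA)) := by
  apply incl₃_injective
  rw [map_add, map_smul, incl₃_one, incl₃_idem, ← coassociator_eq β true]
  exact (isSub_subA β).Φ_mem.choose_spec

theorem Φinv_eq : (quasiHopfA β).Φinv =
    1 + (β ^ 2 - 1) • (idem1 KA ⊗ₜ (idem1 KA ⊗ₜ idem1 KA)) := by
  apply incl₃_injective
  rw [map_add, map_smul, incl₃_one, incl₃_idem, ← coassociator_eq β false]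
  exact (isSub_subA β).Φinv_mem.choose_spec

theorem α_eq : (quasiHopfA β).α = 1 := rfl

/-- Since `(-i)³ = i` and `K² = -1` on `e₁`, the coefficient of `e₁ K` in the pivot is `-i`. -/
theorem g_eq : (quasiHopfA β).g = wA false := by
  apply Subtype.ext
  rw [wA_coe]
  change (e0 + ((-Complex.I) ^ (2 + 1)) • (e1 * K ^ 2)) * K = _
  rw [ω, e1, idem1_mul_sq K_pow, show (-Complex.I) ^ (2 + 1) = Complex.I by
    rw [pow_succ, pow_two]; linear_combination (-Complex.I) * Complex.I_mul_I]
  simp [sgn]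

theorem β_eq : (quasiHopfA β).β = 1 + (β ^ 2 - 1) • idem1 KA := by
  apply Subtype.ext
  change bb β true = 1 + (β ^ 2 - 1) • ((idem1 KA : subA) : SF 2)
  rw [show ((idem1 KA : subA) : SF 2) = e1 from map_idem1 subA.val KA, ← e1_mul_bb β true,
    mul_sub, mul_one]
  have h1 : (e0 : SF 2) * bb β true = e0 := by
    have h : (e0 : SF 2) = 1 - e1 := eq_sub_of_add_eq (idem0_add_idem1 K)
    have h3 : (e1 : SF 2) * bb β true = bb β true - e0 := by
      have h4 := e1_mul_bb β true
      rw [mul_sub, mul_one, sub_eq_iff_eq_add] at h4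
      rw [h4, bb, smul_pow, pow_two (_ * _), sgn_I_sq]
      have h2 : (K : SF 2) ^ 2 * e1 = - e1 := by
        rw [e1, ← idem1_mul_sq K_pow, pow_two, mul_assoc, idem1_comm, ← mul_assoc, idem1_comm,
          mul_assoc]
      rw [smul_mul_assoc, h2]
      module
    conv_lhs => rw [h]
    rw [sub_mul, one_mul, h3]
    abel
  have h2 : bb β true = (e0 : SF 2) * bb β true + e1 * bb β true := by
    rw [← add_mul, show (e0 : SF 2) + e1 = 1 from idem0_add_idem1 K, one_mul]
  conv_lhs => rw [h2, h1]
  rw [← show (e0 : SF 2) + e1 = 1 from idem0_add_idem1 K]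
  abel

end SF
end

noncomputable section

/-! ## Dual bases and the Hattori–Stallings trace -/

namespace FDMod

variable {A : Type} [Ring A] [Algebra ℂ A]

/-- A finite dual basis of an `A`-module. -/
structure DualBasis (X : FDMod A) (ι : Type) [Fintype ι] where
  vec : ι → X.carrier
  coord : ι → X.carrier →ₗ[ℂ] A
  coord_act : ∀ k a x, coord k (X.ρ a x) = a * coord k x
  sum_coord : ∀ x, ∑ k, X.ρ (coord k x) (vec k) = x

theorem DualBasis.isProjective {X : FDMod A} {ι : Type} [Fintype ι] (b : DualBasis X ι) :
    X.IsProjective := by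
  let : Module A X.carrier := Module.compHom X.carrier (X.ρ : A →+* Module.End ℂ X.carrier)
  change Module.Projective A X.carrier
  let i : X.carrier →ₗ[A] (ι → A) :=
    { toFun := fun x k => b.coord k x
      map_add' := fun x y => by ext k; simp
      map_smul' := fun a x => by ext k; exact b.coord_act k a x }
  let s : (ι → A) →ₗ[A] X.carrier :=
    { toFun := fun c => ∑ k, X.ρ (c k) (b.vec k)
      map_add' := fun x y => by simp [Finset.sum_add_distrib]
      map_smul' := fun a x => by
        change _ = X.ρ a (∑ k, X.ρ (x k) (b.vec k))
        simp [map_sum] }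
  exact Module.Projective.of_split i s (by ext x; exact b.sum_coord x)

/-- A ℂ-basis generates `X` over `A`; a splitting of the resulting surjection `Aⁿ → X` supplies the
coordinates. -/
theorem IsProjective.exists_dualBasis {X : FDMod A} (hX : X.IsProjective) :
    ∃ n : ℕ, Nonempty (DualBasis X (Fin n)) := by
  let : Module A X.carrier := Module.compHom X.carrier (X.ρ : A →+* Module.End ℂ X.carrier)
  have : Module.Projective A X.carrier := hX
  have hsmul : ∀ (a : A) (x : X.carrier), a • x = X.ρ a x := fun _ _ => rfl
  let b := Module.finBasis ℂ X.carrier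
  let p : (Fin (Module.finrank ℂ X.carrier) → A) →ₗ[A] X.carrier :=
    { toFun := fun c => ∑ k, c k • b k
      map_add' := fun x y => by simp [add_smul, Finset.sum_add_distrib]
      map_smul' := fun a x => by simp [Finset.smul_sum, mul_smul] }
  have hp : Function.Surjective p := by
    intro x
    refine ⟨fun k => algebraMap ℂ A (b.repr x k), ?_⟩
    change ∑ k, algebraMap ℂ A (b.repr x k) • b k = x
    conv_rhs => rw [← b.sum_repr x]
    refine Finset.sum_congr rfl fun k _ => ?_
    rw [hsmul, AlgHom.commutes]
    rfl
  obtain ⟨s, hs⟩ := Module.projective_lifting_property p LinearMap.id hp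
  refine ⟨_, ⟨⟨b, fun k =>
    { toFun := fun x => s x k
      map_add' := fun x y => by simp
      map_smul' := fun c x => ?_ }, fun k a x => ?_, fun x => ?_⟩⟩⟩
  · have h : c • x = algebraMap ℂ A c • x := by rw [hsmul, AlgHom.commutes]; rfl
    rw [h, map_smul, Pi.smul_apply, smul_eq_mul, RingHom.id_apply, Algebra.smul_def]
  · change s (a • x) k = a * s x k
    rw [map_smul]; rfl
  · exact LinearMap.congr_fun hs x

/-- The trace `∑ λ(φ_k(f(x_k)))` with respect to a dual basis. -/
def DualBasis.trace {X : FDMod A} {ι : Type} [Fintype ι] (b : DualBasis X ι) (lam : A →ₗ[ℂ] ℂ) :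
    Module.End ℂ X.carrier →ₗ[ℂ] ℂ :=
  ∑ k, lam ∘ₗ b.coord k ∘ₗ LinearMap.applyₗ (b.vec k)

theorem DualBasis.trace_apply {X : FDMod A} {ι : Type} [Fintype ι] (b : DualBasis X ι)
    (lam : A →ₗ[ℂ] ℂ) (f : Module.End ℂ X.carrier) :
    b.trace lam f = ∑ k, lam (b.coord k (f (b.vec k))) := by
  simp [trace]

theorem Hom.apply {X Y : FDMod A} (f : Hom X Y) (a : A) (x : X.carrier) :
    f.1 (X.ρ a x) = Y.ρ a (f.1 x) := LinearMap.congr_fun (f.2 a) x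

/-- Expanding `f(x_k)` in the basis of `Y` and `g(y_l)` in that of `X` gives the same double sum on
both sides, up to the order of the two factors inside `lam`. -/
theorem DualBasis.trace_comm {X Y : FDMod A} {ι κ : Type} [Fintype ι] [Fintype κ]
    (b : DualBasis X ι) (d : DualBasis Y κ) {lam : A →ₗ[ℂ] ℂ}
    (hlam : ∀ x y, lam (x * y) = lam (y * x)) (f : Hom X Y) (g : Hom Y X) :
    b.trace lam (g.1 ∘ₗ f.1) = d.trace lam (f.1 ∘ₗ g.1) := by
  have h1 : ∀ k, b.coord k (g.1 (f.1 (b.vec k))) =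
      ∑ l, d.coord l (f.1 (b.vec k)) * b.coord k (g.1 (d.vec l)) := by
    intro k
    conv_lhs => rw [← d.sum_coord (f.1 (b.vec k))]
    simp only [map_sum, Hom.apply, b.coord_act]
  have h2 : ∀ l, d.coord l (f.1 (g.1 (d.vec l))) =
      ∑ k, b.coord k (g.1 (d.vec l)) * d.coord l (f.1 (b.vec k)) := by
    intro l
    conv_lhs => rw [← b.sum_coord (g.1 (d.vec l))]
    simp only [map_sum, Hom.apply, d.coord_act]
  simp only [trace_apply, LinearMap.comp_apply, h1, h2, map_sum]
  rw [Finset.sum_comm]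
  exact Finset.sum_congr rfl fun l _ => Finset.sum_congr rfl fun k _ => hlam _ _

/-- The identity morphism. -/
def Hom.id (X : FDMod A) : Hom X X := ⟨LinearMap.id, fun _ => rfl⟩

/-- Cyclicity applied to `f` and the identity, with one dual basis on each side. -/
theorem DualBasis.trace_eq {X : FDMod A} {ι κ : Type} [Fintype ι] [Fintype κ]
    (b : DualBasis X ι) (d : DualBasis X κ) {lam : A →ₗ[ℂ] ℂ}
    (hlam : ∀ x y, lam (x * y) = lam (y * x)) (f : Hom X X) :
    b.trace lam f.1 = d.trace lam f.1 :=
  b.trace_comm d hlam f (Hom.id X)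

/-- A chosen dual basis of a projective module. -/
def IsProjective.dualBasis {X : FDMod A} (hX : X.IsProjective) :
    DualBasis X (Fin hX.exists_dualBasis.choose) := hX.exists_dualBasis.choose_spec.some

/-- The Hattori–Stallings trace composed with a linear form. -/
def hsTrace (lam : A →ₗ[ℂ] ℂ) : TraceFamily (A := A) FDMod.IsProjective :=
  fun X hX => hX.dualBasis.trace lam ∘ₗ (Hom X X).subtype

theorem hsTrace_eq {X : FDMod A} {ι : Type} [Fintype ι] (b : DualBasis X ι)
    {lam : A →ₗ[ℂ] ℂ} (hlam : ∀ x y, lam (x * y) = lam (y * x)) (hX : X.IsProjective)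
    (f : Hom X X) : hsTrace lam X hX f = b.trace lam f.1 :=
  hX.dualBasis.trace_eq b hlam f

theorem hsTrace_isCyclic {lam : A →ₗ[ℂ] ℂ} (hlam : ∀ x y, lam (x * y) = lam (y * x)) :
    (hsTrace lam).IsCyclic :=
  fun _ _ hX hY f g => hX.dualBasis.trace_comm hY.dualBasis hlam f g

theorem hsTrace_correspondsTo {lam : A →ₗ[ℂ] ℂ} (hlam : ∀ x y, lam (x * y) = lam (y * x)) :
    (hsTrace lam).CorrespondsTo lam := by
  intro P hP i p hi hp hpi f
  -- A retract of the regular module has a dual basis with a single element, `p 1` with coordinate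
  -- `i`.
  let b : DualBasis P Unit :=
    { vec := fun _ => p 1
      coord := fun _ => i
      coord_act := fun _ => hi
      sum_coord := fun x => by
        rw [Fintype.sum_unique, ← hp, mul_one]
        exact LinearMap.congr_fun hpi x }
  rw [hsTrace_eq b hlam, DualBasis.trace_apply, Fintype.sum_unique]

/-! ### Uniqueness of the trace corresponding to a linear form -/

/-- The regular module. -/
abbrev regular (A : Type) [Ring A] [Algebra ℂ A] [FiniteDimensional ℂ A] : FDMod A where
  carrier := A
  ρ := Algebra.lmul ℂ A

/-- The dual basis `1` of the regular module. -/
def regularDualBasis (A : Type) [Ring A] [Algebra ℂ A] [FiniteDimensional ℂ A] :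
    DualBasis (regular A) Unit where
  vec := fun _ => (1 : A)
  coord := fun _ => LinearMap.id
  coord_act := fun _ _ _ => rfl
  sum_coord := fun x => by
    rw [Fintype.sum_unique]
    exact mul_one (x : A)

/-- Every endomorphism of a projective module is a sum of maps factoring through the regular module,
and cyclicity moves each of them to `End_A(A)`. Hence the comparison and vanishing claims can be
proved for every family with the given form, not only for `hsTrace`. -/
theorem eq_trace_of_correspondsTo [FiniteDimensional ℂ A]
    {t : TraceFamily (A := A) FDMod.IsProjective} (ht : t.IsCyclic) {lam : A →ₗ[ℂ] ℂ}
    (hc : t.CorrespondsTo lam) {X : FDMod A} (hX : X.IsProjective) {ι : Type} [Fintype ι]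
    (b : DualBasis X ι) (f : Hom X X) : t X hX f = b.trace lam f.1 := by
  let u : ι → Hom X (regular A) := fun k =>
    ⟨b.coord k ∘ₗ f.1, fun a => by
      ext x
      change b.coord k (f.1 (X.ρ a x)) = a * b.coord k (f.1 x)
      rw [Hom.apply, b.coord_act]⟩
  let v : ι → Hom (regular A) X := fun k =>
    ⟨(LinearMap.applyₗ (b.vec k)) ∘ₗ X.ρ.toLinearMap, fun a => by
      ext x
      change X.ρ (a * x) (b.vec k) = X.ρ a (X.ρ x (b.vec k))
      rw [map_mul]; rfl⟩
  have hf : f = ∑ k, comp (v k) (u k) := by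
    apply Subtype.ext
    rw [AddSubmonoidClass.coe_finsetSum]
    ext x
    rw [LinearMap.sum_apply]
    exact (b.sum_coord (f.1 x)).symm
  have hR : (regular A).IsProjective := (regularDualBasis A).isProjective
  conv_lhs => rw [hf]
  rw [map_sum, DualBasis.trace_apply]
  refine Finset.sum_congr rfl fun k _ => ?_
  rw [ht X (regular A) hX hR (u k) (v k),
    hc (regular A) hR LinearMap.id LinearMap.id (fun _ _ => rfl) (fun _ _ => rfl) rfl]
  change lam (b.coord k (f.1 (X.ρ 1 (b.vec k)))) = _
  rw [map_one]; rfl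

end FDMod
end

noncomputable section

/-! ## Partial traces -/

namespace FDMod

section PartialTrace

variable {X V : Type} [AddCommGroup X] [Module ℂ X] [AddCommGroup V] [Module ℂ V]
  {κ : Type} [Fintype κ]

/-- The partial trace over `V` of `(1 ⊗ b) F` for `F ∈ End(X ⊗ V)`. -/
def partialTrace (v : Module.Basis κ ℂ V) (b : Module.End ℂ V) (F : Module.End ℂ (X ⊗[ℂ] V)) :
    Module.End ℂ X :=
  ∑ j, (TensorProduct.rid ℂ X).toLinearMap ∘ₗ (v.coord j ∘ₗ b).lTensor X ∘ₗ F ∘ₗ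
    (TensorProduct.mk ℂ X V).flip (v j)

variable (v : Module.Basis κ ℂ V)

theorem partialTrace_apply (b : Module.End ℂ V) (F : Module.End ℂ (X ⊗[ℂ] V)) (x : X) :
    partialTrace v b F x =
      ∑ j, TensorProduct.rid ℂ X ((v.coord j ∘ₗ b).lTensor X (F (x ⊗ₜ v j))) := by
  simp [partialTrace]

/-- Both sides evaluate `B` on the canonical element of `V* ⊗ V`, with `c` placed on one leg or on
the other. -/
theorem sum_coord_apply {M : Type*} [AddCommGroup M] [Module ℂ M]
    (B : Module.Dual ℂ V →ₗ[ℂ] V →ₗ[ℂ] M) (c : Module.End ℂ V) :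
    ∑ j, B (v.coord j) (c (v j)) = ∑ i, B (v.coord i ∘ₗ c) (v i) := by
  classical
  have h1 : ∀ j, c (v j) = ∑ i, v.coord i (c (v j)) • v i := fun j =>
    (v.sum_repr (c (v j))).symm
  have h2 : ∀ i, v.coord i ∘ₗ c = ∑ j, v.coord i (c (v j)) • v.coord j := fun i =>
    (v.sum_dual_apply_smul_coord (v.coord i ∘ₗ c)).symm
  calc ∑ j, B (v.coord j) (c (v j))
      = ∑ j, ∑ i, v.coord i (c (v j)) • B (v.coord j) (v i) := by
        refine Finset.sum_congr rfl fun j _ => ?_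
        conv_lhs => rw [h1 j]
        simp only [map_sum, map_smul]
    _ = ∑ i, B (v.coord i ∘ₗ c) (v i) := by
        rw [Finset.sum_comm]
        refine Finset.sum_congr rfl fun i _ => ?_
        rw [h2 i]
        simp only [map_sum, map_smul, LinearMap.sum_apply, LinearMap.smul_apply]

/-- Cyclicity in the factor `V`: an operator entering on the right of `F` reappears in the weight.
-/
theorem partialTrace_comp_lTensor (b c : Module.End ℂ V) (F : Module.End ℂ (X ⊗[ℂ] V)) :
    partialTrace v b (F ∘ₗ c.lTensor X) = partialTrace v (c ∘ₗ b) F := by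
  ext x
  rw [partialTrace_apply, partialTrace_apply]
  let B : Module.Dual ℂ V →ₗ[ℂ] V →ₗ[ℂ] X := LinearMap.mk₂ ℂ
    (fun ξ w => TensorProduct.rid ℂ X ((ξ ∘ₗ b).lTensor X (F (x ⊗ₜ w))))
    (fun ξ ξ' w => by simp [LinearMap.add_comp, LinearMap.lTensor_add])
    (fun r ξ w => by simp [LinearMap.smul_comp, LinearMap.lTensor_smul])
    (fun ξ w w' => by simp [TensorProduct.tmul_add])
    (fun r ξ w => by simp [TensorProduct.tmul_smul])
  exact sum_coord_apply v B c

theorem partialTrace_lTensor_comp (b c : Module.End ℂ V) (F : Module.End ℂ (X ⊗[ℂ] V)) :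
    partialTrace v b (c.lTensor X ∘ₗ F) = partialTrace v (b ∘ₗ c) F := by
  ext x
  simp only [partialTrace_apply, LinearMap.comp_apply, ← LinearMap.comp_assoc,
    LinearMap.lTensor_comp]

theorem partialTrace_comp_rTensor (b : Module.End ℂ V) (a : Module.End ℂ X)
    (F : Module.End ℂ (X ⊗[ℂ] V)) :
    partialTrace v b (F ∘ₗ a.rTensor V) = partialTrace v b F ∘ₗ a := by
  ext x
  simp [partialTrace_apply]

theorem partialTrace_rTensor_comp (b : Module.End ℂ V) (a : Module.End ℂ X)
    (F : Module.End ℂ (X ⊗[ℂ] V)) :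
    partialTrace v b (a.rTensor V ∘ₗ F) = a ∘ₗ partialTrace v b F := by
  ext x
  simp only [partialTrace_apply, LinearMap.comp_apply, map_sum]
  refine Finset.sum_congr rfl fun j _ => ?_
  have h : ∀ w : X ⊗[ℂ] V, TensorProduct.rid ℂ X ((v.coord j ∘ₗ b).lTensor X (a.rTensor V w)) =
      a (TensorProduct.rid ℂ X ((v.coord j ∘ₗ b).lTensor X w)) := by
    intro w
    induction w with
    | zero => simp
    | tmul x y => simp
    | add x y hx hy => simp only [map_add, hx, hy]
  exact h _

theorem partialTrace_add (b : Module.End ℂ V) (F G : Module.End ℂ (X ⊗[ℂ] V)) :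
    partialTrace v b (F + G) = partialTrace v b F + partialTrace v b G := by
  ext x
  simp [partialTrace_apply, Finset.sum_add_distrib]

theorem partialTrace_smul (b : Module.End ℂ V) (r : ℂ) (F : Module.End ℂ (X ⊗[ℂ] V)) :
    partialTrace v b (r • F) = r • partialTrace v b F := by
  ext x
  simp [partialTrace_apply, Finset.smul_sum]

theorem partialTrace_zero (b : Module.End ℂ V) :
    partialTrace v b (0 : Module.End ℂ (X ⊗[ℂ] V)) = 0 := by
  ext x
  simp [partialTrace_apply]

theorem partialTrace_add_left (b c : Module.End ℂ V) (F : Module.End ℂ (X ⊗[ℂ] V)) :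
    partialTrace v (b + c) F = partialTrace v b F + partialTrace v c F := by
  ext x
  simp [partialTrace_apply, LinearMap.comp_add, LinearMap.lTensor_add, Finset.sum_add_distrib]

theorem partialTrace_smul_left (r : ℂ) (b : Module.End ℂ V) (F : Module.End ℂ (X ⊗[ℂ] V)) :
    partialTrace v (r • b) F = r • partialTrace v b F := by
  ext x
  simp [partialTrace_apply, LinearMap.comp_smul, LinearMap.lTensor_smul, Finset.smul_sum]

/-- Conjugating by the involution `1 + (u - 1) a ⊗ b` does not change a partial trace, for
commuting idempotents `a`, `b` with `(1 - 2a) ⊗ (1 - 2b)` commuting with `F`. -/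
theorem partialTrace_conj {u : ℂ} (hu : u * u = 1) {a : Module.End ℂ X} {b c : Module.End ℂ V}
    (ha : a * a = a) (hb : b * b = b) (hbc : b * c = c * b) {F : Module.End ℂ (X ⊗[ℂ] V)}
    (hF : F ∘ₗ (1 - 2 • a).rTensor V ∘ₗ (1 - 2 • b).lTensor X =
      (1 - 2 • a).rTensor V ∘ₗ (1 - 2 • b).lTensor X ∘ₗ F) :
    partialTrace v c ((1 + (u - 1) • (a.rTensor V ∘ₗ b.lTensor X)) ∘ₗ F ∘ₗ
      (1 + (u - 1) • (a.rTensor V ∘ₗ b.lTensor X))) = partialTrace v c F := by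
  -- Every correction term of the conjugation turns out to be a multiple of `a * Y`.
  set Y := partialTrace v (c * b) F
  have hs : (1 - 2 • a) * (1 - 2 • a) = 1 := by
    simp only [sub_mul, mul_sub, one_mul, mul_one, smul_mul_assoc, mul_smul_comm, ha]
    module
  have ht : (1 - 2 • b) * (1 - 2 • b) = 1 := by
    simp only [sub_mul, mul_sub, one_mul, mul_one, smul_mul_assoc, mul_smul_comm, hb]
    module
  have htl : (1 - 2 • b).lTensor X ∘ₗ (1 - 2 • b).lTensor X = LinearMap.id := by
    rw [← LinearMap.lTensor_comp, ← Module.End.mul_eq_comp, ht]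
    exact LinearMap.lTensor_id _ _
  have hF' : F ∘ₗ (1 - 2 • a).rTensor V =
      (1 - 2 • a).rTensor V ∘ₗ (1 - 2 • b).lTensor X ∘ₗ F ∘ₗ (1 - 2 • b).lTensor X := by
    have h := congrArg (fun G => G ∘ₗ (1 - 2 • b).lTensor X) hF
    simp only [LinearMap.comp_assoc, htl, LinearMap.comp_id] at h
    exact h
  -- The two factors `1 - 2b` cycle around `V` and cancel, as they commute with `c * b`. What
  -- remains says that `Y` commutes with `1 - 2a`, hence with `a`.
  have hY : Y * (1 - 2 • a) = (1 - 2 • a) * Y := by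
    have h := congrArg (partialTrace v (c * b)) hF'
    rw [partialTrace_comp_rTensor, partialTrace_rTensor_comp, partialTrace_lTensor_comp,
      partialTrace_comp_lTensor] at h
    have hcb : (1 - 2 • b) ∘ₗ ((c * b) ∘ₗ (1 - 2 • b)) = c * b := by
      change (1 - 2 • b) * (c * b * (1 - 2 • b)) = c * b
      rw [← mul_assoc, show (1 - 2 • b) * (c * b) = c * b * (1 - 2 • b) by
        rw [sub_mul, mul_sub, one_mul, mul_one, smul_mul_assoc, mul_smul_comm, ← mul_assoc, hbc],
        mul_assoc, ht, mul_one]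
    rw [hcb] at h
    exact h
  have hYa : Y * a = a * Y := by
    have h2 : (2 : ℂ) • (Y * a) = (2 : ℂ) • (a * Y) := by
      simp only [mul_sub, sub_mul, mul_one, one_mul, mul_smul_comm, smul_mul_assoc] at hY
      rw [sub_right_inj] at hY
      simpa [two_smul] using hY
    exact smul_right_injective _ two_ne_zero h2
  have e1 : partialTrace v c ((a.rTensor V ∘ₗ b.lTensor X) ∘ₗ F) = a * Y := by
    rw [LinearMap.comp_assoc, partialTrace_rTensor_comp, partialTrace_lTensor_comp]; rfl
  have hcomm : a.rTensor V ∘ₗ b.lTensor X = b.lTensor X ∘ₗ a.rTensor V := by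
    rw [LinearMap.lTensor_comp_rTensor, LinearMap.rTensor_comp_lTensor]
  have e2 : ∀ d, b * d = d * b → partialTrace v d (F ∘ₗ (a.rTensor V ∘ₗ b.lTensor X)) =
      partialTrace v (d * b) F * a := by
    intro d hd
    rw [hcomm, ← LinearMap.comp_assoc, partialTrace_comp_rTensor, partialTrace_comp_lTensor,
      ← hd]; rfl
  have e3 : partialTrace v c ((a.rTensor V ∘ₗ b.lTensor X) ∘ₗ F ∘ₗ
      (a.rTensor V ∘ₗ b.lTensor X)) = a * Y := by
    rw [LinearMap.comp_assoc, partialTrace_rTensor_comp, partialTrace_lTensor_comp,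
      ← Module.End.mul_eq_comp c, e2 (c * b) (by rw [← mul_assoc, hbc]), mul_assoc c, hb,
      ← Module.End.mul_eq_comp, hYa, ← mul_assoc, ha]
  have hexp : (1 + (u - 1) • (a.rTensor V ∘ₗ b.lTensor X)) ∘ₗ F ∘ₗ
      (1 + (u - 1) • (a.rTensor V ∘ₗ b.lTensor X)) =
      F + (u - 1) • ((a.rTensor V ∘ₗ b.lTensor X) ∘ₗ F) +
      (u - 1) • (F ∘ₗ (a.rTensor V ∘ₗ b.lTensor X)) +
      ((u - 1) * (u - 1)) • ((a.rTensor V ∘ₗ b.lTensor X) ∘ₗ F ∘ₗ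
        (a.rTensor V ∘ₗ b.lTensor X)) := by
    simp only [← Module.End.mul_eq_comp]
    simp only [add_mul, mul_add, one_mul, mul_one, smul_mul_assoc, mul_smul_comm, smul_add,
      smul_smul]
    abel
  rw [hexp]
  simp only [partialTrace_add, partialTrace_smul]
  rw [e1, e2 c hbc, e3, hYa, add_assoc, add_assoc]
  -- Two single corrections and a double one: `2(u - 1) + (u - 1)² = u² - 1 = 0`.
  have h0 : (u - 1) • (a * Y) + ((u - 1) • (a * Y) + ((u - 1) * (u - 1)) • (a * Y)) = 0 := by
    rw [← add_smul, ← add_smul, show u - 1 + (u - 1 + (u - 1) * (u - 1)) = u * u - 1 by ring, hu,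
      sub_self, zero_smul]
  rw [h0, add_zero]

end PartialTrace

end FDMod
end

noncomputable section

/-! ## Tensor products of projective modules -/

section HopfPair

variable {A : Type} [Ring A] [Algebra ℂ A]

/-- The algebra map `a ↦ a₁ ⊗ T(a₂)`. -/
def halfAntipode (D : A →ₐ[ℂ] A ⊗[ℂ] A) (T : A →ₐ[ℂ] Aᵐᵒᵖ) : A →ₐ[ℂ] A ⊗[ℂ] Aᵐᵒᵖ :=
  (Algebra.TensorProduct.map (AlgHom.id ℂ A) T).comp D

/-- `p ⊗ q ↦ D(p) (1 ⊗ q)`. -/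
def mulRightFold (D : A →ₐ[ℂ] A ⊗[ℂ] A) : A ⊗[ℂ] Aᵐᵒᵖ →ₗ[ℂ] A ⊗[ℂ] A :=
  TensorProduct.lift (LinearMap.mk₂ ℂ (fun p q => D p * (1 ⊗ₜ q.unop))
    (fun p p' q => by rw [map_add, add_mul])
    (fun r p q => by rw [map_smul, smul_mul_assoc])
    (fun p q q' => by rw [MulOpposite.unop_add, TensorProduct.tmul_add, mul_add])
    (fun r p q => by rw [MulOpposite.unop_smul, TensorProduct.tmul_smul, mul_smul_comm]))

/-- `p ⊗ q ↦ (1 ⊗ q c) D(p)`. -/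
def mulLeftFold (D : A →ₐ[ℂ] A ⊗[ℂ] A) (c : A) : A ⊗[ℂ] Aᵐᵒᵖ →ₗ[ℂ] A ⊗[ℂ] A :=
  TensorProduct.lift (LinearMap.mk₂ ℂ (fun p q => (1 ⊗ₜ (q.unop * c)) * D p)
    (fun p p' q => by rw [map_add, mul_add])
    (fun r p q => by rw [map_smul, mul_smul_comm])
    (fun p q q' => by rw [MulOpposite.unop_add, add_mul, TensorProduct.tmul_add, add_mul])
    (fun r p q => by
      rw [MulOpposite.unop_smul, smul_mul_assoc, TensorProduct.tmul_smul, smul_mul_assoc]))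

/-- `p ⊗ q ↦ p ⊗ q a`. -/
def unopMulRight (a : A) : A ⊗[ℂ] Aᵐᵒᵖ →ₗ[ℂ] A ⊗[ℂ] A :=
  (LinearMap.mulRight ℂ a ∘ₗ (MulOpposite.opLinearEquiv ℂ).symm.toLinearMap).lTensor A

theorem unopMulRight_tmul (a p : A) (q : Aᵐᵒᵖ) :
    unopMulRight a (p ⊗ₜ q) = p ⊗ₜ (q.unop * a) := rfl

/-- `p ⊗ q ↦ p₁ ⊗ T(p₂) q`. -/
def antipodeFold (D : A →ₐ[ℂ] A ⊗[ℂ] A) (T : A →ₐ[ℂ] Aᵐᵒᵖ) : A ⊗[ℂ] A →ₗ[ℂ] A ⊗[ℂ] A :=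
  TensorProduct.lift (LinearMap.mk₂ ℂ (fun p q => unopMulRight q (halfAntipode D T p))
    (fun p p' q => by rw [map_add, map_add])
    (fun r p q => by rw [map_smul, map_smul])
    (fun p q q' => by
      induction halfAntipode D T p with
      | zero => simp
      | tmul x y => simp only [unopMulRight_tmul, mul_add, TensorProduct.tmul_add]
      | add x y hx hy => simp only [map_add, hx, hy]; abel)
    (fun r p q => by
      induction halfAntipode D T p with
      | zero => simp
      | tmul x y => simp only [unopMulRight_tmul, mul_smul_comm, TensorProduct.tmul_smul]
      | add x y hx hy => simp only [map_add, hx, hy, smul_add]))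

variable (D : A →ₐ[ℂ] A ⊗[ℂ] A) (T : A →ₐ[ℂ] Aᵐᵒᵖ)

theorem mulRightFold_tmul (p : A) (q : Aᵐᵒᵖ) :
    mulRightFold D (p ⊗ₜ q) = D p * (1 ⊗ₜ q.unop) := rfl

theorem mulLeftFold_tmul (c p : A) (q : Aᵐᵒᵖ) :
    mulLeftFold D c (p ⊗ₜ q) = (1 ⊗ₜ (q.unop * c)) * D p := rfl

theorem antipodeFold_tmul (p q : A) :
    antipodeFold D T (p ⊗ₜ q) = unopMulRight q (halfAntipode D T p) := rfl

/-- `T` is an antipode for the coproduct `D`, and `c` is an element with `T(a) c = c T⁻¹(a)`,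
both expressed without coassociativity. -/
structure IsHopfPair (c : A) : Prop where
  right_fold : ∀ a, mulRightFold D (halfAntipode D T a) = a ⊗ₜ 1
  left_fold : ∀ a, mulLeftFold D c (halfAntipode D T a) = a ⊗ₜ c
  antipode_fold : ∀ a, antipodeFold D T (D a) = a ⊗ₜ 1

/-- If the inner fold collapses to `b ⊗ 1`, this passes through `1 ⊗ q`; so the folding identity is
stable under products and only has to be checked on generators. -/
theorem mulRightFold_mul (m n : A ⊗[ℂ] Aᵐᵒᵖ) {b : A} (h : mulRightFold D n = b ⊗ₜ 1) :
    mulRightFold D (m * n) = mulRightFold D m * (b ⊗ₜ 1) := by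
  have h1 : ∀ (p : A) (q : Aᵐᵒᵖ), mulRightFold D (p ⊗ₜ q * n) =
      D p * mulRightFold D n * (1 ⊗ₜ q.unop) := by
    intro p q
    clear h
    induction n with
    | zero => simp
    | tmul x y =>
      rw [Algebra.TensorProduct.tmul_mul_tmul, mulRightFold_tmul, mulRightFold_tmul, map_mul,
        MulOpposite.unop_mul, mul_assoc, mul_assoc, mul_assoc,
        Algebra.TensorProduct.tmul_mul_tmul, one_mul]
    | add x y hx hy => simp only [mul_add, map_add, add_mul, hx, hy]
  induction m with
  | zero => simp
  | tmul x y =>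
    rw [h1, h, mulRightFold_tmul, mul_assoc, mul_assoc, Algebra.TensorProduct.tmul_mul_tmul,
      Algebra.TensorProduct.tmul_mul_tmul, one_mul, one_mul, mul_one, mul_one]
  | add x y hx hy => simp only [add_mul, map_add, hx, hy]

/-- Here the left factor collapses first, and `(1 ⊗ q)(a ⊗ c) = (a ⊗ 1)(1 ⊗ q c)` restores the shape
of the fold. -/
theorem mulLeftFold_mul (c : A) (m n : A ⊗[ℂ] Aᵐᵒᵖ) {a : A} (h : mulLeftFold D c m = a ⊗ₜ c) :
    mulLeftFold D c (m * n) = (a ⊗ₜ 1) * mulLeftFold D c n := by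
  have h1 : ∀ (p : A) (q : Aᵐᵒᵖ), mulLeftFold D c (m * p ⊗ₜ q) =
      (1 ⊗ₜ q.unop) * mulLeftFold D c m * D p := by
    intro p q
    clear h
    induction m with
    | zero => simp
    | tmul x y =>
      rw [Algebra.TensorProduct.tmul_mul_tmul, mulLeftFold_tmul, mulLeftFold_tmul, map_mul,
        MulOpposite.unop_mul, ← mul_assoc, ← mul_assoc, Algebra.TensorProduct.tmul_mul_tmul,
        one_mul, mul_assoc q.unop]
    | add x y hx hy => simp only [mul_add, map_add, add_mul, hx, hy]
  induction n with
  | zero => simp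
  | tmul x y =>
    rw [h1, h, mulLeftFold_tmul, ← mul_assoc, Algebra.TensorProduct.tmul_mul_tmul,
      Algebra.TensorProduct.tmul_mul_tmul, one_mul, one_mul, mul_one]
  | add x y hx hy => simp only [mul_add, map_add, hx, hy]

theorem unopMulRight_mul_tmul (m : A ⊗[ℂ] Aᵐᵒᵖ) (q k r : A) (s : Aᵐᵒᵖ) :
    unopMulRight (q * k) (m * (r ⊗ₜ s)) = (1 ⊗ₜ s.unop) * unopMulRight q m * (r ⊗ₜ k) := by
  induction m with
  | zero => simp
  | tmul x y => simp [unopMulRight_tmul, mul_assoc]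
  | add x y hx hy => simp only [add_mul, mul_add, map_add, hx, hy]

theorem antipodeFold_mul (z z' : A ⊗[ℂ] A) {h : A} (hz : antipodeFold D T z = h ⊗ₜ 1) :
    antipodeFold D T (z * z') = (h ⊗ₜ 1) * antipodeFold D T z' := by
  obtain ⟨S, rfl⟩ := TensorProduct.exists_finset z
  induction z' with
  | zero => simp
  | add x y hx hy => simp only [mul_add, map_add, hx, hy]
  | tmul p k =>
    simp only [map_sum, antipodeFold_tmul] at hz
    simp only [Finset.sum_mul, map_sum, Algebra.TensorProduct.tmul_mul_tmul, antipodeFold_tmul,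
      map_mul]
    induction halfAntipode D T p with
    | zero => simp
    | add x y hx hy => simp only [mul_add, map_add, Finset.sum_add_distrib, hx, hy]
    | tmul r s =>
      simp only [unopMulRight_mul_tmul, ← Finset.sum_mul, ← Finset.mul_sum]
      rw [hz, unopMulRight_tmul]
      simp

end HopfPair

/-! ### Dual bases of tensor products -/

namespace FDMod

variable {A : Type} [Ring A] [Algebra ℂ A] (D : A →ₐ[ℂ] A ⊗[ℂ] A) (T : A →ₐ[ℂ] Aᵐᵒᵖ)

/-- The tensor product of modules with action through an algebra map `D : A → A ⊗ A`. -/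
abbrev tensorVia (X V : FDMod A) : FDMod A where
  carrier := X.carrier ⊗[ℂ] V.carrier
  ρ := (act₂ X V).comp D

theorem act₂_tmul (X V : FDMod A) (p q : A) :
    act₂ X V (p ⊗ₜ q) = TensorProduct.map (X.ρ p) (V.ρ q) := rfl

theorem act₂_tmul_tmul (X V : FDMod A) (p q : A) (x : X.carrier) (v : V.carrier) :
    act₂ X V (p ⊗ₜ q) (x ⊗ₜ v) = X.ρ p x ⊗ₜ V.ρ q v := rfl

theorem act₂_tmul_one (X V : FDMod A) (p : A) :
    act₂ X V (p ⊗ₜ 1) = (X.ρ p).rTensor V.carrier := by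
  rw [act₂_tmul, map_one]; rfl

theorem act₂_one_tmul (X V : FDMod A) (p : A) :
    act₂ X V (1 ⊗ₜ p) = (V.ρ p).lTensor X.carrier := by
  rw [act₂_tmul, map_one]; rfl

/-- `p ⊗ q ↦ (v ↦ ξ(q v) p)`. -/
def contractOp (V : FDMod A) (ξ : Module.Dual ℂ V.carrier) :
    A ⊗[ℂ] Aᵐᵒᵖ →ₗ[ℂ] V.carrier →ₗ[ℂ] A :=
  TensorProduct.lift (LinearMap.mk₂ ℂ
    (fun p q => LinearMap.toSpanSingleton ℂ A p ∘ₗ ξ ∘ₗ V.ρ q.unop)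
    (fun p p' q => by ext; simp)
    (fun r p q => by ext; simp [smul_smul, mul_comm])
    (fun p q q' => by ext; simp [add_smul])
    (fun r p q => by ext; simp [smul_smul]))

theorem contractOp_tmul (V : FDMod A) (ξ : Module.Dual ℂ V.carrier) (p : A) (q : Aᵐᵒᵖ)
    (v : V.carrier) : contractOp V ξ (p ⊗ₜ q) v = ξ (V.ρ q.unop v) • p := rfl

/-- The linear form `x ⊗ v ↦ ∑ ξ(T(a₂) v) a₁`, `a = φ(x)`, on a tensor product. -/
def tensorCoord {X : FDMod A} (φ : X.carrier →ₗ[ℂ] A) (V : FDMod A)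
    (ξ : Module.Dual ℂ V.carrier) : X.carrier ⊗[ℂ] V.carrier →ₗ[ℂ] A :=
  TensorProduct.lift (contractOp V ξ ∘ₗ (halfAntipode D T).toLinearMap ∘ₗ φ)

theorem tensorCoord_tmul {X : FDMod A} (φ : X.carrier →ₗ[ℂ] A) (V : FDMod A)
    (ξ : Module.Dual ℂ V.carrier) (x : X.carrier) (v : V.carrier) :
    tensorCoord D T φ V ξ (x ⊗ₜ v) = contractOp V ξ (halfAntipode D T (φ x)) v := rfl

variable {D T}

/-- In Sweedler terms, acting by `D a` contributes `a₁` and `T(a₂)` through the coordinate and `a₃`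
through `v`; `antipode_fold` cancels the last two and leaves the factor `a`. -/
theorem tensorCoord_act {c : A} (hD : IsHopfPair D T c) {X : FDMod A} {φ : X.carrier →ₗ[ℂ] A}
    (hφ : ∀ a x, φ (X.ρ a x) = a * φ x) (V : FDMod A) (ξ : Module.Dual ℂ V.carrier) (a : A)
    (w : X.carrier ⊗[ℂ] V.carrier) :
    tensorCoord D T φ V ξ (act₂ X V (D a) w) = a * tensorCoord D T φ V ξ w := by
  induction w with
  | zero => simp
  | add w w' hw hw' => simp only [map_add, mul_add, hw, hw']
  | tmul x v =>
    have ha := hD.antipode_fold a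
    rw [tensorCoord_tmul]
    obtain ⟨S, hS⟩ := TensorProduct.exists_finset (D a)
    rw [hS] at ha ⊢
    simp only [map_sum, antipodeFold_tmul] at ha
    simp only [map_sum, LinearMap.sum_apply, act₂_tmul_tmul, tensorCoord_tmul, hφ, map_mul]
    induction halfAntipode D T (φ x) with
    | zero => simp
    | add y y' hy hy' =>
      simp only [mul_add, map_add, LinearMap.add_apply, Finset.sum_add_distrib, hy, hy']
    | tmul r s =>
      -- A term `p ⊗ q` of `D a` enters the coordinate only through `p₁ ⊗ T(p₂) q`, which `Ξ` reads
      -- off.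
      let Ξ : A ⊗[ℂ] A →ₗ[ℂ] A := TensorProduct.lift (LinearMap.mk₂ ℂ
        (fun p q => ξ (V.ρ (s.unop * q) v) • (p * r))
        (fun p p' q => by rw [add_mul, smul_add])
        (fun c p q => by rw [smul_mul_assoc, smul_comm])
        (fun p q q' => by simp [mul_add, add_smul])
        (fun c p q => by simp [smul_smul]))
      have h1 : ∀ (m : A ⊗[ℂ] Aᵐᵒᵖ) (q : A),
          contractOp V ξ (m * r ⊗ₜ s) (V.ρ q v) = Ξ (unopMulRight q m) := by
        intro m q
        induction m with
        | zero => simp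
        | add y y' hy hy' => simp only [add_mul, map_add, LinearMap.add_apply, hy, hy']
        | tmul p' s' =>
          rw [Algebra.TensorProduct.tmul_mul_tmul, contractOp_tmul, unopMulRight_tmul]
          change _ = ξ (V.ρ (s.unop * (s'.unop * q)) v) • (p' * r)
          rw [map_mul V.ρ, map_mul V.ρ, MulOpposite.unop_mul, map_mul V.ρ]
          rfl
      simp only [h1, ← map_sum]
      rw [ha, contractOp_tmul]
      change ξ (V.ρ (s.unop * 1) v) • (a * r) = _
      rw [mul_one, mul_smul_comm]

/-- Summation over the basis of `V` reassembles `T(a₂) v`, so with `a = φ(x)` the sum is `D(a₁)(y ⊗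
T(a₂) v)`, which `right_fold` collapses. -/
theorem sum_tensorCoord {c : A} (hD : IsHopfPair D T c) {X : FDMod A}
    (φ : X.carrier →ₗ[ℂ] A) (V : FDMod A) {κ : Type} [Fintype κ]
    (b : Module.Basis κ ℂ V.carrier) (y x : X.carrier) (v : V.carrier) :
    ∑ j, act₂ X V (D (tensorCoord D T φ V (b.coord j) (x ⊗ₜ v))) (y ⊗ₜ b j) =
      X.ρ (φ x) y ⊗ₜ v := by
  have h1 : ∀ m : A ⊗[ℂ] Aᵐᵒᵖ, ∑ j, act₂ X V (D (contractOp V (b.coord j) m v)) (y ⊗ₜ b j) =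
      act₂ X V (mulRightFold D m) (y ⊗ₜ v) := by
    intro m
    induction m with
    | zero => simp
    | add m m' hm hm' =>
      simp only [map_add, LinearMap.add_apply, Finset.sum_add_distrib, hm, hm']
    | tmul p q =>
      rw [mulRightFold_tmul, map_mul, Module.End.mul_apply, act₂_tmul_tmul, map_one,
        Module.End.one_apply]
      conv_rhs => rw [← b.sum_repr (V.ρ q.unop v), TensorProduct.tmul_sum, map_sum]
      refine Finset.sum_congr rfl fun j _ => ?_
      rw [contractOp_tmul, map_smul, map_smul, LinearMap.smul_apply, TensorProduct.tmul_smul,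
        map_smul]
      rfl
  simp only [tensorCoord_tmul]
  rw [h1, hD.right_fold, act₂_tmul_tmul, map_one, Module.End.one_apply]

theorem sum_dualBasis_tensor {c : A} (hD : IsHopfPair D T c) {X : FDMod A} {ι : Type} [Fintype ι]
    (d : DualBasis X ι) (V : FDMod A) {κ : Type} [Fintype κ] (b : Module.Basis κ ℂ V.carrier)
    (w : X.carrier ⊗[ℂ] V.carrier) :
    ∑ k, ∑ j, act₂ X V (D (tensorCoord D T (d.coord k) V (b.coord j) w))
      (d.vec k ⊗ₜ b j) = w := by
  induction w with
  | zero => simp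
  | add w w' hw hw' =>
    simp only [map_add, LinearMap.add_apply, Finset.sum_add_distrib]
    rw [hw, hw']
  | tmul x v =>
    simp only [sum_tensorCoord hD]
    rw [← TensorProduct.sum_tmul, d.sum_coord]

/-- The dual basis `x_k ⊗ v_j` of a tensor product. -/
def DualBasis.tensor {c : A} (hD : IsHopfPair D T c) {X : FDMod A} {ι : Type} [Fintype ι]
    (d : DualBasis X ι) (V : FDMod A) {κ : Type} [Fintype κ] (b : Module.Basis κ ℂ V.carrier) :
    DualBasis (tensorVia D X V) (ι × κ) where
  vec := fun k => d.vec k.1 ⊗ₜ b k.2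
  coord := fun k => tensorCoord D T (d.coord k.1) V (b.coord k.2)
  coord_act := fun k => tensorCoord_act hD (d.coord_act k.1) V (b.coord k.2)
  sum_coord := fun w => (Fintype.sum_prod_type _).trans (sum_dualBasis_tensor hD d V b w)

/-- Applying `lam` to the leg `a₁` turns the leg `a₂` into `c` by the cointegral identity, hence
`T(a₂)` into `T(c)`. -/
theorem lam_tensorCoord {lam : A →ₗ[ℂ] ℂ} {c : A}
    (hlam : ∀ h, TensorProduct.lid ℂ A (lam.rTensor A (D h)) = lam h • c) {X : FDMod A}
    (φ : X.carrier →ₗ[ℂ] A) (V : FDMod A) (ξ : Module.Dual ℂ V.carrier)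
    (w : X.carrier ⊗[ℂ] V.carrier) :
    lam (tensorCoord D T φ V ξ w) = lam (φ (TensorProduct.rid ℂ X.carrier
      ((ξ ∘ₗ V.ρ (T c).unop).lTensor X.carrier w))) := by
  induction w with
  | zero => simp
  | add w w' hw hw' => simp only [map_add, hw, hw']
  | tmul x v =>
    have h1 : ∀ z : A ⊗[ℂ] A, lam (contractOp V ξ
        (Algebra.TensorProduct.map (AlgHom.id ℂ A) T z) v) =
        ξ (V.ρ (T (TensorProduct.lid ℂ A (lam.rTensor A z))).unop v) := by
      intro z
      induction z with
      | zero => simp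
      | add z z' hz hz' =>
        simp only [map_add, LinearMap.add_apply, hz, hz', MulOpposite.unop_add]
      | tmul p q =>
        rw [Algebra.TensorProduct.map_tmul, contractOp_tmul, LinearMap.rTensor_tmul,
          TensorProduct.lid_tmul, map_smul, map_smul, MulOpposite.unop_smul, map_smul,
          LinearMap.smul_apply, map_smul, smul_eq_mul, smul_eq_mul, mul_comm]
        rfl
    rw [tensorCoord_tmul]
    change lam (contractOp V ξ (Algebra.TensorProduct.map (AlgHom.id ℂ A) T (D (φ x))) v) = _
    rw [h1, hlam]
    simp [mul_comm]

/-- For the dual basis `x_k ⊗ v_j`, summing the previous identity over `j` is a partial trace over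
`V`. This is the algebraic core of compatibility with partial traces. -/
theorem DualBasis.trace_tensor {lam : A →ₗ[ℂ] ℂ} {c c' : A} (hD : IsHopfPair D T c')
    (hlam : ∀ h, TensorProduct.lid ℂ A (lam.rTensor A (D h)) = lam h • c) {X : FDMod A}
    {ι : Type} [Fintype ι] (d : DualBasis X ι) (V : FDMod A) {κ : Type} [Fintype κ]
    (b : Module.Basis κ ℂ V.carrier) (F : Module.End ℂ (X.carrier ⊗[ℂ] V.carrier)) :
    (d.tensor hD V b).trace lam F = d.trace lam (partialTrace b (V.ρ (T c).unop) F) := by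
  rw [trace_apply, trace_apply, Fintype.sum_prod_type]
  refine Finset.sum_congr rfl fun k _ => ?_
  rw [partialTrace_apply, map_sum, map_sum]
  exact Finset.sum_congr rfl fun j _ => lam_tensorCoord hlam _ _ _ _

/-- Write `a ⊗ 1` as a right fold. Moving `D(a₁)` across the intertwiner and cycling `T(a₂)` around
`V` produces the left fold, which is `a ⊗ c`. -/
theorem partialTrace_mem {c : A} (hD : IsHopfPair D T c) {X V : FDMod A} {κ : Type} [Fintype κ]
    (b : Module.Basis κ ℂ V.carrier) (F : Hom (tensorVia D X V) (tensorVia D X V)) :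
    partialTrace b (V.ρ c) F.1 ∈ Hom X X := by
  let Θ : A ⊗[ℂ] A →ₗ[ℂ] Module.End ℂ X.carrier := TensorProduct.lift (LinearMap.mk₂ ℂ
    (fun p q => X.ρ p * partialTrace b (V.ρ q) F.1)
    (fun p p' q => by rw [map_add, add_mul])
    (fun r p q => by rw [map_smul, smul_mul_assoc])
    (fun p q q' => by rw [map_add, partialTrace_add_left, mul_add])
    (fun r p q => by rw [map_smul, partialTrace_smul_left, mul_smul_comm]))
  have h1 : ∀ (y : A) (z : A ⊗[ℂ] A), partialTrace b (V.ρ y) (act₂ X V z ∘ₗ F.1) =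
      Θ ((1 ⊗ₜ y) * z) := by
    intro y z
    induction z with
    | zero => simp [partialTrace_zero]
    | add z z' hz hz' =>
      simp only [map_add, LinearMap.add_comp, partialTrace_add, mul_add, hz, hz']
    | tmul p q =>
      have h2 : act₂ X V (p ⊗ₜ q) = (X.ρ p).rTensor V.carrier ∘ₗ (V.ρ q).lTensor X.carrier := by
        rw [LinearMap.rTensor_comp_lTensor]; rfl
      rw [h2, LinearMap.comp_assoc, partialTrace_rTensor_comp, partialTrace_lTensor_comp,
        Algebra.TensorProduct.tmul_mul_tmul, one_mul]
      change _ = X.ρ p * partialTrace b (V.ρ (y * q)) F.1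
      rw [map_mul]; rfl
  have h3 : ∀ m : A ⊗[ℂ] Aᵐᵒᵖ, partialTrace b (V.ρ c) (F.1 ∘ₗ act₂ X V (mulRightFold D m)) =
      Θ (mulLeftFold D c m) := by
    intro m
    induction m with
    | zero => simp [partialTrace_zero]
    | add m m' hm hm' =>
      simp only [map_add, LinearMap.comp_add, partialTrace_add, hm, hm']
    | tmul p q =>
      rw [mulRightFold_tmul, mulLeftFold_tmul, map_mul, act₂_one_tmul, Module.End.mul_eq_comp,
        ← LinearMap.comp_assoc, partialTrace_comp_lTensor, ← h1, map_mul]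
      exact congrArg (partialTrace b _) (F.2 p)
  intro a
  have h4 := h3 (halfAntipode D T a)
  rw [hD.right_fold, hD.left_fold, act₂_tmul_one, partialTrace_comp_rTensor] at h4
  exact h4

end FDMod
end

noncomputable section

/-! ## Partial traces for a coassociator concentrated on a central idempotent -/

namespace FDMod

variable {A : Type} [Ring A] [Algebra ℂ A]

theorem act₃_tmul (X Y Z : FDMod A) (a b c : A) (x : X.carrier) (y : Y.carrier) (z : Z.carrier) :
    act₃ X Y Z (a ⊗ₜ (b ⊗ₜ c)) (x ⊗ₜ (y ⊗ₜ z)) = X.ρ a x ⊗ₜ (Y.ρ b y ⊗ₜ Z.ρ c z) := rfl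

theorem dual_ρ_apply (Q : QuasiHopfData A) (V : FDMod A) (a : A)
    (ξ : Module.Dual ℂ V.carrier) : (dual Q V).ρ a ξ = ξ ∘ₗ V.ρ (Q.antipode a) := rfl

/-- The coassociator and its inverse are `1 + (u - 1) e ⊗ e ⊗ e` for a central idempotent `e`
fixed by the antipode, with `u² = 1`, and the evaluation element is trivial. -/
structure HasSignCoassociator (Q : QuasiHopfData A) (u : ℂ) (e : A) : Prop where
  sq : u * u = 1
  Φ_eq : Q.Φ = 1 + (u - 1) • (e ⊗ₜ (e ⊗ₜ e))
  Φinv_eq : Q.Φinv = 1 + (u - 1) • (e ⊗ₜ (e ⊗ₜ e))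
  α_eq : Q.α = 1
  antipode_eq : Q.antipode e = e
  central : ∀ a, e * a = a * e
  idem : e * e = e

variable {Q : QuasiHopfData A} {u : ℂ} {e : A}

/-- The operator `1 + (u - 1) e ⊗ e` on a tensor product. -/
def signOp (u : ℂ) (e : A) (X V : FDMod A) : Module.End ℂ (X.carrier ⊗[ℂ] V.carrier) :=
  1 + (u - 1) • ((X.ρ e).rTensor V.carrier ∘ₗ (V.ρ e).lTensor X.carrier)

theorem signOp_tmul (X V : FDMod A) (x : X.carrier) (v : V.carrier) :
    signOp u e X V (x ⊗ₜ v) = x ⊗ₜ v + (u - 1) • (X.ρ e x ⊗ₜ V.ρ e v) := by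
  simp [signOp]

theorem act₃_sign (X Y Z : FDMod A) (x : X.carrier) (y : Y.carrier) (z : Z.carrier) :
    act₃ X Y Z (1 + (u - 1) • (e ⊗ₜ (e ⊗ₜ e))) (x ⊗ₜ (y ⊗ₜ z)) =
      x ⊗ₜ (y ⊗ₜ z) + (u - 1) • (X.ρ e x ⊗ₜ (Y.ρ e y ⊗ₜ Z.ρ e z)) := by
  rw [map_add, map_smul, map_one, LinearMap.add_apply, LinearMap.smul_apply, act₃_tmul]
  rfl

theorem act₃_Φ_right (hQ : HasSignCoassociator Q u e) (X V : FDMod A) (x : X.carrier)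
    (v : V.carrier) (ξ : Module.Dual ℂ V.carrier) :
    act₃ X V (dual Q V) Q.Φ (x ⊗ₜ (v ⊗ₜ ξ)) =
      x ⊗ₜ (v ⊗ₜ ξ) + (u - 1) • (X.ρ e x ⊗ₜ (V.ρ e v ⊗ₜ (ξ ∘ₗ V.ρ e))) := by
  rw [hQ.Φ_eq]
  refine (act₃_sign X V (dual Q V) x v ξ).trans ?_
  rw [dual_ρ_apply, hQ.antipode_eq]

theorem act₃_Φ_left (hQ : HasSignCoassociator Q u e) (X V : FDMod A) (x : X.carrier)
    (v : V.carrier) (ξ : Module.Dual ℂ V.carrier) :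
    act₃ (dual Q V) V X Q.Φ (ξ ⊗ₜ (v ⊗ₜ x)) =
      ξ ⊗ₜ (v ⊗ₜ x) + (u - 1) • ((ξ ∘ₗ V.ρ e) ⊗ₜ (V.ρ e v ⊗ₜ X.ρ e x)) := by
  rw [hQ.Φ_eq]
  refine (act₃_sign (dual Q V) V X ξ v x).trans ?_
  rw [dual_ρ_apply, hQ.antipode_eq]

theorem Φinv_eq_Φ (hQ : HasSignCoassociator Q u e) : Q.Φinv = Q.Φ :=
  hQ.Φinv_eq.trans hQ.Φ_eq.symm

theorem ρ_comm_apply {V : FDMod A} {a b : A} (h : a * b = b * a) (v : V.carrier) :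
    V.ρ a (V.ρ b v) = V.ρ b (V.ρ a v) := by
  rw [← Module.End.mul_apply, ← map_mul, h, map_mul, Module.End.mul_apply]

theorem ρ_idem_apply (hQ : HasSignCoassociator Q u e) {V : FDMod A} (v : V.carrier) :
    V.ρ e (V.ρ e v) = V.ρ e v := by
  rw [← Module.End.mul_apply, ← map_mul, hQ.idem]

/-- The idempotent on the dual leg slides across the coevaluation to `V`, where the copy of `e`
already present absorbs it. The coassociator thus acts on `X ⊗ V` alone. -/
theorem signOp_coev (hQ : HasSignCoassociator Q u e) (X V : FDMod A) (x : X.carrier) :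
    (TensorProduct.assoc ℂ X.carrier V.carrier (Module.Dual ℂ V.carrier)).symm
      (act₃ X V (dual Q V) Q.Φ (x ⊗ₜ coev Q V)) =
    ∑ j, signOp u e X V (x ⊗ₜ V.ρ Q.β (Module.Basis.ofVectorSpace ℂ V.carrier j)) ⊗ₜ
      (Module.Basis.ofVectorSpace ℂ V.carrier).coord j := by
  have hcoev : coev Q V = ∑ j, V.ρ Q.β (Module.Basis.ofVectorSpace ℂ V.carrier j) ⊗ₜ
      (Module.Basis.ofVectorSpace ℂ V.carrier).coord j := by
    rw [coev, coevaluation_apply_one]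
    simp only [map_sum, LinearMap.rTensor_tmul]
  rw [hcoev]
  simp only [TensorProduct.tmul_sum, map_sum, act₃_Φ_right hQ, map_add, map_smul,
    TensorProduct.assoc_symm_tmul, signOp_tmul, TensorProduct.add_tmul, Finset.sum_add_distrib]
  congr 1
  simp only [← TensorProduct.smul_tmul', ← Finset.smul_sum]
  congr 1
  let B : Module.Dual ℂ V.carrier →ₗ[ℂ] V.carrier →ₗ[ℂ]
      (X.carrier ⊗[ℂ] V.carrier) ⊗[ℂ] Module.Dual ℂ V.carrier :=
    LinearMap.mk₂ ℂ (fun ξ w => (X.ρ e x ⊗ₜ V.ρ e (V.ρ Q.β w)) ⊗ₜ ξ)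
      (fun ξ ξ' w => by rw [TensorProduct.tmul_add])
      (fun r ξ w => by rw [TensorProduct.tmul_smul])
      (fun ξ w w' => by simp only [map_add, TensorProduct.tmul_add, TensorProduct.add_tmul])
      (fun r ξ w => by simp only [map_smul, TensorProduct.tmul_smul, TensorProduct.smul_tmul'])
  refine (sum_coord_apply (Module.Basis.ofVectorSpace ℂ V.carrier) B (V.ρ e)).symm.trans ?_
  refine Finset.sum_congr rfl fun j _ => ?_
  change (X.ρ e x ⊗ₜ V.ρ e (V.ρ Q.β (V.ρ e _))) ⊗ₜ[ℂ] _ = _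
  rw [← ρ_comm_apply (hQ.central Q.β), ρ_idem_apply hQ]

/-- Likewise, the two copies of `e` that meet in the evaluation merge into one. -/
theorem evPiv_signOp (hQ : HasSignCoassociator Q u e) (X V : FDMod A)
    (y : X.carrier ⊗[ℂ] V.carrier) (ξ : Module.Dual ℂ V.carrier) :
    TensorProduct.rid ℂ X.carrier ((evPiv Q V).lTensor X.carrier (act₃ X V (dual Q V) Q.Φinv
      (TensorProduct.assoc ℂ X.carrier V.carrier (Module.Dual ℂ V.carrier) (y ⊗ₜ ξ)))) =
    TensorProduct.rid ℂ X.carrier ((ξ ∘ₗ V.ρ Q.g).lTensor X.carrier (signOp u e X V y)) := by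
  induction y with
  | zero => simp
  | add y y' hy hy' => simp only [TensorProduct.add_tmul, map_add, hy, hy']
  | tmul x v =>
    have hev : ∀ (w : V.carrier) (η : Module.Dual ℂ V.carrier),
        evPiv Q V (w ⊗ₜ η) = η (V.ρ Q.g w) := by
      intro w η
      simp [evPiv, hQ.α_eq, QuasiHopfData.antipode_one]
    rw [TensorProduct.assoc_tmul, Φinv_eq_Φ hQ, act₃_Φ_right hQ, signOp_tmul]
    simp only [map_add, map_smul, LinearMap.lTensor_tmul, hev, LinearMap.comp_apply]
    rw [ρ_comm_apply (hQ.central Q.g).symm v, ρ_idem_apply hQ]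

theorem rightPartialTrace_eq (hQ : HasSignCoassociator Q u e) (X V : FDMod A)
    (F : Module.End ℂ (X.carrier ⊗[ℂ] V.carrier)) :
    rightPartialTrace Q X V F = partialTrace (Module.Basis.ofVectorSpace ℂ V.carrier) (V.ρ Q.g)
      ((signOp u e X V ∘ₗ F ∘ₗ signOp u e X V) ∘ₗ (V.ρ Q.β).lTensor X.carrier) := by
  ext x
  rw [partialTrace_apply]
  change TensorProduct.rid ℂ X.carrier ((evPiv Q V).lTensor X.carrier
    (act₃ X V (dual Q V) Q.Φinv (TensorProduct.assoc ℂ X.carrier V.carrier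
      (Module.Dual ℂ V.carrier) (F.rTensor (Module.Dual ℂ V.carrier)
        ((TensorProduct.assoc ℂ X.carrier V.carrier (Module.Dual ℂ V.carrier)).symm
          (act₃ X V (dual Q V) Q.Φ (x ⊗ₜ coev Q V))))))) = _
  rw [signOp_coev hQ]
  simp only [map_sum, LinearMap.rTensor_tmul]
  refine Finset.sum_congr rfl fun j _ => ?_
  rw [evPiv_signOp hQ]
  simp only [LinearMap.comp_apply, LinearMap.lTensor_tmul]

theorem signOp_coevPiv (hQ : HasSignCoassociator Q u e) (X V : FDMod A) (x : X.carrier) :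
    act₃ (dual Q V) V X Q.Φinv
      (TensorProduct.assoc ℂ (Module.Dual ℂ V.carrier) V.carrier X.carrier
        (coevPiv Q V ⊗ₜ x)) =
    ∑ j, (Module.Basis.ofVectorSpace ℂ V.carrier).coord j ⊗ₜ signOp u e V X
      (V.ρ (Q.antipodeInv (Q.g * Q.β)) (Module.Basis.ofVectorSpace ℂ V.carrier j) ⊗ₜ x) := by
  have hcoev : coevPiv Q V = ∑ j, (Module.Basis.ofVectorSpace ℂ V.carrier).coord j ⊗ₜ
      V.ρ (Q.antipodeInv (Q.g * Q.β)) (Module.Basis.ofVectorSpace ℂ V.carrier j) := by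
    rw [coevPiv, coevaluation_apply_one]
    simp only [map_sum, TensorProduct.comm_tmul, LinearMap.lTensor_tmul]
  rw [hcoev, Φinv_eq_Φ hQ]
  generalize Q.antipodeInv (Q.g * Q.β) = c
  simp only [TensorProduct.sum_tmul, map_sum, TensorProduct.assoc_tmul, act₃_Φ_left hQ,
    signOp_tmul, TensorProduct.tmul_add, Finset.sum_add_distrib,
    TensorProduct.tmul_smul]
  congr 1
  simp only [← Finset.smul_sum]
  congr 1
  let B : Module.Dual ℂ V.carrier →ₗ[ℂ] V.carrier →ₗ[ℂ]
      Module.Dual ℂ V.carrier ⊗[ℂ] (V.carrier ⊗[ℂ] X.carrier) :=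
    LinearMap.mk₂ ℂ (fun ξ w => ξ ⊗ₜ (V.ρ e (V.ρ c w) ⊗ₜ X.ρ e x))
      (fun ξ ξ' w => by rw [TensorProduct.add_tmul])
      (fun r ξ w => by rw [TensorProduct.smul_tmul'])
      (fun ξ w w' => by simp only [map_add, TensorProduct.tmul_add, TensorProduct.add_tmul])
      (fun r ξ w => by
        simp only [map_smul, TensorProduct.tmul_smul, ← TensorProduct.smul_tmul'])
  refine (sum_coord_apply (Module.Basis.ofVectorSpace ℂ V.carrier) B (V.ρ e)).symm.trans ?_
  refine Finset.sum_congr rfl fun j _ => ?_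
  change _ ⊗ₜ[ℂ] (V.ρ e (V.ρ c (V.ρ e _)) ⊗ₜ X.ρ e x) = _
  rw [← ρ_comm_apply (hQ.central c), ρ_idem_apply hQ]

theorem ev_signOp (hQ : HasSignCoassociator Q u e) (X V : FDMod A)
    (y : V.carrier ⊗[ℂ] X.carrier) (ξ : Module.Dual ℂ V.carrier) :
    TensorProduct.lid ℂ X.carrier ((ev Q V).rTensor X.carrier
      ((TensorProduct.assoc ℂ (Module.Dual ℂ V.carrier) V.carrier X.carrier).symm
        (act₃ (dual Q V) V X Q.Φ (ξ ⊗ₜ y)))) =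
    TensorProduct.lid ℂ X.carrier (ξ.rTensor X.carrier (signOp u e V X y)) := by
  induction y with
  | zero => simp
  | add y y' hy hy' => simp only [TensorProduct.tmul_add, map_add, hy, hy']
  | tmul v x =>
    have hev : ∀ (w : V.carrier) (η : Module.Dual ℂ V.carrier),
        ev Q V (η ⊗ₜ w) = η w := by
      intro w η
      simp [ev, hQ.α_eq]
    rw [act₃_Φ_left hQ, signOp_tmul]
    simp only [map_add, map_smul, TensorProduct.assoc_symm_tmul, LinearMap.rTensor_tmul, hev,
      LinearMap.comp_apply]
    rw [ρ_idem_apply hQ]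

theorem comm_signOp (X V : FDMod A) (y : X.carrier ⊗[ℂ] V.carrier) :
    signOp u e V X (TensorProduct.comm ℂ X.carrier V.carrier y) =
      TensorProduct.comm ℂ X.carrier V.carrier (signOp u e X V y) := by
  induction y with
  | zero => simp
  | add y y' hy hy' => simp only [map_add, hy, hy']
  | tmul v x => simp only [TensorProduct.comm_tmul, signOp_tmul, map_add, map_smul]

theorem lid_rTensor_comm {X V : Type} [AddCommGroup X] [Module ℂ X] [AddCommGroup V] [Module ℂ V]
    (ξ : Module.Dual ℂ V) (y : V ⊗[ℂ] X) :
    TensorProduct.lid ℂ X (ξ.rTensor X y) =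
      TensorProduct.rid ℂ X (ξ.lTensor X (TensorProduct.comm ℂ V X y)) := by
  induction y with
  | zero => simp
  | add y y' hy hy' => simp only [map_add, hy, hy']
  | tmul v x => simp

/-- Conjugation of an endomorphism of `V ⊗ X` to `X ⊗ V`. -/
def flipEnd {X V : Type} [AddCommGroup X] [Module ℂ X] [AddCommGroup V] [Module ℂ V]
    (F : Module.End ℂ (V ⊗[ℂ] X)) : Module.End ℂ (X ⊗[ℂ] V) :=
  (TensorProduct.comm ℂ V X).toLinearMap ∘ₗ F ∘ₗ (TensorProduct.comm ℂ X V).toLinearMap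

theorem leftPartialTrace_eq (hQ : HasSignCoassociator Q u e) (X V : FDMod A)
    (F : Module.End ℂ (V.carrier ⊗[ℂ] X.carrier)) :
    leftPartialTrace Q X V F = partialTrace (Module.Basis.ofVectorSpace ℂ V.carrier) 1
      ((signOp u e X V ∘ₗ flipEnd F ∘ₗ signOp u e X V) ∘ₗ
        (V.ρ (Q.antipodeInv (Q.g * Q.β))).lTensor X.carrier) := by
  ext x
  rw [partialTrace_apply]
  change TensorProduct.lid ℂ X.carrier ((ev Q V).rTensor X.carrier
      ((TensorProduct.assoc ℂ (Module.Dual ℂ V.carrier) V.carrier X.carrier).symm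
        (act₃ (dual Q V) V X Q.Φ (F.lTensor (Module.Dual ℂ V.carrier)
          (act₃ (dual Q V) V X Q.Φinv
      (TensorProduct.assoc ℂ (Module.Dual ℂ V.carrier) V.carrier X.carrier
        (coevPiv Q V ⊗ₜ x))))))) = _
  rw [signOp_coevPiv hQ]
  simp only [map_sum, LinearMap.lTensor_tmul]
  refine Finset.sum_congr rfl fun j _ => ?_
  rw [ev_signOp hQ, lid_rTensor_comm]
  simp only [LinearMap.comp_apply, LinearMap.lTensor_tmul, flipEnd, LinearEquiv.coe_coe,
    ← comm_signOp]
  rw [TensorProduct.comm_tmul]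
  rfl

/-! ### Modified traces -/

/-- As `1 - 2e` is grouplike, commuting with its action is the commutation hypothesis of
`partialTrace_conj`. -/
theorem sign_comm_of_mem {D : A →ₐ[ℂ] A ⊗[ℂ] A}
    (hD : D (1 - 2 • e) = (1 - 2 • e) ⊗ₜ (1 - 2 • e)) {X V : FDMod A}
    (F : Hom (tensorVia D X V) (tensorVia D X V)) :
    F.1 ∘ₗ (1 - 2 • X.ρ e).rTensor V.carrier ∘ₗ (1 - 2 • V.ρ e).lTensor X.carrier =
      (1 - 2 • X.ρ e).rTensor V.carrier ∘ₗ (1 - 2 • V.ρ e).lTensor X.carrier ∘ₗ F.1 := by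
  have h := F.2 (1 - 2 • e)
  have h1 : (tensorVia D X V).ρ (1 - 2 • e) =
      (1 - 2 • X.ρ e).rTensor V.carrier ∘ₗ (1 - 2 • V.ρ e).lTensor X.carrier := by
    change act₂ X V (D (1 - 2 • e)) = _
    rw [hD, act₂_tmul, LinearMap.rTensor_comp_lTensor]
    simp only [map_sub, map_one, map_nsmul]
  rw [h1] at h
  rw [h, LinearMap.comp_assoc]

theorem rightPartialTrace_eq_of_mem (hQ : HasSignCoassociator Q u e)
    (hΔ : Q.Δ (1 - 2 • e) = (1 - 2 • e) ⊗ₜ (1 - 2 • e)) {X V : FDMod A}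
    (F : Hom (tensor Q X V) (tensor Q X V)) :
    rightPartialTrace Q X V F.1 = partialTrace (Module.Basis.ofVectorSpace ℂ V.carrier)
      (V.ρ (Q.β * Q.g)) F.1 := by
  rw [rightPartialTrace_eq hQ, partialTrace_comp_lTensor, ← Module.End.mul_eq_comp, ← map_mul]
  refine partialTrace_conj _ hQ.sq ?_ ?_ ?_ (sign_comm_of_mem hΔ F)
  · rw [← map_mul, hQ.idem]
  · rw [← map_mul, hQ.idem]
  · rw [← map_mul, hQ.central, map_mul]

/-- On module endomorphisms the coassociator drops out of the partial trace, leaving the weight `c =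
𝛃 g`; the Hattori–Stallings trace of a tensor product has weight `S(c)`, and the two agree. -/
theorem hsTrace_isRightModifiedTrace (hQ : HasSignCoassociator Q u e)
    (hΔ : Q.Δ (1 - 2 • e) = (1 - 2 • e) ⊗ₜ (1 - 2 • e)) {c : A} (hc : Q.β * Q.g = c)
    (hS : Q.antipode c = c) (hD : IsHopfPair Q.Δ (Q.S : A →ₐ[ℂ] Aᵐᵒᵖ) c) {lam : A →ₗ[ℂ] ℂ}
    (hsym : ∀ x y, lam (x * y) = lam (y * x))
    (hlam : ∀ h, TensorProduct.lid ℂ A (lam.rTensor A (Q.Δ h)) = lam h • c) :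
    (hsTrace lam).IsRightModifiedTrace Q := by
  refine ⟨hsTrace_isCyclic hsym, fun X V hX => ?_⟩
  let d := hX.dualBasis.tensor hD V (Module.Basis.ofVectorSpace ℂ V.carrier)
  refine ⟨d.isProjective, fun F => ?_⟩
  have h1 := rightPartialTrace_eq_of_mem hQ hΔ F
  rw [hc] at h1
  refine ⟨h1 ▸ partialTrace_mem hD _ F, ?_⟩
  rw [hsTrace_eq d hsym, hsTrace_eq hX.dualBasis hsym]
  refine (hX.dualBasis.trace_tensor hD hlam V _ F.1).trans ?_
  change _ = hX.dualBasis.trace lam (rightPartialTrace Q X V F.1)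
  rw [h1]
  exact congrArg (fun y => hX.dualBasis.trace lam (partialTrace _ (V.ρ y) F.1)) hS

/-- The opposite of the coproduct. -/
def coopΔ (Q : QuasiHopfData A) : A →ₐ[ℂ] A ⊗[ℂ] A :=
  (Algebra.TensorProduct.comm ℂ A A : A ⊗[ℂ] A →ₐ[ℂ] A ⊗[ℂ] A).comp Q.Δ

/-- The inverse antipode as an algebra map to the opposite algebra. -/
def antipodeInvOp (Q : QuasiHopfData A) : A →ₐ[ℂ] Aᵐᵒᵖ :=
  AlgHom.opComm.symm (Q.S.symm : Aᵐᵒᵖ →ₐ[ℂ] A)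

theorem antipodeInvOp_apply (Q : QuasiHopfData A) (a : A) :
    antipodeInvOp Q a = MulOpposite.op (Q.antipodeInv a) := rfl

theorem comm_act₂ (X V : FDMod A) (z : A ⊗[ℂ] A) (w : V.carrier ⊗[ℂ] X.carrier) :
    TensorProduct.comm ℂ V.carrier X.carrier (act₂ V X z w) =
      act₂ X V (Algebra.TensorProduct.comm ℂ A A z)
        (TensorProduct.comm ℂ V.carrier X.carrier w) := by
  induction z with
  | zero => simp
  | add y y' hy hy' => simp only [map_add, LinearMap.add_apply, hy, hy']
  | tmul p q =>
    induction w with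
    | zero => simp
    | add y y' hy hy' => simp only [map_add, hy, hy']
    | tmul v x => rfl

/-- The flip `V ⊗ X → X ⊗ V`, where the target has the opposite tensor product action. -/
def flipHom (Q : QuasiHopfData A) (X V : FDMod A) :
    Hom (tensor Q V X) (tensorVia (coopΔ Q) X V) :=
  ⟨(TensorProduct.comm ℂ V.carrier X.carrier).toLinearMap, fun a =>
    LinearMap.ext fun w => comm_act₂ X V (Q.Δ a) w⟩

/-- The inverse of `flipHom`. -/
def flipHomInv (Q : QuasiHopfData A) (X V : FDMod A) :
    Hom (tensorVia (coopΔ Q) X V) (tensor Q V X) :=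
  ⟨(TensorProduct.comm ℂ X.carrier V.carrier).toLinearMap, fun a =>
    LinearMap.ext fun w => by
      refine (comm_act₂ V X (coopΔ Q a) w).trans ?_
      change act₂ V X (Algebra.TensorProduct.comm ℂ A A
        (Algebra.TensorProduct.comm ℂ A A (Q.Δ a))) _ = _
      rw [show Algebra.TensorProduct.comm ℂ A A (Algebra.TensorProduct.comm ℂ A A (Q.Δ a)) = Q.Δ a
        from TensorProduct.comm_comm _ _ _ (Q.Δ a)]
      rfl⟩

/-- Transport of a dual basis along an isomorphism. -/
def DualBasis.ofIso {X Y : FDMod A} {ι : Type} [Fintype ι] (d : DualBasis X ι) (i : Hom X Y)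
    (j : Hom Y X) (hij : ∀ y, i.1 (j.1 y) = y) : DualBasis Y ι where
  vec := fun k => i.1 (d.vec k)
  coord := fun k => d.coord k ∘ₗ j.1
  coord_act := fun k a y => by
    rw [LinearMap.comp_apply, Hom.apply, d.coord_act]; rfl
  sum_coord := fun y => by
    simp only [LinearMap.comp_apply, ← Hom.apply]
    rw [← map_sum, d.sum_coord, hij]

/-- After a flip, `V ⊗ X` is a tensor product for the opposite coproduct with antipode `S⁻¹`, and
the left partial trace becomes a weighted partial trace over the second factor. -/
theorem hsTrace_isLeftModifiedTrace (hQ : HasSignCoassociator Q u e)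
    (hΔ : Q.Δ (1 - 2 • e) = (1 - 2 • e) ⊗ₜ (1 - 2 • e)) {c : A} (hc : Q.g * Q.β = c)
    (hS : Q.antipodeInv c = c) (hD : IsHopfPair (coopΔ Q) (antipodeInvOp Q) c) {lam : A →ₗ[ℂ] ℂ}
    (hsym : ∀ x y, lam (x * y) = lam (y * x))
    (hlam : ∀ h, TensorProduct.lid ℂ A (lam.rTensor A (coopΔ Q h)) = lam h • c) :
    (hsTrace lam).IsLeftModifiedTrace Q := by
  refine ⟨hsTrace_isCyclic hsym, fun X V hX => ?_⟩
  let d := hX.dualBasis.tensor hD V (Module.Basis.ofVectorSpace ℂ V.carrier)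
  have hd : (tensorVia (coopΔ Q) X V).IsProjective := d.isProjective
  have hVX : (tensor Q V X).IsProjective :=
    (d.ofIso (flipHomInv Q X V) (flipHom Q X V)
      (fun y => TensorProduct.comm_comm _ _ _ y)).isProjective
  refine ⟨hVX, fun F => ?_⟩
  let G : Hom (tensorVia (coopΔ Q) X V) (tensorVia (coopΔ Q) X V) :=
    comp (flipHom Q X V) (comp F (flipHomInv Q X V))
  have hΔ' : coopΔ Q (1 - 2 • e) = (1 - 2 • e) ⊗ₜ (1 - 2 • e) := by
    change Algebra.TensorProduct.comm ℂ A A (Q.Δ (1 - 2 • e)) = _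
    rw [hΔ]; rfl
  have h1 : leftPartialTrace Q X V F.1 =
      partialTrace (Module.Basis.ofVectorSpace ℂ V.carrier) (V.ρ c) G.1 := by
    rw [leftPartialTrace_eq hQ, partialTrace_comp_lTensor, hc, hS]
    refine partialTrace_conj _ hQ.sq ?_ ?_ ?_ (sign_comm_of_mem hΔ' G)
    · rw [← map_mul, hQ.idem]
    · rw [← map_mul, hQ.idem]
    · exact (map_mul V.ρ e c).symm.trans ((congrArg V.ρ (hQ.central c)).trans (map_mul V.ρ c e))
  refine ⟨h1 ▸ partialTrace_mem hD _ G, ?_⟩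
  have h2 : F = comp (flipHomInv Q X V) (comp (flipHom Q X V) F) := by
    apply Subtype.ext
    exact LinearMap.ext fun w => (TensorProduct.comm_comm _ _ _ (F.1 w)).symm
  have h3 : hsTrace lam (tensor Q V X) hVX F = hsTrace lam (tensorVia (coopΔ Q) X V) hd G := by
    conv_lhs => rw [h2]
    exact hsTrace_isCyclic hsym _ _ hVX hd (comp (flipHom Q X V) F) (flipHomInv Q X V)
  rw [h3, hsTrace_eq d hsym, hsTrace_eq hX.dualBasis hsym]
  refine (hX.dualBasis.trace_tensor hD hlam V _ G.1).trans ?_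
  change _ = hX.dualBasis.trace lam (leftPartialTrace Q X V F.1)
  rw [h1, antipodeInvOp_apply, hS, MulOpposite.unop_op]

end FDMod
end

noncomputable section

/-! ## Adding a pair of fermions: right multiplication on `1, f⁺, f⁻, f⁺f⁻` -/

namespace SF

section Extension

variable {B : Type} [Ring B]

/-- The matrix of right multiplication by an element which commutes with even and anticommutes
with odd products of the new generators. -/
def oddDiag (x : B) : Matrix (Fin 4) (Fin 4) B := Matrix.diagonal ![x, -x, -x, x]

theorem oddDiag_mul (x y : B) : oddDiag x * oddDiag y = Matrix.diagonal fun _ => x * y := by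
  rw [oddDiag, oddDiag, Matrix.diagonal_mul_diagonal]
  congr 1
  ext i
  fin_cases i <;> simp

theorem oddDiag_pow_four {k : B} (hk : k ^ 4 = 1) : oddDiag k ^ 4 = 1 := by
  rw [oddDiag, Matrix.diagonal_pow, ← Matrix.diagonal_one]
  congr 1
  ext i
  fin_cases i <;> simp [hk, Even.neg_pow (show Even 4 by decide)]

variable [Algebra ℂ B] {N : ℕ}

/-- The matrices of right multiplication by the new generators `f^±`. -/
def newFermion (k : B) (s : Bool) : Matrix (Fin 4) (Fin 4) B :=
  if s then !![0, 1, 0, 0; 0, 0, 0, 0; idem1 k, 0, 0, -1; 0, idem1 k, 0, 0]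
  else !![0, 0, 1, 0; 0, 0, 0, 1; 0, 0, 0, 0; 0, 0, 0, 0]

/-- The matrices of right multiplication by all generators `f_i^±`. -/
def extFermion (k : B) (φ : Fin N → Bool → B) (i : Fin (N + 1)) (s : Bool) :
    Matrix (Fin 4) (Fin 4) B :=
  Fin.lastCases (motive := fun _ => Matrix (Fin 4) (Fin 4) B) (newFermion k s)
    (fun j => oddDiag (φ j s)) i

theorem extFermion_last (k : B) (φ : Fin N → Bool → B) (s : Bool) :
    extFermion k φ (Fin.last N) s = newFermion k s := Fin.lastCases_last

theorem extFermion_castSucc (k : B) (φ : Fin N → Bool → B) (j : Fin N) (s : Bool) :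
    extFermion k φ j.castSucc s = oddDiag (φ j s) := Fin.lastCases_castSucc j

theorem idem1_oddDiag (k : B) : idem1 (oddDiag k) = Matrix.diagonal fun _ => idem1 k := by
  rw [idem1, pow_two, oddDiag_mul, ← Matrix.diagonal_one, Matrix.diagonal_sub,
    ← Matrix.diagonal_smul]
  congr 1
  ext i
  simp [idem1, pow_two]

theorem newFermion_mul_oddDiag {k x : B} (h : x * idem1 k = idem1 k * x) (s : Bool) :
    newFermion k s * oddDiag x + oddDiag x * newFermion k s = 0 := by
  ext i j
  rw [Matrix.add_apply, oddDiag, Matrix.mul_diagonal, Matrix.diagonal_mul]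
  cases s <;> fin_cases i <;> fin_cases j <;> simp [newFermion, h]

theorem newFermion_mul_newFermion (k : B) (s t : Bool) :
    newFermion k s * newFermion k t + newFermion k t * newFermion k s =
      if s ≠ t then idem1 (oddDiag k) else 0 := by
  rw [idem1_oddDiag]
  ext i j
  cases s <;> cases t <;> fin_cases i <;> fin_cases j <;>
    simp [newFermion]

variable {k : B} {φ : Fin N → Bool → B}

/-- The algebra map `Q(N+1) → M₄(B)` extending a map `Q(N) → B`. -/
def extLift (hk : k ^ 4 = 1) (hf : ∀ i s, φ i s * k + k * φ i s = 0)
    (hff : ∀ i j s t, φ i s * φ j t + φ j t * φ i s =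
      if i = j ∧ s ≠ t then idem1 k else 0) : SF (N + 1) →ₐ[ℂ] Matrix (Fin 4) (Fin 4) B :=
  lift (oddDiag k) (extFermion k φ) (oddDiag_pow_four hk)
    (by
      intro i s
      induction i using Fin.lastCases with
      | last => rw [extFermion_last, newFermion_mul_oddDiag (idem1_comm k)]
      | cast j =>
        rw [extFermion_castSucc, oddDiag_mul, oddDiag_mul, Matrix.diagonal_add]
        simp [hf])
    (by
      intro i j s t
      induction i using Fin.lastCases with
      | last =>
        induction j using Fin.lastCases with
        | last => simp only [extFermion_last, newFermion_mul_newFermion, true_and]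
        | cast j =>
          rw [extFermion_last, extFermion_castSucc,
            newFermion_mul_oddDiag (idem1_anticomm (hf j t)),
            if_neg (fun h => (Fin.castSucc_lt_last j).ne h.1.symm)]
      | cast i =>
        induction j using Fin.lastCases with
        | last =>
          rw [extFermion_last, extFermion_castSucc, add_comm,
            newFermion_mul_oddDiag (idem1_anticomm (hf i s)),
            if_neg (fun h => (Fin.castSucc_lt_last i).ne h.1)]
        | cast j =>
          rw [extFermion_castSucc, extFermion_castSucc, oddDiag_mul, oddDiag_mul,
            Matrix.diagonal_add, idem1_oddDiag]
          simp only [hff, Fin.castSucc_inj]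
          split_ifs <;> simp)

variable (hk : k ^ 4 = 1) (hf : ∀ i s, φ i s * k + k * φ i s = 0)
    (hff : ∀ i j s t, φ i s * φ j t + φ j t * φ i s =
      if i = j ∧ s ≠ t then idem1 k else 0)

theorem extLift_K : extLift hk hf hff K = oddDiag k := lift_K _ _ _ _ _

theorem extLift_f_last (s : Bool) :
    extLift hk hf hff (f (Fin.last N) s) = newFermion k s :=
  (lift_f _ _ _ _ _ _ s).trans (extFermion_last k φ s)

theorem extLift_f_castSucc (j : Fin N) (s : Bool) :
    extLift hk hf hff (f j.castSucc s) = oddDiag (φ j s) :=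
  (lift_f _ _ _ _ _ _ s).trans (extFermion_castSucc k φ j s)

end Extension

/-! ### Linear independence of the monomials -/

/-- `(1, i, -1, -i)`, a faithful image of `K`. -/
def rootsVec : Fin 4 → ℂ := ![1, Complex.I, -1, -Complex.I]

theorem rootsVec_pow : rootsVec ^ 4 = 1 := by
  ext j
  fin_cases j <;> simp [rootsVec, Even.neg_pow (show Even 4 by decide)]

/-- A faithful matrix representation of `Q(1)`. -/
def rep₁ : SF 1 →ₐ[ℂ] Matrix (Fin 4) (Fin 4) (Fin 4 → ℂ) :=
  extLift (N := 0) (k := rootsVec) (φ := fun i => i.elim0) rootsVec_pow (fun i => i.elim0)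
    (fun i => i.elim0)

/-- The induced matrix representation of `Q(2)`. -/
def rep₂ : SF 2 →ₐ[ℂ] Matrix (Fin 4) (Fin 4) (Matrix (Fin 4) (Fin 4) (Fin 4 → ℂ)) :=
  extLift (N := 1) (k := rep₁ K) (φ := fun i s => rep₁ (f i s))
    (by rw [← map_pow, K_pow, map_one])
    (fun i s => by rw [← map_mul, ← map_mul, ← map_add, f_K, map_zero])
    (fun i j s t => by
      rw [← map_mul, ← map_mul, ← map_add, f_f, apply_ite rep₁, map_idem1, map_zero])

/-- `K` and `f_1^±` act diagonally on the added pair `f_2^±`, and a diagonal entry is multiplicative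
on diagonal matrices; so the computation takes place in the representation of `Q(1)`. -/
theorem rep₂_monomial (s t m : ℕ) :
    rep₂ (f 0 true ^ s * f 0 false ^ t * K ^ m) 0 0 =
      newFermion rootsVec true ^ s * newFermion rootsVec false ^ t * oddDiag rootsVec ^ m := by
  have hK : rep₂ K = oddDiag (oddDiag rootsVec) := by
    rw [rep₂, extLift_K, rep₁, extLift_K]
  have hf : ∀ s, rep₂ (f 0 s) = oddDiag (newFermion rootsVec s) := by
    intro s
    refine (extLift_f_castSucc _ _ _ (0 : Fin 1) s).trans (congrArg oddDiag ?_)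
    exact extLift_f_last (N := 0) _ _ _ s
  rw [map_mul, map_mul, map_pow, map_pow, map_pow, hK, hf, hf, oddDiag, oddDiag, oddDiag,
    Matrix.diagonal_pow, Matrix.diagonal_pow, Matrix.diagonal_pow, Matrix.diagonal_mul_diagonal,
    Matrix.diagonal_mul_diagonal, Matrix.diagonal_apply_eq]
  rfl

/-- The first row is right multiplication applied to `1`, so it returns the monomial itself,
numbered `s + 2t` in the order `1, f⁺, f⁻, f⁺f⁻`. -/
theorem newFermion_row (k : Fin 4 → ℂ) (s t : Fin 2) (j : Fin 4) :
    (newFermion k true ^ (s : ℕ) * newFermion k false ^ (t : ℕ)) 0 j =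
      if (j : ℕ) = s + 2 * t then 1 else 0 := by
  fin_cases s <;> fin_cases t <;> fin_cases j <;> simp [newFermion]

/-- Discrete Fourier inversion over the fourth roots of unity; the sign `e` only permutes them. -/
theorem coeff_eq_zero_of_roots {d : Fin 4 → ℂ} (e : ℂ) (he : e * e = 1)
    (h : ∀ l, ∑ m, d m * (e * rootsVec l) ^ (m : ℕ) = 0) (m : Fin 4) : d m = 0 := by
  have h0 := h 0
  have h1 := h 1
  have h2 := h 2
  have h3 := h 3
  have hI := Complex.I_sq
  simp [Fin.sum_univ_four, rootsVec] at h0 h1 h2 h3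
  fin_cases m
  · change d 0 = 0
    linear_combination (h0 + h1 + h2 + h3) / 4 - d 2 / 2 * e ^ 2 * hI
  · change d 1 = 0
    linear_combination e / 4 * (h0 - h2 - Complex.I * h1 + Complex.I * h3) +
      (d 1 / 2 * e ^ 2 + d 3 / 2 * e ^ 4 * (Complex.I ^ 2 - 1)) * hI - d 1 * he
  · change d 2 = 0
    linear_combination (h0 - h1 + h2 - h3) / 4 + d 2 / 2 * e ^ 2 * hI - d 2 * he
  · change d 3 = 0
    linear_combination e / 4 * (h0 - h2 + Complex.I * h1 - Complex.I * h3) +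
      (-d 1 / 2 * e ^ 2 - d 3 / 2 * e ^ 4 * (Complex.I ^ 2 - 1)) * hI - d 3 * (e ^ 2 + 1) * he

/-- The monomials `(f^+)^s (f^-)^t K^m` in `A`. -/
def monomial (x : Fin 4 × Fin 2 × Fin 2) : subA :=
  fA true ^ (x.2.1 : ℕ) * fA false ^ (x.2.2 : ℕ) * KA ^ (x.1 : ℕ)

theorem linearIndependent_monomial : LinearIndependent ℂ monomial := by
  rw [Fintype.linearIndependent_iff]
  intro c hc
  have h1 : ∑ x, c x • (newFermion rootsVec true ^ (x.2.1 : ℕ) *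
      newFermion rootsVec false ^ (x.2.2 : ℕ) * oddDiag rootsVec ^ (x.1 : ℕ)) = 0 := by
    have h2 := congrArg (fun a : subA => rep₂ (a : SF 2) 0 0) hc
    simp only [AddSubmonoidClass.coe_finsetSum, map_sum, Matrix.sum_apply] at h2
    refine (Finset.sum_congr rfl fun x _ => ?_).trans (h2.trans ?_)
    · rw [← rep₂_monomial]
      change _ = rep₂ (c x • (monomial x : SF 2)) 0 0
      rw [map_smul]; rfl
    · change rep₂ 0 0 0 = 0
      rw [map_zero]; rfl
  rintro ⟨m, s, t⟩
  have hj : (s : ℕ) + 2 * t < 4 := by omega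
  -- The sign with which `oddDiag` acts in column `s + 2t`.
  let e : ℂ := (![1, -1, -1, 1] : Fin 4 → ℂ) ⟨s + 2 * t, hj⟩
  have he : e * e = 1 := by
    simp only [e]
    fin_cases s <;> fin_cases t <;> simp
  refine coeff_eq_zero_of_roots (d := fun m => c (m, s, t)) e he (fun l => ?_) m
  have h3 := congrFun (congrFun (congrFun h1 0) ⟨s + 2 * t, hj⟩) l
  rw [Matrix.sum_apply, Finset.sum_apply, Fintype.sum_prod_type] at h3
  refine (Finset.sum_congr rfl fun m _ => ?_).trans h3
  rw [Fintype.sum_eq_single (s, t)]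
  · rw [Matrix.smul_apply, oddDiag, Matrix.diagonal_pow, Matrix.mul_diagonal, newFermion_row,
      if_pos rfl, one_mul, Pi.smul_apply, smul_eq_mul]
    congr 1
    simp only [Pi.pow_apply, e]
    congr 1
    fin_cases s <;> fin_cases t <;> simp
  · rintro ⟨s', t'⟩ hne
    rw [Matrix.smul_apply, oddDiag, Matrix.diagonal_pow, Matrix.mul_diagonal, newFermion_row,
      if_neg, zero_mul, smul_zero, Pi.zero_apply]
    intro h4
    apply hne
    simp only at h4
    ext <;> simp only <;> omega

end SF
end

noncomputable section

namespace SF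

/-! ### The monomial basis -/

theorem KA_sq_mul_fA (s : Bool) : KA ^ 2 * fA s = fA s * KA ^ 2 := by
  rw [← idem0_sub_idem1, sub_mul, mul_sub, idem0_central, idem1_central]

theorem fA_false_mul_true : fA false * fA true = idem1 KA - fA true * fA false :=
  eq_sub_of_add_eq' fA_true_mul_false

theorem KA_pow_mem (s t : Fin 2) (n : ℕ) :
    fA true ^ (s : ℕ) * fA false ^ (t : ℕ) * KA ^ n ∈
      Submodule.span ℂ (Set.range monomial) := by
  have h : KA ^ n = KA ^ (n % 4) := by
    conv_lhs => rw [← Nat.div_add_mod n 4]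
    rw [pow_add, pow_mul, KA_pow, one_pow, one_mul]
  rw [h]
  exact Submodule.subset_span ⟨(⟨n % 4, Nat.mod_lt _ (by norm_num)⟩, s, t), rfl⟩

theorem KA_mul_fA_pow (s : Bool) (t : Fin 2) :
    KA * fA s ^ (t : ℕ) = ((-1 : ℂ) ^ (t : ℕ)) • (fA s ^ (t : ℕ) * KA) := by
  fin_cases t
  · simp
  · simp [fA_mul_KA]

/-- With `1` in the span, stability under left multiplication makes it all of `A`. Only `f_-`
passing `f_+` needs care: the anticommutator `e₁ = (1 - K²)/2` is again a combination of powers of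
`K`. -/
theorem mul_mem_span_monomial (a : subA) :
    ∀ x ∈ Submodule.span ℂ (Set.range monomial), a * x ∈
      Submodule.span ℂ (Set.range monomial) := by
  set M := Submodule.span ℂ (Set.range monomial)
  have red : ∀ a : subA, (∀ m s t, a * monomial (m, s, t) ∈ M) → ∀ x ∈ M, a * x ∈ M := by
    intro a ha x hx
    refine Submodule.span_induction (p := fun x _ => a * x ∈ M) ?_ ?_ ?_ ?_ hx
    · rintro _ ⟨⟨m, s, t⟩, rfl⟩
      exact ha m s t
    · rw [mul_zero]; exact M.zero_mem
    · intro x y _ _ hx hy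
      rw [mul_add]; exact M.add_mem hx hy
    · intro c x _ hx
      rw [mul_smul_comm]; exact M.smul_mem c hx
  have hK : ∀ x ∈ M, KA * x ∈ M := by
    refine red KA fun m s t => ?_
    simp only [monomial]
    rw [← mul_assoc, ← mul_assoc, KA_mul_fA_pow, smul_mul_assoc, mul_assoc (fA true ^ (s : ℕ)),
      KA_mul_fA_pow, mul_smul_comm, smul_smul, smul_mul_assoc, ← mul_assoc, mul_assoc _ KA,
      ← pow_succ']
    exact M.smul_mem _ (KA_pow_mem s t _)
  have hp : ∀ x ∈ M, fA true * x ∈ M := by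
    refine red _ fun m s t => ?_
    simp only [monomial]
    rw [← mul_assoc, ← mul_assoc, ← pow_succ']
    fin_cases s
    · exact KA_pow_mem 1 t m
    · simp [pow_two, fA_mul_fA]
  have hm : ∀ x ∈ M, fA false * x ∈ M := by
    refine red _ fun m s t => ?_
    simp only [monomial]
    fin_cases s
    · simp only [pow_zero, one_mul]
      rw [← mul_assoc, ← pow_succ']
      fin_cases t
      · simpa using KA_pow_mem 0 1 m
      · simp [pow_two, fA_mul_fA]
    · simp only [pow_one]
      rw [mul_assoc (fA true), ← mul_assoc, fA_false_mul_true, sub_mul,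
        idem1, smul_mul_assoc, sub_mul, one_mul]
      refine M.sub_mem (M.smul_mem _ (M.sub_mem ?_ ?_)) ?_
      · simpa using KA_pow_mem 0 t m
      · have h : KA ^ 2 * (fA false ^ (t : ℕ) * KA ^ (m : ℕ)) =
            fA true ^ ((0 : Fin 2) : ℕ) * fA false ^ (t : ℕ) * KA ^ ((m : ℕ) + 2) := by
          rw [← mul_assoc, (Commute.pow_right (show Commute (KA ^ 2) (fA false) from
            KA_sq_mul_fA false) t).eq, mul_assoc, ← pow_add, add_comm 2]
          simp
        rw [h]
        exact KA_pow_mem 0 t _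
      · rw [mul_assoc, ← mul_assoc (fA false), ← pow_succ']
        fin_cases t
        · simpa [mul_assoc] using KA_pow_mem 1 1 m
        · simp [pow_two, fA_mul_fA]
  refine subA_induction (p := fun a => ∀ x ∈ M, a * x ∈ M) ?_ ?_ ?_ ?_ ?_ a
  · intro s x hx
    rw [wA_eq, add_mul, smul_mul_assoc, smul_mul_assoc]
    refine M.add_mem (M.smul_mem _ (hK x hx)) (M.smul_mem _ ?_)
    rw [pow_succ, pow_two, mul_assoc, mul_assoc]
    exact hK _ (hK _ (hK _ hx))
  · intro s
    cases s
    exacts [hm, hp]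
  · intro c x hx
    rw [← Algebra.smul_def]
    exact M.smul_mem c hx
  · intro a b ha hb x hx
    rw [add_mul]
    exact M.add_mem (ha x hx) (hb x hx)
  · intro a b ha hb x hx
    rw [mul_assoc]
    exact ha _ (hb x hx)

theorem span_monomial : ⊤ ≤ Submodule.span ℂ (Set.range monomial) := by
  intro a _
  rw [← mul_one a]
  refine mul_mem_span_monomial a 1 ?_
  simpa using KA_pow_mem 0 0 0

/-- The basis of `A` of monomials. -/
def monomialBasis : Module.Basis (Fin 4 × Fin 2 × Fin 2) ℂ subA :=
  Module.Basis.mk linearIndependent_monomial span_monomial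

theorem monomialBasis_apply (m : Fin 4) (s t : Fin 2) : monomialBasis (m, s, t) =
    fA true ^ (s : ℕ) * fA false ^ (t : ℕ) * KA ^ (m : ℕ) := by
  rw [monomialBasis, Module.Basis.mk_apply]; rfl

instance finiteDimensional_subA : FiniteDimensional ℂ subA :=
  Module.Finite.of_basis monomialBasis

/-! ### Linear forms on `A` -/

/-- The grouplike elements `1, K², ω_+, ω_-` of `A`. -/
def grouplikes : Set subA := {y | y = 1 ∨ y = KA ^ 2 ∨ ∃ s, y = wA s}

theorem KA_pow_mem_span (m : Fin 4) : KA ^ (m : ℕ) ∈ Submodule.span ℂ grouplikes := by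
  have hw : ∀ s, wA s ∈ Submodule.span ℂ grouplikes := fun s =>
    Submodule.subset_span (Or.inr (Or.inr ⟨s, rfl⟩))
  fin_cases m
  · exact Submodule.subset_span (Or.inl (pow_zero _))
  · change KA ^ 1 ∈ _
    rw [pow_one, KA_eq]
    exact Submodule.add_mem _ (Submodule.smul_mem _ _ (hw _)) (Submodule.smul_mem _ _ (hw _))
  · exact Submodule.subset_span (Or.inr (Or.inl rfl))
  · change KA ^ 3 ∈ _
    rw [KA_cube_eq]
    exact Submodule.add_mem _ (Submodule.smul_mem _ _ (hw _)) (Submodule.smul_mem _ _ (hw _))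

/-- Linear maps on `A` agree if they agree on products of monomials in `f_±` and grouplike
elements. -/
theorem subA_linearMap_ext {M : Type*} [AddCommGroup M] [Module ℂ M] {F G : subA →ₗ[ℂ] M}
    (h0 : ∀ y ∈ grouplikes, F y = G y) (h1 : ∀ s, ∀ y ∈ grouplikes, F (fA s * y) = G (fA s * y))
    (h2 : ∀ y ∈ grouplikes, F (fA true * fA false * y) = G (fA true * fA false * y)) : F = G := by
  refine monomialBasis.ext fun ⟨m, s, t⟩ => ?_
  rw [monomialBasis_apply]
  have key : ∀ x : subA, (∀ y ∈ grouplikes, F (x * y) = G (x * y)) →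
      F (x * KA ^ (m : ℕ)) = G (x * KA ^ (m : ℕ)) := by
    intro x hx
    refine LinearMap.eqOn_span (f := F ∘ₗ LinearMap.mulLeft ℂ x) (g := G ∘ₗ LinearMap.mulLeft ℂ x)
      hx (KA_pow_mem_span m)
  apply key
  intro y hy
  fin_cases s <;> fin_cases t
  · simpa using h0 y hy
  · simpa using h1 false y hy
  · simpa using h1 true y hy
  · simpa using h2 y hy

theorem mul_mem_grouplikes {y : subA} (hy : y ∈ grouplikes) (s : Bool) :
    wA s * y ∈ grouplikes := by
  rcases hy with rfl | rfl | ⟨t, rfl⟩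
  · exact Or.inr (Or.inr ⟨s, mul_one _⟩)
  · refine Or.inr (Or.inr ⟨!s, ?_⟩)
    rw [← wA_mul_not s, ← mul_assoc, wA_mul_self, one_mul]
  · rcases Bool.eq_or_eq_not t s with rfl | rfl
    · exact Or.inl (wA_mul_self _)
    · exact Or.inr (Or.inl (wA_mul_not s))

theorem grouplikes_comm {y : subA} (hy : y ∈ grouplikes) (s : Bool) : y * wA s = wA s * y := by
  rcases hy with rfl | rfl | ⟨t, rfl⟩
  · rw [one_mul, mul_one]
  · rw [KA_sq_eq, mul_assoc, wA_comm false s, ← mul_assoc, wA_comm true s, mul_assoc]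
  · exact wA_comm t s

theorem Δ_grouplike (β : ℂ) {y : subA} (hy : y ∈ grouplikes) :
    (quasiHopfA β).Δ y = y ⊗ₜ y := by
  rcases hy with rfl | rfl | ⟨t, rfl⟩
  · rw [map_one]; rfl
  · exact Δ_KA_sq β
  · exact Δ_wA β t

/-- A linear form on `A` supported on `f_+ f_- ω_s`, with value `κ` there. -/
structure IsTopForm (lam : subA →ₗ[ℂ] ℂ) (s : Bool) (κ : ℂ) : Prop where
  apply_grouplike : ∀ y ∈ grouplikes, lam y = 0
  apply_fA : ∀ t, ∀ y ∈ grouplikes, lam (fA t * y) = 0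
  apply_one : lam (fA true * fA false) = 0
  apply_KA_sq : lam (fA true * fA false * KA ^ 2) = 0
  apply_wA_not : lam (fA true * fA false * wA (!s)) = 0
  apply_wA : lam (fA true * fA false * wA s) = κ

variable {lam : subA →ₗ[ℂ] ℂ} {s : Bool} {κ : ℂ}

/-- The coefficients `(1 ± i)/2` are those of `K` and `K³` in `ω_±`; the two conditions express
vanishing at `ω_{-s}` and the value at `ω_s`. -/
theorem isTopForm_of_values (a b : ℂ)
    (h : ∀ m s t, lam (monomialBasis (m, s, t)) = if s = 1 ∧ t = 1 then
      (if m = 1 then 1 else 0) * a + (if m = 3 then 1 else 0) * b else 0)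
    (h0 : (1 + sgn (!s) * Complex.I) / 2 * a + (1 - sgn (!s) * Complex.I) / 2 * b = 0)
    (h1 : (1 + sgn s * Complex.I) / 2 * a + (1 - sgn s * Complex.I) / 2 * b = κ) :
    IsTopForm lam s κ := by
  have hv := h
  simp only [monomialBasis_apply] at hv
  have hw : ∀ (x : subA) (t : Bool), lam (x * wA t) = (1 + sgn t * Complex.I) / 2 * lam (x * KA) +
      (1 - sgn t * Complex.I) / 2 * lam (x * KA ^ 3) := by
    intro x t
    rw [wA_eq, mul_add, mul_smul_comm, mul_smul_comm, map_add, map_smul, map_smul]; rfl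
  have g0 : ∀ x : subA, (∀ m : Fin 4, lam (x * KA ^ (m : ℕ)) = 0) →
      ∀ y ∈ grouplikes, lam (x * y) = 0 := by
    intro x hx y hy
    have hx1 : lam (x * KA) = 0 := by simpa using hx 1
    have hx3 : lam (x * KA ^ 3) = 0 := hx 3
    rcases hy with rfl | rfl | ⟨t, rfl⟩
    · simpa using hx 0
    · simpa using hx 2
    · rw [hw, hx1, hx3]; simp
  have hK : lam (fA true * fA false * KA) = a := by simpa using hv 1 1 1
  have hK3 : lam (fA true * fA false * KA ^ 3) = b := by simpa using hv 3 1 1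
  refine ⟨fun y hy => ?_, fun t y hy => ?_, ?_, ?_, ?_, ?_⟩
  · rw [← one_mul y]
    exact g0 1 (fun m => by simpa using hv m 0 0) y hy
  · cases t
    · exact g0 _ (fun m => by simpa using hv m 0 1) y hy
    · exact g0 _ (fun m => by simpa using hv m 1 0) y hy
  · simpa using hv 0 1 1
  · simpa using hv 2 1 1
  · rw [hw, hK, hK3, h0]
  · rw [hw, hK, hK3, h1]

/-- `e₁` is a combination of grouplikes, so `e₁ y` stays in the span on which the form vanishes. -/
theorem apply_idem1_mul (x : subA)
    (hx : ∀ y ∈ grouplikes, lam (x * y) = 0) {y : subA} (hy : y ∈ grouplikes) :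
    lam (x * (idem1 KA * y)) = 0 := by
  rw [idem1_eq, smul_mul_assoc, sub_mul, one_mul, mul_smul_comm, mul_sub, map_smul, map_sub,
    hx y hy, mul_assoc, hx _ (mul_mem_grouplikes (mul_mem_grouplikes hy _) _)]
  simp

/-- Grouplike elements commute or anticommute with `f_±`; in the commuting case a top form
vanishes on `f_+ f_- y`. -/
theorem IsTopForm.sign (h : IsTopForm lam s κ) {y : subA} (hy : y ∈ grouplikes) :
    ((∀ t, y * fA t = fA t * y) ∧ lam (fA true * fA false * y) = 0) ∨
      (∀ t, y * fA t = -(fA t * y)) := by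
  rcases hy with rfl | rfl | ⟨t, rfl⟩
  · left
    exact ⟨fun t => by simp, by simpa using h.apply_one⟩
  · left
    exact ⟨KA_sq_mul_fA, h.apply_KA_sq⟩
  · right
    intro t'
    rw [fA_mul_wA, neg_neg]

/-- Top forms are symmetric. -/
theorem IsTopForm.symm (h : IsTopForm lam s κ) (a b : subA) : lam (a * b) = lam (b * a) := by
  have h0 : ∀ y ∈ grouplikes, lam y = 0 := h.apply_grouplike
  have hf := h.apply_fA
  have red : ∀ b : subA, (∀ y ∈ grouplikes, lam (y * b) = lam (b * y)) →
      (∀ t, ∀ y ∈ grouplikes, lam (fA t * y * b) = lam (b * (fA t * y))) →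
      (∀ y ∈ grouplikes, lam (fA true * fA false * y * b) = lam (b * (fA true * fA false * y))) →
      ∀ a, lam (a * b) = lam (b * a) := by
    intro b h1 h2 h3 a
    exact LinearMap.congr_fun (subA_linearMap_ext (F := lam ∘ₗ LinearMap.mulRight ℂ b)
      (G := lam ∘ₗ LinearMap.mulLeft ℂ b) h1 h2 h3) a
  refine subA_induction (p := fun b => ∀ a, lam (a * b) = lam (b * a)) ?_ ?_ ?_ ?_ ?_ b a
  · intro r
    apply red
    · intro y hy
      rw [grouplikes_comm hy]
    · intro t y hy
      rw [mul_assoc, grouplikes_comm hy, hf t _ (mul_mem_grouplikes hy r), ← mul_assoc,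
        ← neg_eq_iff_eq_neg.2 (fA_mul_wA t r), neg_mul, mul_assoc, map_neg,
        hf t _ (mul_mem_grouplikes hy r), neg_zero]
    · intro y hy
      rw [mul_assoc _ y, grouplikes_comm hy, ← mul_assoc, mul_assoc (fA true), fA_mul_wA,
        mul_neg, ← mul_assoc, fA_mul_wA]
      simp only [neg_mul, neg_neg, mul_assoc]
  · intro r
    apply red
    · intro y hy
      have h1 := hf r y hy
      rcases h.sign hy with ⟨hc, -⟩ | hc
      · rw [hc]
      · rw [hc, map_neg, h1, neg_zero]
    · intro t y hy
      -- The form vanishes on the anticommutator times `y`, so `f_t` and `f_r` anticommute under it;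
      -- moving an anticommuting `y` past `f_r` gives the compensating sign.
      have key : ∀ t r, lam (fA t * fA r * y) = - lam (fA r * fA t * y) := by
        intro t r
        rcases Bool.eq_or_eq_not r t with rfl | rfl
        · rw [fA_mul_fA]; simp
        · have h2 : lam ((fA t * fA (!t) + fA (!t) * fA t) * y) = 0 := by
            rw [fA_mul_fA_not]
            simpa using apply_idem1_mul 1 (fun y hy => by simpa using h0 y hy) hy
          rw [add_mul, map_add] at h2
          exact eq_neg_of_add_eq_zero_left h2
      rcases h.sign hy with ⟨hc, hz⟩ | hc
      · have hz' : ∀ t r, lam (fA t * fA r * y) = 0 := by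
          intro t r
          cases t <;> cases r
          · rw [fA_mul_fA]; simp
          · rw [key, hz, neg_zero]
          · exact hz
          · rw [fA_mul_fA]; simp
        rw [mul_assoc, hc, ← mul_assoc, ← mul_assoc, hz', hz']
      · rw [mul_assoc, hc, mul_neg, map_neg, ← mul_assoc, ← mul_assoc, key, neg_neg]
    · intro y hy
      -- Products of three fermions are zero or reduce to `e₁ f y`, so both sides vanish.
      have hL : lam (fA r * (fA true * fA false * y)) = 0 := by
        cases r
        · rw [← mul_assoc, ← mul_assoc, fA_false_mul_true, sub_mul, mul_assoc _ (fA false),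
            fA_mul_fA, mul_zero, sub_zero, idem1_central, mul_assoc]
          exact apply_idem1_mul _ (hf false) hy
        · rw [← mul_assoc, ← mul_assoc, fA_mul_fA]; simp
      have hR : lam (fA true * fA false * (fA r * y)) = 0 := by
        cases r
        · rw [← mul_assoc, mul_assoc (fA true), fA_mul_fA]; simp
        · rw [← mul_assoc, mul_assoc (fA true), fA_false_mul_true, mul_sub, ← mul_assoc (fA true),
            fA_mul_fA, zero_mul, sub_zero, mul_assoc]
          exact apply_idem1_mul _ (hf true) hy
      rw [hL, mul_assoc]
      rcases h.sign hy with ⟨hc, -⟩ | hc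
      · rw [hc, hR]
      · rw [hc, mul_neg, map_neg, hR, neg_zero]
  · intro c a
    rw [Algebra.commutes]
  · intro x y hx hy a
    rw [mul_add, add_mul, map_add, map_add, hx, hy]
  · intro x y hx hy a
    rw [← mul_assoc, hy, ← mul_assoc, hx, mul_assoc]

/-- `(λ ⊗ id) Δ(h) = λ(h) ω_s` for a top form. -/
theorem IsTopForm.right_cointegral (h : IsTopForm lam s κ) (β : ℂ) (a : subA) :
    TensorProduct.lid ℂ subA (lam.rTensor subA ((quasiHopfA β).Δ a)) = lam a • wA s := by
  have h0 := h.apply_grouplike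
  have hf := h.apply_fA
  refine LinearMap.congr_fun (subA_linearMap_ext
    (F := (TensorProduct.lid ℂ subA).toLinearMap ∘ₗ lam.rTensor subA ∘ₗ
      (quasiHopfA β).Δ.toLinearMap) (G := lam.smulRight (wA s)) ?_ ?_ ?_) a
  · intro y hy
    change TensorProduct.lid ℂ subA (lam.rTensor subA ((quasiHopfA β).Δ y)) = lam y • wA s
    rw [Δ_grouplike β hy, LinearMap.rTensor_tmul, TensorProduct.lid_tmul, h0 y hy, zero_smul,
      zero_smul]
  · intro t y hy
    change TensorProduct.lid ℂ subA (lam.rTensor subA ((quasiHopfA β).Δ (fA t * y))) =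
      lam (fA t * y) • wA s
    rw [map_mul, Δ_fA, Δ_grouplike β hy, add_mul, Algebra.TensorProduct.tmul_mul_tmul,
      Algebra.TensorProduct.tmul_mul_tmul, map_add, map_add, LinearMap.rTensor_tmul,
      LinearMap.rTensor_tmul, TensorProduct.lid_tmul, TensorProduct.lid_tmul, hf t y hy,
      h0 _ (mul_mem_grouplikes hy t)]
    simp
  · intro y hy
    change TensorProduct.lid ℂ subA (lam.rTensor subA ((quasiHopfA β).Δ
      (fA true * fA false * y))) = lam (fA true * fA false * y) • wA s
    rw [map_mul (quasiHopfA β).Δ, map_mul (quasiHopfA β).Δ, Δ_fA, Δ_fA, Δ_grouplike β hy]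
    simp only [add_mul, mul_add, Algebra.TensorProduct.tmul_mul_tmul, map_add,
      LinearMap.rTensor_tmul, TensorProduct.lid_tmul, mul_one, one_mul]
    -- Of the four terms only `f_+ f_- y ⊗ y` survives: the others have fewer than two fermions in
    -- the first leg.
    rw [mul_assoc (fA true) (wA false), hf true _ (mul_mem_grouplikes hy _), mul_assoc (wA true)
      (wA false), h0 _ (mul_mem_grouplikes (mul_mem_grouplikes hy _) _),
      ← neg_eq_iff_eq_neg.2 (fA_mul_wA false true), neg_mul, map_neg, mul_assoc (fA false),
      hf false _ (mul_mem_grouplikes hy _)]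
    simp only [neg_zero, zero_smul, add_zero]
    rcases hy with rfl | rfl | ⟨t, rfl⟩
    · rw [mul_one, h.apply_one, zero_smul, zero_smul]
    · rw [h.apply_KA_sq, zero_smul, zero_smul]
    · rcases Bool.eq_or_eq_not t s with rfl | rfl
      · rfl
      · rw [h.apply_wA_not, zero_smul, zero_smul]

/-- `(id ⊗ λ) Δ(h) = λ(h) ω_{-s}` for a top form. -/
theorem IsTopForm.left_cointegral (h : IsTopForm lam s κ) (β : ℂ) (a : subA) :
    TensorProduct.rid ℂ subA (lam.lTensor subA ((quasiHopfA β).Δ a)) = lam a • wA (!s) := by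
  have h0 := h.apply_grouplike
  have hf := h.apply_fA
  refine LinearMap.congr_fun (subA_linearMap_ext
    (F := (TensorProduct.rid ℂ subA).toLinearMap ∘ₗ lam.lTensor subA ∘ₗ
      (quasiHopfA β).Δ.toLinearMap) (G := lam.smulRight (wA (!s))) ?_ ?_ ?_) a
  · intro y hy
    change TensorProduct.rid ℂ subA (lam.lTensor subA ((quasiHopfA β).Δ y)) = lam y • wA (!s)
    rw [Δ_grouplike β hy, LinearMap.lTensor_tmul, TensorProduct.rid_tmul, h0 y hy, zero_smul,
      zero_smul]
  · intro t y hy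
    change TensorProduct.rid ℂ subA (lam.lTensor subA ((quasiHopfA β).Δ (fA t * y))) =
      lam (fA t * y) • wA (!s)
    rw [map_mul, Δ_fA, Δ_grouplike β hy, add_mul, Algebra.TensorProduct.tmul_mul_tmul,
      Algebra.TensorProduct.tmul_mul_tmul, map_add, map_add, LinearMap.lTensor_tmul,
      LinearMap.lTensor_tmul, TensorProduct.rid_tmul, TensorProduct.rid_tmul, hf t y hy,
      one_mul, h0 _ hy]
    simp
  · intro y hy
    change TensorProduct.rid ℂ subA (lam.lTensor subA ((quasiHopfA β).Δ
      (fA true * fA false * y))) = lam (fA true * fA false * y) • wA (!s)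
    rw [map_mul (quasiHopfA β).Δ, map_mul (quasiHopfA β).Δ, Δ_fA, Δ_fA, Δ_grouplike β hy]
    simp only [add_mul, mul_add, Algebra.TensorProduct.tmul_mul_tmul, map_add,
      LinearMap.lTensor_tmul, TensorProduct.rid_tmul, mul_one, one_mul]
    -- Now only `ω_+ ω_- y ⊗ f_+ f_- y` survives, and the factor `ω_+ ω_- = K²` exchanges `ω_+` and
    -- `ω_-`. This is the origin of the difference between left and right.
    rw [h0 _ hy, hf true _ hy, hf false _ hy]
    simp only [zero_smul, zero_add]
    rcases hy with rfl | rfl | ⟨t, rfl⟩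
    · rw [mul_one, h.apply_one, zero_smul, zero_smul]
    · rw [h.apply_KA_sq, zero_smul, zero_smul]
    · rcases Bool.eq_or_eq_not t s with rfl | rfl
      · rw [← KA_sq_eq, ← wA_mul_not t, mul_assoc, wA_comm, mul_assoc, wA_mul_self, mul_one]
      · rw [h.apply_wA_not, zero_smul, zero_smul]

end SF
end

/-! ### Symmetrised cointegrals for a sign coassociator -/

noncomputable section

namespace FDMod

variable {A : Type} [Ring A] [Algebra ℂ A] {Q : QuasiHopfData A} {u : ℂ} {e : A}

theorem antipodeInv_one (Q : QuasiHopfData A) : Q.antipodeInv 1 = 1 :=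
  Q.antipodeInv_of_eq Q.antipode_one

/-- The antipode fixes `e` and `e² = e`, so contracting two legs of the coassociator leaves a single
`e`. -/
theorem qR_eq (hQ : HasSignCoassociator Q u e) : Q.qR = 1 + (u - 1) • (e ⊗ₜ e) := by
  rw [QuasiHopfData.qR, hQ.Φinv_eq, hQ.α_eq, Algebra.TensorProduct.one_def,
    Algebra.TensorProduct.one_def]
  simp [Q.antipodeInv_of_eq hQ.antipode_eq, antipodeInv_one, hQ.idem]

theorem pR_eq (hQ : HasSignCoassociator Q u e) :
    Q.pR = (1 + (u - 1) • (e ⊗ₜ e)) * (1 ⊗ₜ Q.β) := by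
  rw [QuasiHopfData.pR, hQ.Φ_eq, Algebra.TensorProduct.one_def, Algebra.TensorProduct.one_def]
  simp [hQ.antipode_eq, Q.antipode_one, add_mul]
  rw [← hQ.central, ← mul_assoc, hQ.idem]

theorem qL_eq (hQ : HasSignCoassociator Q u e) : Q.qL = 1 + (u - 1) • (e ⊗ₜ e) := by
  rw [QuasiHopfData.qL, hQ.Φ_eq, hQ.α_eq, Algebra.TensorProduct.one_def,
    Algebra.TensorProduct.one_def]
  simp [hQ.antipode_eq, Q.antipode_one, hQ.idem]

theorem antipodeInv_mul (Q : QuasiHopfData A) (a b : A) :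
    Q.antipodeInv (a * b) = Q.antipodeInv b * Q.antipodeInv a := by
  simp [QuasiHopfData.antipodeInv]

theorem pL_eq (hQ : HasSignCoassociator Q u e) :
    Q.pL = (1 + (u - 1) • (e ⊗ₜ e)) * (Q.antipodeInv Q.β ⊗ₜ 1) := by
  rw [QuasiHopfData.pL, hQ.Φinv_eq, Algebra.TensorProduct.one_def, Algebra.TensorProduct.one_def]
  simp [Q.antipodeInv_of_eq hQ.antipode_eq, antipodeInv_mul, add_mul]
  rw [← hQ.central, ← mul_assoc, hQ.idem]

theorem sign_mul_comm (hQ : HasSignCoassociator Q u e) (z : A ⊗[ℂ] A) :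
    (1 + (u - 1) • (e ⊗ₜ[ℂ] e)) * z = z * (1 + (u - 1) • (e ⊗ₜ e)) := by
  induction z with
  | zero => simp
  | add z z' hz hz' => rw [mul_add, hz, hz', ← add_mul]
  | tmul a b =>
    simp only [add_mul, mul_add, one_mul, mul_one, smul_mul_assoc, mul_smul_comm,
      Algebra.TensorProduct.tmul_mul_tmul, hQ.central]

theorem sign_mul_self (hQ : HasSignCoassociator Q u e) :
    (1 + (u - 1) • (e ⊗ₜ[ℂ] e)) * (1 + (u - 1) • (e ⊗ₜ e)) = 1 := by
  simp only [add_mul, mul_add, one_mul, mul_one, smul_mul_assoc, mul_smul_comm,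
      Algebra.TensorProduct.tmul_mul_tmul, hQ.idem, smul_smul, smul_add]
  rw [add_assoc, ← add_smul, ← add_smul, show u - 1 + (u - 1 + (u - 1) * (u - 1)) = u * u - 1 by
    ring, hQ.sq, sub_self, zero_smul, add_zero]

/-- `q^R` and `p^R` carry the same central involution, so `q^R Δ(h) p^R = Δ(h)(1 ⊗ 𝛃)` and the
condition reduces to an ordinary cointegral identity. -/
theorem isRightSymCointegral_of (hQ : HasSignCoassociator Q u e) {lam : A →ₗ[ℂ] ℂ}
    (h0 : lam ≠ 0) {c : A} (hc : c * Q.β = Q.ginv)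
    (h : ∀ a, TensorProduct.lid ℂ A (lam.rTensor A (Q.Δ a)) = lam a • c) :
    Q.IsRightSymCointegral lam := by
  refine ⟨h0, fun a => ?_⟩
  have h1 : ∀ z : A ⊗[ℂ] A, TensorProduct.lid ℂ A (lam.rTensor A (z * (1 ⊗ₜ Q.β))) =
      TensorProduct.lid ℂ A (lam.rTensor A z) * Q.β := by
    intro z
    induction z with
    | zero => simp
    | add z z' hz hz' => simp only [add_mul, map_add, hz, hz']
    | tmul a b => simp
  rw [qR_eq hQ, pR_eq hQ, sign_mul_comm hQ, mul_assoc, ← mul_assoc (1 + _), sign_mul_self hQ,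
    one_mul, h1, h, smul_mul_assoc, hc]

theorem isLeftSymCointegral_of (hQ : HasSignCoassociator Q u e) {lam : A →ₗ[ℂ] ℂ}
    (h0 : lam ≠ 0) {c : A} (hc : c * Q.antipodeInv Q.β = Q.g)
    (h : ∀ a, TensorProduct.rid ℂ A (lam.lTensor A (Q.Δ a)) = lam a • c) :
    Q.IsLeftSymCointegral lam := by
  refine ⟨h0, fun a => ?_⟩
  have h1 : ∀ z : A ⊗[ℂ] A,
      TensorProduct.rid ℂ A (lam.lTensor A (z * (Q.antipodeInv Q.β ⊗ₜ 1))) =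
      TensorProduct.rid ℂ A (lam.lTensor A z) * Q.antipodeInv Q.β := by
    intro z
    induction z with
    | zero => simp
    | add z z' hz hz' => simp only [add_mul, map_add, hz, hz']
    | tmul a b => simp
  rw [qL_eq hQ, pL_eq hQ, sign_mul_comm hQ, mul_assoc, ← mul_assoc (1 + _), sign_mul_self hQ,
    one_mul, h1, h, smul_mul_assoc, hc]

end FDMod

/-! ### Cointegrals and modified traces of `A` -/

namespace SF

open FDMod

variable {β : ℂ}

theorem hasSignCoassociator (hβ : β ^ 4 = 1) :
    HasSignCoassociator (quasiHopfA β) (β ^ 2) (idem1 KA) where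
  sq := by rw [← hβ]; ring
  Φ_eq := Φ_eq β
  Φinv_eq := Φinv_eq β
  α_eq := α_eq β
  antipode_eq := antipode_idem1 β
  central := idem1_central
  idem := idem1_sq

theorem one_sub_idem1 : 1 - 2 • idem1 KA = KA ^ 2 := by
  rw [← idem0_sub_idem1, ← idem0_add_idem1 KA]; module

theorem Δ_one_sub_idem1 : (quasiHopfA β).Δ (1 - 2 • idem1 KA) =
    (1 - 2 • idem1 KA) ⊗ₜ (1 - 2 • idem1 KA) := by
  rw [one_sub_idem1, Δ_KA_sq]

/-- The index `t` with `β g = ω_t`. -/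
theorem exists_sgn (hβ : β ^ 4 = 1) : ∃ t, sgn t = -β ^ 2 := by
  have h : (β ^ 2 - 1) * (β ^ 2 + 1) = 0 := by linear_combination hβ
  rcases mul_eq_zero.1 h with h | h
  · exact ⟨false, by rw [sgn_false]; linear_combination h⟩
  · exact ⟨true, by rw [sgn_true]; linear_combination h⟩

/-- As `sgn t = ±1`, one has `β² = ±1` and `𝛃` is `1` or `1 - 2e₁ = K²`; the latter exchanges `ω_-`
and `ω_+`. -/
theorem β_mul_g {t : Bool} (ht : sgn t = -β ^ 2) :
    (quasiHopfA β).β * (quasiHopfA β).g = wA t := by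
  rw [β_eq, g_eq]
  cases t
  · rw [sgn_false] at ht
    rw [show β ^ 2 = 1 by linear_combination ht]
    simp
  · rw [sgn_true] at ht
    rw [show β ^ 2 = -1 by linear_combination ht, show (1 : subA) + ((-1 : ℂ) - 1) • idem1 KA =
      1 - 2 • idem1 KA by module, one_sub_idem1, ← wA_mul_not true, mul_assoc]
    exact (congrArg _ (wA_mul_self false)).trans (mul_one _)

theorem β_mul_self (hβ : β ^ 4 = 1) : (quasiHopfA β).β * (quasiHopfA β).β = 1 := by
  rw [β_eq]
  simp only [add_mul, mul_add, one_mul, mul_one, smul_mul_assoc, mul_smul_comm, idem1_sq,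
    smul_smul, smul_add]
  rw [add_assoc, ← add_smul, ← add_smul, show β ^ 2 - 1 + (β ^ 2 - 1 + (β ^ 2 - 1) * (β ^ 2 - 1)) =
    β ^ 4 - 1 by ring, hβ, sub_self, zero_smul, add_zero]

theorem β_central (a : subA) : (quasiHopfA β).β * a = a * (quasiHopfA β).β := by
  rw [β_eq, add_mul, mul_add, one_mul, mul_one, smul_mul_assoc, mul_smul_comm, idem1_central]

theorem antipodeInv_β : (quasiHopfA β).antipodeInv (quasiHopfA β).β = (quasiHopfA β).β := by
  apply QuasiHopfData.antipodeInv_of_eq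
  rw [β_eq, map_add, map_smul, QuasiHopfData.antipode_one, antipode_idem1]

theorem wA_mul_β (hβ : β ^ 4 = 1) {t : Bool} (ht : sgn t = -β ^ 2) :
    wA t * (quasiHopfA β).β = (quasiHopfA β).g := by
  rw [← β_mul_g ht, ← β_central, ← mul_assoc, β_mul_self hβ, one_mul]

/-- The Hopf pair conditions may be checked on generators. -/
theorem isHopfPair_of_generators {D : subA →ₐ[ℂ] subA ⊗[ℂ] subA} {T : subA →ₐ[ℂ] subAᵐᵒᵖ}
    {c : subA}
    (h1 : ∀ s, mulRightFold D (halfAntipode D T (wA s)) = wA s ⊗ₜ 1)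
    (h2 : ∀ s, mulRightFold D (halfAntipode D T (fA s)) = fA s ⊗ₜ 1)
    (h3 : ∀ s, mulLeftFold D c (halfAntipode D T (wA s)) = wA s ⊗ₜ c)
    (h4 : ∀ s, mulLeftFold D c (halfAntipode D T (fA s)) = fA s ⊗ₜ c)
    (h5 : ∀ s, antipodeFold D T (D (wA s)) = wA s ⊗ₜ 1)
    (h6 : ∀ s, antipodeFold D T (D (fA s)) = fA s ⊗ₜ 1) : IsHopfPair D T c := by
  refine ⟨subA_induction h1 h2 ?_ ?_ ?_, subA_induction h3 h4 ?_ ?_ ?_,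
    subA_induction h5 h6 ?_ ?_ ?_⟩
  · intro r
    rw [AlgHom.commutes, Algebra.algebraMap_eq_smul_one, Algebra.algebraMap_eq_smul_one,
      map_smul, Algebra.TensorProduct.one_def, mulRightFold_tmul]
    simp [TensorProduct.smul_tmul']
  · intro x y hx hy
    rw [map_add, map_add, hx, hy, TensorProduct.add_tmul]
  · intro x y hx hy
    rw [map_mul, mulRightFold_mul D _ _ hy, hx]
    simp
  · intro r
    rw [AlgHom.commutes, Algebra.algebraMap_eq_smul_one, Algebra.algebraMap_eq_smul_one,
      map_smul, Algebra.TensorProduct.one_def, mulLeftFold_tmul]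
    simp [TensorProduct.smul_tmul']
  · intro x y hx hy
    rw [map_add, map_add, hx, hy, TensorProduct.add_tmul]
  · intro x y hx hy
    rw [map_mul, mulLeftFold_mul D c _ _ hx, hy]
    simp
  · intro r
    rw [AlgHom.commutes, Algebra.algebraMap_eq_smul_one, Algebra.algebraMap_eq_smul_one,
      map_smul, Algebra.TensorProduct.one_def, antipodeFold_tmul, map_one,
      Algebra.TensorProduct.one_def, unopMulRight_tmul]
    simp [TensorProduct.smul_tmul']
  · intro x y hx hy
    rw [map_add, map_add, hx, hy, TensorProduct.add_tmul]
  · intro x y hx hy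
    rw [map_mul, antipodeFold_mul D T _ _ hx, hy]
    simp

theorem halfAntipode_of_eq_tmul {D : subA →ₐ[ℂ] subA ⊗[ℂ] subA} {T : subA →ₐ[ℂ] subAᵐᵒᵖ}
    {a b c : subA} (h : D a = b ⊗ₜ c) : halfAntipode D T a = b ⊗ₜ T c := by
  rw [halfAntipode, AlgHom.comp_apply, h]; rfl

theorem halfAntipode_of_eq_add {D : subA →ₐ[ℂ] subA ⊗[ℂ] subA} {T : subA →ₐ[ℂ] subAᵐᵒᵖ}
    {a b c b' c' : subA} (h : D a = b ⊗ₜ c + b' ⊗ₜ c') :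
    halfAntipode D T a = b ⊗ₜ T c + b' ⊗ₜ T c' := by
  rw [halfAntipode, AlgHom.comp_apply, h, map_add]; rfl

theorem wA_mul_fA (s t : Bool) : wA t * fA s = -(fA s * wA t) := by
  rw [fA_mul_wA, neg_neg]

theorem wA_conj (s t : Bool) : wA s * wA t * wA s = wA t := by
  rw [wA_comm, mul_assoc, wA_mul_self, mul_one]

/-- Either sign `t` works: conjugation by `ω_t` fixes `ω_±` and negates `f_±`, as does the square of
the antipode. -/
theorem isHopfPair (β : ℂ) (t : Bool) :
    IsHopfPair (quasiHopfA β).Δ ((quasiHopfA β).S : subA →ₐ[ℂ] subAᵐᵒᵖ) (wA t) := by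
  have hTw : ∀ s, ((quasiHopfA β).S : subA →ₐ[ℂ] subAᵐᵒᵖ) (wA s) = MulOpposite.op (wA s) :=
    fun s => MulOpposite.unop_injective (antipode_wA β s)
  have hTf : ∀ s, ((quasiHopfA β).S : subA →ₐ[ℂ] subAᵐᵒᵖ) (fA s) =
      MulOpposite.op (fA s * wA s) := fun s => MulOpposite.unop_injective (antipode_fA β s)
  have hw : ∀ s, halfAntipode (quasiHopfA β).Δ ((quasiHopfA β).S : subA →ₐ[ℂ] subAᵐᵒᵖ) (wA s) =
      wA s ⊗ₜ MulOpposite.op (wA s) := fun s => by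
    rw [halfAntipode_of_eq_tmul (Δ_wA β s), hTw]
  have hf : ∀ s, halfAntipode (quasiHopfA β).Δ ((quasiHopfA β).S : subA →ₐ[ℂ] subAᵐᵒᵖ) (fA s) =
      fA s ⊗ₜ 1 + wA s ⊗ₜ MulOpposite.op (fA s * wA s) := fun s => by
    rw [halfAntipode_of_eq_add (Δ_fA β s), hTf, map_one]
  refine isHopfPair_of_generators ?_ ?_ ?_ ?_ ?_ ?_ <;> intro s
  · rw [hw, mulRightFold_tmul, Δ_wA, Algebra.TensorProduct.tmul_mul_tmul, mul_one,
      MulOpposite.unop_op, wA_mul_self]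
  · rw [hf, map_add, mulRightFold_tmul, mulRightFold_tmul, Δ_fA, Δ_wA,
      Algebra.TensorProduct.tmul_mul_tmul, MulOpposite.unop_op, ← mul_assoc (wA s), wA_mul_fA,
      neg_mul, mul_assoc (fA s), wA_mul_self, MulOpposite.unop_one,
      ← Algebra.TensorProduct.one_def]
    simp [TensorProduct.tmul_neg]
  · rw [hw, mulLeftFold_tmul, Δ_wA, Algebra.TensorProduct.tmul_mul_tmul, one_mul,
      MulOpposite.unop_op, wA_conj]
  · rw [hf, map_add, mulLeftFold_tmul, mulLeftFold_tmul, Δ_fA, Δ_wA, mul_add,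
      Algebra.TensorProduct.tmul_mul_tmul, Algebra.TensorProduct.tmul_mul_tmul,
      Algebra.TensorProduct.tmul_mul_tmul, MulOpposite.unop_op, MulOpposite.unop_one,
      mul_assoc (fA s), mul_assoc (fA s), wA_conj]
    simp [wA_mul_fA, TensorProduct.tmul_neg]
  · rw [Δ_wA, antipodeFold_tmul, hw, unopMulRight_tmul, MulOpposite.unop_op, wA_mul_self]
  · rw [Δ_fA, map_add, antipodeFold_tmul, antipodeFold_tmul, hw, hf, map_add, unopMulRight_tmul,
      unopMulRight_tmul, unopMulRight_tmul, MulOpposite.unop_op, MulOpposite.unop_op, wA_mul_fA]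
    simp [TensorProduct.tmul_neg]

theorem isHopfPair_coop (β : ℂ) (t : Bool) :
    IsHopfPair (coopΔ (quasiHopfA β)) (antipodeInvOp (quasiHopfA β)) (wA t) := by
  have hDw : ∀ s, coopΔ (quasiHopfA β) (wA s) = wA s ⊗ₜ wA s := fun s => by
    change Algebra.TensorProduct.comm ℂ subA subA ((quasiHopfA β).Δ (wA s)) = _
    rw [Δ_wA]; rfl
  have hDf : ∀ s, coopΔ (quasiHopfA β) (fA s) = 1 ⊗ₜ fA s + fA s ⊗ₜ wA s := fun s => by
    change Algebra.TensorProduct.comm ℂ subA subA ((quasiHopfA β).Δ (fA s)) = _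
    rw [Δ_fA, map_add]; rfl
  have hw : ∀ s, halfAntipode (coopΔ (quasiHopfA β)) (antipodeInvOp (quasiHopfA β)) (wA s) =
      wA s ⊗ₜ MulOpposite.op (wA s) := fun s => by
    rw [halfAntipode_of_eq_tmul (hDw s), antipodeInvOp_apply, antipodeInv_wA]
  have hf : ∀ s, halfAntipode (coopΔ (quasiHopfA β)) (antipodeInvOp (quasiHopfA β)) (fA s) =
      1 ⊗ₜ MulOpposite.op (wA s * fA s) + fA s ⊗ₜ MulOpposite.op (wA s) := fun s => by
    rw [halfAntipode_of_eq_add (hDf s), antipodeInvOp_apply, antipodeInvOp_apply, antipodeInv_wA,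
      antipodeInv_fA]
  refine isHopfPair_of_generators ?_ ?_ ?_ ?_ ?_ ?_ <;> intro s
  · rw [hw, mulRightFold_tmul, hDw, Algebra.TensorProduct.tmul_mul_tmul, mul_one,
      MulOpposite.unop_op, wA_mul_self]
  · rw [hf, map_add, mulRightFold_tmul, mulRightFold_tmul, hDf, map_one, add_mul,
      Algebra.TensorProduct.tmul_mul_tmul, Algebra.TensorProduct.tmul_mul_tmul,
      MulOpposite.unop_op, MulOpposite.unop_op, wA_mul_self, wA_mul_fA]
    simp [TensorProduct.tmul_neg]
  · rw [hw, mulLeftFold_tmul, hDw, Algebra.TensorProduct.tmul_mul_tmul, one_mul,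
      MulOpposite.unop_op, wA_conj]
  · rw [hf, map_add, mulLeftFold_tmul, mulLeftFold_tmul, hDf, map_one, mul_add,
      Algebra.TensorProduct.tmul_mul_tmul, Algebra.TensorProduct.tmul_mul_tmul,
      MulOpposite.unop_op, MulOpposite.unop_op, wA_conj, mul_assoc (wA s), mul_assoc (wA s),
      wA_mul_fA s t]
    simp [TensorProduct.tmul_neg]
  · rw [hDw, antipodeFold_tmul, hw, unopMulRight_tmul, MulOpposite.unop_op, wA_mul_self]
  · rw [hDf, map_add, antipodeFold_tmul, antipodeFold_tmul, hf, map_add, map_one,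
      Algebra.TensorProduct.one_def, unopMulRight_tmul, unopMulRight_tmul, unopMulRight_tmul,
      MulOpposite.unop_op, MulOpposite.unop_op, wA_mul_self, wA_mul_fA, neg_mul,
      mul_assoc (fA s), wA_mul_self]
    simp [TensorProduct.tmul_neg]

variable {lam : subA →ₗ[ℂ] ℂ} {t : Bool} {κ : ℂ}

theorem IsTopForm.ne_zero (h : IsTopForm lam t κ) (hκ : κ ≠ 0) : lam ≠ 0 := by
  rintro rfl
  exact hκ h.apply_wA.symm

theorem IsTopForm.isRightSymCointegral (hβ : β ^ 4 = 1) (ht : sgn t = -β ^ 2)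
    (h : IsTopForm lam t κ) (hκ : κ ≠ 0) : (quasiHopfA β).IsRightSymCointegral lam :=
  isRightSymCointegral_of (hasSignCoassociator hβ) (h.ne_zero hκ) (wA_mul_β hβ ht)
    (h.right_cointegral β)

theorem IsTopForm.isLeftSymCointegral (hβ : β ^ 4 = 1) (ht : sgn t = -β ^ 2)
    (h : IsTopForm lam (!t) κ) (hκ : κ ≠ 0) : (quasiHopfA β).IsLeftSymCointegral lam := by
  refine isLeftSymCointegral_of (hasSignCoassociator hβ) (h.ne_zero hκ) (c := wA t) ?_ ?_
  · rw [antipodeInv_β, wA_mul_β hβ ht]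
  · have h1 := h.left_cointegral β
    rwa [Bool.not_not] at h1

theorem IsTopForm.isRightModifiedTrace (hβ : β ^ 4 = 1) (ht : sgn t = -β ^ 2)
    (h : IsTopForm lam t κ) : (hsTrace lam).IsRightModifiedTrace (quasiHopfA β) :=
  hsTrace_isRightModifiedTrace (hasSignCoassociator hβ) Δ_one_sub_idem1 (β_mul_g ht)
    (antipode_wA β t) (isHopfPair β t) h.symm (h.right_cointegral β)

theorem IsTopForm.isLeftModifiedTrace (hβ : β ^ 4 = 1) (ht : sgn t = -β ^ 2)
    (h : IsTopForm lam (!t) κ) : (hsTrace lam).IsLeftModifiedTrace (quasiHopfA β) := by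
  refine hsTrace_isLeftModifiedTrace (hasSignCoassociator hβ) Δ_one_sub_idem1
    ((β_central _).symm.trans (β_mul_g ht)) (antipodeInv_wA β t) (isHopfPair_coop β t) h.symm ?_
  -- A left cointegral for `Δ` is a right cointegral for the opposite coproduct.
  intro a
  have h1 := h.left_cointegral β a
  rw [Bool.not_not] at h1
  rw [← h1]
  change TensorProduct.lid ℂ subA (lam.rTensor subA
    (TensorProduct.comm ℂ subA subA ((quasiHopfA β).Δ a))) = _
  rw [lid_rTensor_comm, show TensorProduct.comm ℂ subA subA
    (TensorProduct.comm ℂ subA subA ((quasiHopfA β).Δ a)) = (quasiHopfA β).Δ a from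
    TensorProduct.comm_comm _ _ _ _]

end SF
end

noncomputable section

namespace SF

open FDMod

/-! ### Comparison of top forms -/

theorem wA_mul_KA_sq (s : Bool) : wA s * KA ^ 2 = wA (!s) := by
  rw [← wA_mul_not s, ← mul_assoc, wA_mul_self, one_mul]

theorem KA_sq_mul_KA_sq : KA ^ 2 * KA ^ 2 = 1 := by rw [← pow_add, KA_pow]

section Compare

variable {lam lam' : subA →ₗ[ℂ] ℂ} {t : Bool} {κ κ' : ℂ}

theorem apply_mul_grouplike_mul_KA_sq {x : subA}
    (hx : ∀ y ∈ grouplikes, lam (x * y) = 0) {y : subA} (hy : y ∈ grouplikes) :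
    lam (x * y * KA ^ 2) = 0 := by
  rcases hy with rfl | rfl | ⟨s, rfl⟩
  · rw [mul_one]; exact hx _ (Or.inr (Or.inl rfl))
  · rw [mul_assoc, KA_sq_mul_KA_sq]; exact hx _ (Or.inl rfl)
  · rw [mul_assoc, wA_mul_KA_sq]; exact hx _ (Or.inr (Or.inr ⟨_, rfl⟩))

/-- Two top forms, concentrated on `ω_t` and `ω_{-t}`, are exchanged by `K²`. -/
theorem IsTopForm.apply_mul_KA_sq (h : IsTopForm lam t κ) (h' : IsTopForm lam' (!t) κ')
    (a : subA) : κ' * lam (a * KA ^ 2) = κ * lam' a := by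
  refine LinearMap.congr_fun (subA_linearMap_ext
    (F := κ' • (lam ∘ₗ LinearMap.mulRight ℂ (KA ^ 2))) (G := κ • lam') ?_ ?_ ?_) a
  · intro y hy
    change κ' * lam (y * KA ^ 2) = κ * lam' y
    rw [h'.apply_grouplike y hy, ← one_mul y, apply_mul_grouplike_mul_KA_sq _ hy, mul_zero, mul_zero]
    simpa using h.apply_grouplike
  · intro s y hy
    change κ' * lam (fA s * y * KA ^ 2) = κ * lam' (fA s * y)
    rw [h'.apply_fA s y hy, apply_mul_grouplike_mul_KA_sq (h.apply_fA s) hy, mul_zero, mul_zero]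
  · intro y hy
    change κ' * lam (fA true * fA false * y * KA ^ 2) = κ * lam' (fA true * fA false * y)
    rcases hy with rfl | rfl | ⟨s, rfl⟩
    · rw [mul_one, h.apply_KA_sq, h'.apply_one, mul_zero, mul_zero]
    · rw [mul_assoc, KA_sq_mul_KA_sq, mul_one, h.apply_one, h'.apply_KA_sq, mul_zero, mul_zero]
    · rw [mul_assoc, wA_mul_KA_sq]
      rcases Bool.eq_or_eq_not s t with rfl | rfl
      · have h2 := h'.apply_wA_not
        rw [Bool.not_not] at h2
        rw [h.apply_wA_not, h2, mul_zero, mul_zero]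
      · rw [Bool.not_not, h.apply_wA, h'.apply_wA, mul_comm]

theorem idem0_mul_KA_sq : idem0 KA * KA ^ 2 = idem0 KA := by
  rw [← idem0_sub_idem1, mul_sub, idem0_sq, idem0_mul_idem1, sub_zero]

theorem IsTopForm.apply_of_idem0 (h : IsTopForm lam t κ) (h' : IsTopForm lam' (!t) κ')
    {a : subA} (ha : idem0 KA * a = a) : κ' * lam a = κ * lam' a := by
  rw [← h.apply_mul_KA_sq h', ← ha, idem0_central, mul_assoc, idem0_mul_KA_sq]

/-- `K²` is `-1` on `e₁` but `1` on `e₀`; the resulting opposite signs are what prevents global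
proportionality. -/
theorem IsTopForm.apply_of_idem1 (h : IsTopForm lam t κ) (h' : IsTopForm lam' (!t) κ')
    {a : subA} (ha : idem1 KA * a = a) : κ' * lam a = -κ * lam' a := by
  rw [neg_mul, ← h.apply_mul_KA_sq h', ← ha, idem1_central, mul_assoc, idem1_mul_sq KA_pow, mul_neg,
    map_neg, mul_neg, neg_neg]

/-- Coordinates of a module on which `e` is the identity satisfy `e φ(x) = φ(x)`, so only the
restrictions of the forms to `eA` matter. -/
theorem _root_.FDMod.DualBasis.trace_proportional {A : Type} [Ring A] [Algebra ℂ A] {X : FDMod A}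
    {ι : Type} [Fintype ι] (b : DualBasis X ι) {lam lam' : A →ₗ[ℂ] ℂ} {e : A} {c c' : ℂ}
    (he : X.ρ e = 1) (h : ∀ a, e * a = a → c' * lam a = c * lam' a) (f : Module.End ℂ X.carrier) :
    c' * b.trace lam f = c * b.trace lam' f := by
  rw [DualBasis.trace_apply, DualBasis.trace_apply, Finset.mul_sum, Finset.mul_sum]
  refine Finset.sum_congr rfl fun k _ => h _ ?_
  rw [← b.coord_act, he]; rfl

variable {tR tL : TraceFamily (A := subA) FDMod.IsProjective}

theorem exists_proportional {e : subA} {c : ℂ} (hR : tR.IsCyclic) (hRl : tR.CorrespondsTo lam)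
    (hL : tL.IsCyclic) (hLl : tL.CorrespondsTo lam') (hc : c ≠ 0) (hκ' : κ' ≠ 0)
    (h : ∀ a, e * a = a → κ' * lam a = c * lam' a) :
    ∃ c : ℂ, c ≠ 0 ∧ ∀ (P : FDMod subA) (hP : P.IsProjective), P.ρ e = 1 →
      ∀ f : FDMod.Hom P P, tR P hP f = c * tL P hP f := by
  refine ⟨c / κ', div_ne_zero hc hκ', fun P hP he f => ?_⟩
  obtain ⟨n, ⟨b⟩⟩ := hP.exists_dualBasis
  rw [eq_trace_of_correspondsTo hR hRl hP b, eq_trace_of_correspondsTo hL hLl hP b,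
    div_mul_eq_mul_div, eq_div_iff hκ', mul_comm]
  exact b.trace_proportional he h f.1

theorem not_proportional (h : IsTopForm lam t κ) (h' : IsTopForm lam' (!t) κ') (hκ : κ ≠ 0)
    (hRl : tR.CorrespondsTo lam) (hLl : tL.CorrespondsTo lam') :
    ¬ ∃ c : ℂ, ∀ (P : FDMod subA) (hP : P.IsProjective),
      ∀ f : FDMod.Hom P P, tR P hP f = c * tL P hP f := by
  rintro ⟨c, hc⟩
  have hP : (regular subA).IsProjective := (regularDualBasis subA).isProjective
  -- Right multiplication by `f_+ f_- ω_t` separates the traces: it has trace `κ` for `lam` and `0`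
  -- for `lam'`.
  let f : FDMod.Hom (regular subA) (regular subA) :=
    ⟨LinearMap.mulRight ℂ (fA true * fA false * wA t), fun a => by
      ext x
      exact congrArg Subtype.val (mul_assoc a x _)⟩
  have h1 := hc (regular subA) hP f
  rw [hRl (regular subA) hP LinearMap.id LinearMap.id (fun _ _ => rfl) (fun _ _ => rfl) rfl,
    hLl (regular subA) hP LinearMap.id LinearMap.id (fun _ _ => rfl) (fun _ _ => rfl) rfl] at h1
  change lam (1 * (fA true * fA false * wA t)) = c * lam' (1 * (fA true * fA false * wA t)) at h1
  have h2 := h'.apply_wA_not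
  rw [Bool.not_not] at h2
  rw [one_mul, h.apply_wA, h2, mul_zero] at h1
  exact hκ h1

end Compare

/-! ### Restriction of projective modules along `A ⊂ Q(2, β)` -/

theorem SF_induction {N : ℕ} {p : SF N → Prop} (hK : p K) (hf : ∀ i s, p (f i s))
    (hc : ∀ c, p (algebraMap ℂ (SF N) c)) (hadd : ∀ x y, p x → p y → p (x + y))
    (hmul : ∀ x y, p x → p y → p (x * y)) (a : SF N) : p a := by
  obtain ⟨x, rfl⟩ := RingQuot.mkAlgHom_surjective ℂ (SFRel N) a
  induction x with
  | grade0 c => rw [AlgHom.commutes]; exact hc c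
  | grade1 g =>
    cases g with
    | K => exact hK
    | f i s => exact hf i s
  | mul x y hx hy => rw [map_mul]; exact hmul _ _ hx hy
  | add x y hx hy => rw [map_add]; exact hadd _ _ hx hy

/-- Right multiplication by elements of `Q(2, β)` as matrices over `A`. -/
def mulMatrix : SF 2 →ₐ[ℂ] Matrix (Fin 4) (Fin 4) subA :=
  extLift (N := 1) (k := KA) (φ := fun _ s => fA s) KA_pow
    (fun _ s => Subtype.ext (f_K 0 s))
    (fun i j s t => by
      have hij : i = j := Subsingleton.elim _ _
      rcases Bool.eq_or_eq_not t s with rfl | rfl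
      · simp [fA_mul_fA]
      · rw [fA_mul_fA_not, if_pos ⟨hij, by simp⟩])

theorem mulMatrix_K : mulMatrix K = oddDiag KA := extLift_K _ _ _

theorem mulMatrix_f_zero (s : Bool) : mulMatrix (f 0 s) = oddDiag (fA s) :=
  extLift_f_castSucc (N := 1) _ _ _ 0 s

theorem mulMatrix_f_one (s : Bool) : mulMatrix (f 1 s) = newFermion KA s :=
  extLift_f_last (N := 1) _ _ _ s

/-- The basis of `Q(2, β)` as a left `A`-module. -/
def cosetBasis : Fin 4 → SF 2 := ![1, f 1 true, f 1 false, f 1 true * f 1 false]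

theorem f_mul_K (i : Fin 2) (s : Bool) : f i s * K = -((K : SF 2) * f i s) :=
  eq_neg_of_add_eq_zero_left (f_K i s)

theorem f_one_mul_f_zero (s t : Bool) : f 1 s * f 0 t = -((f 0 t : SF 2) * f 1 s) :=
  eq_neg_of_add_eq_zero_left ((f_f 1 0 s t).trans (if_neg (by simp)))

theorem f_one_mul_self (s : Bool) : (f 1 s : SF 2) * f 1 s = 0 := by
  have h2 : (2 : ℂ) • (f (N := 2) 1 s * f 1 s) = 0 := by
    rw [two_smul, f_f]; simp
  exact (smul_eq_zero.1 h2).resolve_left two_ne_zero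

theorem f_one_false_mul_true : (f 1 false : SF 2) * f 1 true = idem1 K - f 1 true * f 1 false :=
  eq_sub_of_add_eq ((f_f 1 1 false true).trans (if_pos (by simp)))

theorem coe_idem1 : ((idem1 KA : subA) : SF 2) = idem1 K := map_idem1 subA.val KA

theorem cosetBasis_mul_odd {x : SF 2} (a : subA) (ha : (a : SF 2) = x)
    (h : ∀ s, f 1 s * x = -(x * f 1 s)) (i : Fin 4) :
    cosetBasis i * x = ∑ j, ((oddDiag a i j : subA) : SF 2) * cosetBasis j := by
  subst ha
  have h' : f 1 true * f 1 false * (a : SF 2) = (a : SF 2) * (f 1 true * f 1 false) := by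
    rw [mul_assoc, h, mul_neg, ← mul_assoc, h, neg_mul, neg_neg, mul_assoc]
  rw [Fintype.sum_eq_single i]
  · rw [oddDiag, Matrix.diagonal_apply_eq]
    fin_cases i
    · simp [cosetBasis]
    · simp [cosetBasis, h]
    · simp [cosetBasis, h]
    · simp [cosetBasis, h']
  · intro j hj
    rw [oddDiag, Matrix.diagonal_apply_ne _ hj.symm]
    simp

/-- The identity is closed under products, hence may be checked on generators. It shows that the
abstract matrices are those of right multiplication and, for `i = 0`, that the four elements
generate `Q(2, β)` over `A`. -/
theorem cosetBasis_mul (h : SF 2) (i : Fin 4) :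
    cosetBasis i * h = ∑ j, ((mulMatrix h i j : subA) : SF 2) * cosetBasis j := by
  refine SF_induction (p := fun h => ∀ i, cosetBasis i * h =
    ∑ j, ((mulMatrix h i j : subA) : SF 2) * cosetBasis j) ?_ ?_ ?_ ?_ ?_ h i
  · rw [mulMatrix_K]
    exact cosetBasis_mul_odd KA rfl (f_mul_K 1)
  · intro i s
    fin_cases i
    · change ∀ i, cosetBasis i * f 0 s = ∑ j, ((mulMatrix (f 0 s) i j : subA) : SF 2) * cosetBasis j
      rw [mulMatrix_f_zero]
      exact cosetBasis_mul_odd (fA s) rfl (fun t => f_one_mul_f_zero t s)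
    · change ∀ i, cosetBasis i * f 1 s = ∑ j, ((mulMatrix (f 1 s) i j : subA) : SF 2) * cosetBasis j
      rw [mulMatrix_f_one]
      have h1 : (f 1 true : SF 2) * idem1 K = idem1 K * f 1 true := idem1_anticomm (f_K 1 true)
      intro i
      rw [Fin.sum_univ_four]
      cases s <;> fin_cases i <;>
        simp [cosetBasis, newFermion, f_one_mul_self, f_one_false_mul_true, coe_idem1, mul_assoc,
          sub_eq_add_neg, mul_add, h1]
      rw [← mul_assoc, f_one_mul_self, zero_mul]
  · intro c i
    rw [AlgHom.commutes, Fintype.sum_eq_single i]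
    · rw [Matrix.algebraMap_matrix_apply, if_pos rfl]
      exact (Algebra.commutes c _).symm
    · intro j hj
      rw [Matrix.algebraMap_matrix_apply, if_neg hj.symm]
      simp
  · intro x y hx hy i
    simp only [mul_add, hx, hy, map_add, Matrix.add_apply, Subalgebra.coe_add, add_mul,
      Finset.sum_add_distrib]
  · intro x y hx hy i
    rw [← mul_assoc, hx, Finset.sum_mul]
    simp only [mul_assoc, hy, map_mul, Matrix.mul_apply, AddSubmonoidClass.coe_finsetSum,
      Subalgebra.coe_mul, Finset.sum_mul, Finset.mul_sum]
    rw [Finset.sum_comm]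

/-- The automorphism `K ↦ -K`, `f ↦ -f`. -/
def parity : SF 2 →ₐ[ℂ] SF 2 :=
  lift (-K) (fun i s => -f i s)
    (by rw [Even.neg_pow (by decide), K_pow])
    (fun i s => by rw [neg_mul_neg, neg_mul_neg, f_K])
    (fun i j s t => by rw [neg_mul_neg, neg_mul_neg, f_f, idem1, idem1, neg_sq])

theorem parity_mem (a : subA) : parity (a : SF 2) ∈ subA := by
  refine subA_induction (p := fun a => parity (a : SF 2) ∈ subA) ?_ ?_ ?_ ?_ ?_ a
  · intro s
    rw [wA_eq]
    have hK : parity (KA : SF 2) ∈ subA := by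
      rw [show parity (KA : SF 2) = -K from lift_K _ _ _ _ _]
      exact subA.neg_mem K_mem
    change parity (_ • (KA : SF 2) + _ • (KA : SF 2) ^ 3) ∈ subA
    rw [map_add, map_smul, map_smul, map_pow]
    exact subA.add_mem (subA.smul_mem hK _) (subA.smul_mem (subA.pow_mem hK _) _)
  · intro s
    rw [show parity (fA s : SF 2) = -f 0 s from lift_f _ _ _ _ _ _ _]
    exact subA.neg_mem (f_mem s)
  · intro c
    change parity (algebraMap ℂ (SF 2) c) ∈ subA
    rw [AlgHom.commutes]
    exact subA.algebraMap_mem c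
  · intro x y hx hy
    rw [Subalgebra.coe_add, map_add]
    exact subA.add_mem hx hy
  · intro x y hx hy
    rw [Subalgebra.coe_mul, map_mul]
    exact subA.mul_mem hx hy

/-- The automorphism `K ↦ -K`, `f ↦ -f` of `A`. -/
def parityA : subA →ₐ[ℂ] subA := (parity.comp subA.val).codRestrict subA parity_mem

theorem parityA_KA : parityA KA = -KA := Subtype.ext (lift_K _ _ _ _ _)

theorem parityA_fA (s : Bool) : parityA (fA s) = -fA s := Subtype.ext (lift_f _ _ _ _ _ _ _)

theorem parityA_wA (s : Bool) : parityA (wA s) = -wA s := by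
  rw [wA_eq, map_add, map_smul, map_smul, map_pow, parityA_KA, Odd.neg_pow (by decide)]
  module

/-- Moving `a` past one fermion of the second pair applies the parity automorphism; past two it does
nothing. -/
theorem mulMatrix_coe (a : subA) :
    mulMatrix (a : SF 2) = Matrix.diagonal ![a, parityA a, parityA a, a] := by
  have key : ∀ a : subA, parityA a = -a → oddDiag a = Matrix.diagonal ![a, parityA a, parityA a, a] :=
    fun a ha => by rw [ha, oddDiag]
  refine subA_induction (p := fun a : subA =>
    mulMatrix (a : SF 2) = Matrix.diagonal ![a, parityA a, parityA a, a]) ?_ ?_ ?_ ?_ ?_ a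
  · intro s
    rw [← key _ (parityA_wA s), wA_eq]
    change mulMatrix (_ • (K : SF 2) + _ • (K : SF 2) ^ 3) = _
    rw [map_add, map_smul, map_smul, map_pow, mulMatrix_K, oddDiag, oddDiag, Matrix.diagonal_pow,
      ← Matrix.diagonal_smul, ← Matrix.diagonal_smul, Matrix.diagonal_add]
    congr 1
    ext1 i
    fin_cases i
    · simp
    · simp [Odd.neg_pow (show Odd 3 by decide)]; abel
    · simp [Odd.neg_pow (show Odd 3 by decide)]; abel
    · simp
  · intro s
    rw [← key _ (parityA_fA s)]
    exact mulMatrix_f_zero s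
  · intro c
    change mulMatrix (algebraMap ℂ (SF 2) c) = _
    rw [AlgHom.commutes, AlgHom.commutes, Matrix.algebraMap_eq_diagonal]
    congr 1
    ext1 i
    fin_cases i <;> rfl
  · intro x y hx hy
    rw [Subalgebra.coe_add, map_add, hx, hy, Matrix.diagonal_add]
    congr 1
    ext1 i
    fin_cases i <;> simp
  · intro x y hx hy
    rw [Subalgebra.coe_mul, map_mul, hx, hy, Matrix.diagonal_mul_diagonal]
    congr 1
    ext1 i
    fin_cases i <;> simp

/-- The dual basis of the restriction of a projective module. -/
def resDualBasis {X : FDMod (SF 2)} {ι : Type} [Fintype ι] (b : DualBasis X ι) :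
    DualBasis (X.res subA) (ι × Fin 4) where
  vec := fun k => X.ρ (cosetBasis k.2) (b.vec k.1)
  coord := fun k => (Matrix.entryLinearMap ℂ subA 0 k.2) ∘ₗ mulMatrix.toLinearMap ∘ₗ b.coord k.1
  coord_act := fun k a x => by
    refine (congrArg (fun y => mulMatrix y 0 k.2) (b.coord_act k.1 (a : SF 2) x)).trans ?_
    rw [map_mul, mulMatrix_coe, Matrix.diagonal_mul]
    rfl
  sum_coord := fun x => by
    rw [Fintype.sum_prod_type]
    refine (Finset.sum_congr rfl fun k _ => ?_).trans (b.sum_coord x)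
    -- Row `0` belongs to the representative `1`, so it expands the element itself.
    have h := cosetBasis_mul (b.coord k x) 0
    rw [show cosetBasis 0 = 1 from rfl, one_mul] at h
    rw [h, map_sum, LinearMap.sum_apply]
    refine Finset.sum_congr rfl fun j _ => ?_
    rw [map_mul]; rfl

theorem mulMatrix_cosetBasis (j l : Fin 4) :
    mulMatrix (cosetBasis j) 0 l = if l = j then 1 else 0 := by
  fin_cases j <;> fin_cases l <;>
    simp [cosetBasis, mulMatrix_f_one, newFermion, Matrix.mul_apply, Fin.sum_univ_four]

/-- With `h = φ_k(f(x_k))`, the coordinate for the pair `(k, j)` is entry `(0, j)` of `M(c_j h)`,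
which is the diagonal entry `(j, j)` of `M(h)`. -/
theorem resDualBasis_trace {X : FDMod (SF 2)} {ι : Type} [Fintype ι] (b : DualBasis X ι)
    (lam : subA →ₗ[ℂ] ℂ) (f : FDMod.Hom X X) :
    (resDualBasis b).trace lam (FDMod.resEnd subA X f).1 =
      ∑ k, lam ((mulMatrix (b.coord k (f.1 (b.vec k)))).trace) := by
  rw [DualBasis.trace_apply, Fintype.sum_prod_type]
  refine Finset.sum_congr rfl fun k _ => ?_
  rw [Matrix.trace, map_sum]
  refine Finset.sum_congr rfl fun j _ => congrArg lam ?_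
  change mulMatrix (b.coord k (f.1 (X.ρ (cosetBasis j) (b.vec k)))) 0 j = _
  rw [Hom.apply, b.coord_act, map_mul, Matrix.mul_apply]
  simp [mulMatrix_cosetBasis]

variable {lam : subA →ₗ[ℂ] ℂ} {t : Bool} {κ : ℂ}

/-- Parity fixes `f_+ f_-` and negates `ω_±`, where the form is concentrated. -/
theorem IsTopForm.apply_parityA (h : IsTopForm lam t κ) (a : subA) :
    lam (parityA a) = -lam a := by
  have hg : ∀ y ∈ grouplikes, (parityA y = y ∧ lam (fA true * fA false * y) = 0) ∨
      parityA y = -y := by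
    rintro y (rfl | rfl | ⟨s, rfl⟩)
    · exact Or.inl ⟨map_one _, by rw [mul_one]; exact h.apply_one⟩
    · exact Or.inl ⟨by rw [map_pow, parityA_KA, neg_sq], h.apply_KA_sq⟩
    · exact Or.inr (parityA_wA s)
  refine LinearMap.congr_fun (subA_linearMap_ext (F := lam ∘ₗ parityA.toLinearMap) (G := -lam)
    ?_ ?_ ?_) a
  · intro y hy
    change lam (parityA y) = -lam y
    rcases hg y hy with ⟨h1, -⟩ | h1 <;> simp [h1, h.apply_grouplike y hy]
  · intro s y hy
    change lam (parityA (fA s * y)) = -lam (fA s * y)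
    rcases hg y hy with ⟨h1, -⟩ | h1 <;> simp [h1, parityA_fA, h.apply_fA s y hy]
  · intro y hy
    change lam (parityA (fA true * fA false * y)) = -lam (fA true * fA false * y)
    rcases hg y hy with ⟨h1, h2⟩ | h1
    · simp [h1, parityA_fA, h2]
    · simp [h1, parityA_fA]

/-- By linearity `x = a c_j`. The trace is zero for the two odd `c_j`, and `2(a + π(a))` or `(a +
π(a)) e₁` for the even ones, with `π` the parity; a form odd under `π` kills both. -/
theorem IsTopForm.apply_trace_mulMatrix (h : IsTopForm lam t κ) (x : SF 2) :
    lam (mulMatrix x).trace = 0 := by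
  have hx := cosetBasis_mul x 0
  rw [show cosetBasis 0 = 1 from rfl, one_mul] at hx
  rw [hx, map_sum, Matrix.trace_sum, map_sum]
  refine Finset.sum_eq_zero fun j _ => ?_
  generalize mulMatrix x 0 j = a
  rw [map_mul, mulMatrix_coe, Matrix.trace]
  simp only [Matrix.diag_apply, Matrix.diagonal_mul, Fin.sum_univ_four]
  have h1 := h.apply_parityA (a * idem1 KA)
  rw [map_mul, map_idem1 parityA, parityA_KA, idem1, neg_sq, ← idem1] at h1
  fin_cases j
  · simp [cosetBasis, h.apply_parityA]
  · simp [cosetBasis, mulMatrix_f_one, newFermion]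
  · simp [cosetBasis, mulMatrix_f_one, newFermion]
  · simp [cosetBasis, mulMatrix_f_one, newFermion, Matrix.mul_apply, Fin.sum_univ_four, h1]

theorem IsTopForm.pullback_eq_zero (h : IsTopForm lam t κ)
    {tr : TraceFamily (A := subA) FDMod.IsProjective} (hc : tr.IsCyclic)
    (hl : tr.CorrespondsTo lam) {X : FDMod (SF 2)} {ι : Type} [Fintype ι] (b : DualBasis X ι)
    (hX : (X.res subA).IsProjective) (f : FDMod.Hom X X) : tr.pullback X hX f = 0 := by
  refine (eq_trace_of_correspondsTo hc hl hX (resDualBasis b) _).trans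
    ((resDualBasis_trace b lam f).trans ?_)
  exact Finset.sum_eq_zero fun k _ => h.apply_trace_mulMatrix _

end SF
end

noncomputable section

/-! ## Slices of tensors by linear forms -/

section Slice

variable {A B M : Type} [Ring A] [Algebra ℂ A] [Ring B] [Algebra ℂ B] [AddCommGroup M] [Module ℂ M]

/-- Apply a linear form to the left leg. -/
def sliceLeft (φ : A →ₗ[ℂ] ℂ) : A ⊗[ℂ] M →ₗ[ℂ] M :=
  (TensorProduct.lid ℂ M).toLinearMap ∘ₗ φ.rTensor M

/-- Apply a linear form to the right leg. -/
def sliceRight (φ : A →ₗ[ℂ] ℂ) : M ⊗[ℂ] A →ₗ[ℂ] M :=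
  (TensorProduct.rid ℂ M).toLinearMap ∘ₗ φ.lTensor M

@[simp] theorem sliceLeft_tmul (φ : A →ₗ[ℂ] ℂ) (a : A) (m : M) :
    sliceLeft φ (a ⊗ₜ[ℂ] m) = φ a • m := by simp [sliceLeft]

@[simp] theorem sliceRight_tmul (φ : A →ₗ[ℂ] ℂ) (a : A) (m : M) :
    sliceRight φ (m ⊗ₜ[ℂ] a) = φ a • m := by simp [sliceRight]

/-- `d` is a derivation with respect to the characters `χ` on the left and `ε` on the right. -/
def IsSkewDerivation (χ ε : A →ₐ[ℂ] ℂ) (d : A →ₗ[ℂ] ℂ) : Prop :=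
  ∀ a b, d (a * b) = d a * ε b + χ a * d b

theorem IsSkewDerivation.map_one {χ ε : A →ₐ[ℂ] ℂ} {d : A →ₗ[ℂ] ℂ}
    (h : IsSkewDerivation χ ε d) : d 1 = 0 := by
  have h1 := h 1 1
  rw [mul_one, _root_.map_one ε, _root_.map_one χ, mul_one, one_mul] at h1
  exact left_eq_add.1 h1

theorem sliceLeft_mul (χ : A →ₐ[ℂ] ℂ) (z w : A ⊗[ℂ] B) :
    sliceLeft χ.toLinearMap (z * w) =
      sliceLeft χ.toLinearMap z * sliceLeft χ.toLinearMap w := by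
  induction z with
  | zero => simp
  | add z z' hz hz' => rw [add_mul, map_add, hz, hz', map_add, add_mul]
  | tmul a b =>
    induction w with
    | zero => simp
    | add w w' hw hw' => rw [mul_add, map_add, hw, hw', map_add, mul_add]
    | tmul a' b' => simp [smul_smul, mul_comm]

theorem sliceRight_mul (χ : A →ₐ[ℂ] ℂ) (z w : B ⊗[ℂ] A) :
    sliceRight χ.toLinearMap (z * w) =
      sliceRight χ.toLinearMap z * sliceRight χ.toLinearMap w := by
  induction z with
  | zero => simp
  | add z z' hz hz' => rw [add_mul, map_add, hz, hz', map_add, add_mul]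
  | tmul a b =>
    induction w with
    | zero => simp
    | add w w' hw hw' => rw [mul_add, map_add, hw, hw', map_add, mul_add]
    | tmul a' b' => simp [smul_smul, mul_comm]

theorem IsSkewDerivation.sliceLeft_mul {χ ε : A →ₐ[ℂ] ℂ} {d : A →ₗ[ℂ] ℂ}
    (h : IsSkewDerivation χ ε d) (z w : A ⊗[ℂ] B) :
    sliceLeft d (z * w) = sliceLeft d z * sliceLeft ε.toLinearMap w +
      sliceLeft χ.toLinearMap z * sliceLeft d w := by
  induction z with
  | zero => simp
  | add z z' hz hz' => rw [add_mul, map_add, hz, hz', map_add, map_add, add_mul, add_mul]; abel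
  | tmul a b =>
    induction w with
    | zero => simp
    | add w w' hw hw' => rw [mul_add, map_add, hw, hw', map_add, map_add, mul_add, mul_add]; abel
    | tmul a' b' => simp [smul_smul, h a a', mul_comm, add_smul]

theorem IsSkewDerivation.sliceRight_mul {χ ε : A →ₐ[ℂ] ℂ} {d : A →ₗ[ℂ] ℂ}
    (h : IsSkewDerivation χ ε d) (z w : B ⊗[ℂ] A) :
    sliceRight d (z * w) = sliceRight d z * sliceRight ε.toLinearMap w +
      sliceRight χ.toLinearMap z * sliceRight d w := by
  induction z with
  | zero => simp
  | add z z' hz hz' => rw [add_mul, map_add, hz, hz', map_add, map_add, add_mul, add_mul]; abel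
  | tmul a b =>
    induction w with
    | zero => simp
    | add w w' hw hw' => rw [mul_add, map_add, hw, hw', map_add, map_add, mul_add, mul_add]; abel
    | tmul a' b' => simp [smul_smul, h b b', mul_comm, add_smul]

theorem sliceLeft_tmul_mul {φ : A →ₗ[ℂ] ℂ} {e : A} (he : ∀ a, φ (e * a) = 0) (b : B)
    (z : A ⊗[ℂ] B) : sliceLeft φ ((e ⊗ₜ b) * z) = 0 := by
  induction z with
  | zero => simp
  | add z z' hz hz' => rw [mul_add, map_add, hz, hz', add_zero]
  | tmul a b' => simp [he]

theorem sliceRight_tmul_mul {φ : A →ₗ[ℂ] ℂ} {e : A} (he : ∀ a, φ (e * a) = 0) (b : B)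
    (z : B ⊗[ℂ] A) : sliceRight φ ((b ⊗ₜ e) * z) = 0 := by
  induction z with
  | zero => simp
  | add z z' hz hz' => rw [mul_add, map_add, hz, hz', add_zero]
  | tmul a b' => simp [he]

/-- Both are `(φ ⊗ ψ)(R)`. Computing such a number in two ways is what rules out a ribbon structure.
-/
theorem apply_sliceLeft (φ ψ : A →ₗ[ℂ] ℂ) (R : A ⊗[ℂ] A) :
    ψ (sliceLeft φ R) = φ (sliceRight ψ R) := by
  induction R with
  | zero => simp
  | add z z' hz hz' => simp only [map_add, hz, hz']
  | tmul a b => simp [mul_comm]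

theorem sliceRight_comm (φ : A →ₗ[ℂ] ℂ) (R : A ⊗[ℂ] A) :
    sliceRight φ (Algebra.TensorProduct.comm ℂ A A R) = sliceLeft φ R := by
  induction R with
  | zero => simp
  | add z z' hz hz' => simp only [map_add, hz, hz']
  | tmul a b => simp

namespace QuasiHopfData

variable (φ : A →ₗ[ℂ] ℂ) (R : A ⊗[ℂ] A)

theorem sliceLeft_leg12 : sliceLeft φ (leg12 R) = sliceLeft φ R ⊗ₜ 1 := by
  induction R with
  | zero => simp
  | add z z' hz hz' => simp only [map_add, hz, hz', TensorProduct.add_tmul]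
  | tmul a b => simp [leg12, TensorProduct.smul_tmul']

theorem sliceLeft_leg13 : sliceLeft φ (leg13 R) = 1 ⊗ₜ sliceLeft φ R := by
  induction R with
  | zero => simp
  | add z z' hz hz' => simp only [map_add, hz, hz', TensorProduct.tmul_add]
  | tmul a b => simp [leg13]

theorem sliceLeft_leg23 : sliceLeft φ (leg23 R) = φ 1 • R := sliceLeft_tmul φ 1 R

theorem sliceLeft_map (D : A →ₐ[ℂ] B) :
    sliceLeft φ (Algebra.TensorProduct.map (AlgHom.id ℂ A) D R) = D (sliceLeft φ R) := by
  induction R with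
  | zero => simp
  | add z z' hz hz' => simp only [map_add, hz, hz']
  | tmul a b => simp

theorem sliceRight_map (D : A →ₐ[ℂ] B) :
    sliceRight φ (Algebra.TensorProduct.map D (AlgHom.id ℂ A) R) = D (sliceRight φ R) := by
  induction R with
  | zero => simp
  | add z z' hz hz' => simp only [map_add, hz, hz']
  | tmul a b => simp

theorem sliceRight_leg12 :
    sliceRight φ ((Algebra.TensorProduct.assoc ℂ ℂ ℂ A A A).symm (leg12 R)) = φ 1 • R := by
  induction R with
  | zero => simp
  | add z z' hz hz' => simp only [map_add, hz, hz', smul_add]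
  | tmul a b => simp [leg12]

theorem sliceRight_leg13 :
    sliceRight φ ((Algebra.TensorProduct.assoc ℂ ℂ ℂ A A A).symm (leg13 R)) =
      sliceRight φ R ⊗ₜ 1 := by
  induction R with
  | zero => simp
  | add z z' hz hz' => simp only [map_add, hz, hz', TensorProduct.add_tmul]
  | tmul a b => simp [leg13, TensorProduct.smul_tmul']

theorem sliceRight_leg23 :
    sliceRight φ ((Algebra.TensorProduct.assoc ℂ ℂ ℂ A A A).symm (leg23 R)) =
      1 ⊗ₜ sliceRight φ R := by
  induction R with
  | zero => simp
  | add z z' hz hz' => simp only [map_add, hz, hz', TensorProduct.tmul_add]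
  | tmul a b => simp [leg23]

end QuasiHopfData

end Slice

/-! ## Characters and skew derivations of `A` -/

namespace SF

/-- The counit of `A`. -/
def counitA : subA →ₐ[ℂ] ℂ := counit.comp subA.val

/-- The character `K ↦ -1`, `f ↦ 0`. -/
def signHom : SF 2 →ₐ[ℂ] ℂ :=
  lift (-1) (fun _ _ => 0) (by norm_num) (by simp) (by simp [idem1])

/-- The character `K ↦ -1`, `f ↦ 0` of `A`. -/
def signA : subA →ₐ[ℂ] ℂ := signHom.comp subA.val

theorem counit_K : counit (K : SF 2) = 1 := lift_K _ _ _ _ _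

theorem counit_f (i : Fin 2) (s : Bool) : counit (f i s) = 0 := lift_f _ _ _ _ _ _ _

theorem signHom_K : signHom K = -1 := lift_K _ _ _ _ _

theorem signHom_f (i : Fin 2) (s : Bool) : signHom (f i s) = 0 := lift_f _ _ _ _ _ _ _

/-- The two-dimensional representation on which `f_1^σ` is a nilpotent Jordan block. -/
def jordanHom (σ : Bool) : SF 2 →ₐ[ℂ] Matrix (Fin 2) (Fin 2) ℂ :=
  lift !![-1, 0; 0, 1] (fun i s => if i = 0 ∧ s = σ then !![0, 1; 0, 0] else 0)
    (by simp [pow_succ, Matrix.one_fin_two])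
    (by
      intro i s
      split_ifs
      · ext i j; fin_cases i <;> fin_cases j <;> simp
      · simp)
    (by
      intro i j s t
      have h1 : idem1 (!![-1, 0; 0, 1] : Matrix (Fin 2) (Fin 2) ℂ) = 0 := by
        simp [idem1, pow_succ, Matrix.one_fin_two]
      rw [h1, ite_self]
      split_ifs
      · ext i j; fin_cases i <;> fin_cases j <;> simp
      all_goals simp)

theorem jordanHom_K (σ : Bool) : jordanHom σ K = !![-1, 0; 0, 1] := lift_K _ _ _ _ _

theorem jordanHom_f (σ : Bool) (i : Fin 2) (s : Bool) :
    jordanHom σ (f i s) = if i = 0 ∧ s = σ then !![0, 1; 0, 0] else 0 := lift_f _ _ _ _ _ _ _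

/-- The representation is an extension of the counit by the character `K ↦ -1`; its off-diagonal
entry is therefore a skew derivation. -/
theorem jordanHom_apply (σ : Bool) (x : SF 2) :
    jordanHom σ x 1 0 = 0 ∧ jordanHom σ x 0 0 = signHom x ∧ jordanHom σ x 1 1 = counit x := by
  induction x using SF_induction with
  | hK => simp [jordanHom_K, signHom_K, counit_K]
  | hf i s =>
    rw [jordanHom_f, signHom_f, counit_f]
    split_ifs <;> simp
  | hc c =>
    rw [AlgHom.commutes, AlgHom.commutes, AlgHom.commutes]
    simp [Matrix.algebraMap_matrix_apply]
  | hadd x y hx hy =>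
    simp [hx, hy]
  | hmul x y hx hy =>
    simp [Matrix.mul_apply, hx, hy]

/-- The skew derivation `f_τ ↦ δ_{στ}`, `K ↦ 0` of `A`. -/
def derivA (σ : Bool) : subA →ₗ[ℂ] ℂ :=
  Matrix.entryLinearMap ℂ ℂ 0 1 ∘ₗ (jordanHom σ).toLinearMap ∘ₗ subA.val.toLinearMap

theorem isSkewDerivation_derivA (σ : Bool) : IsSkewDerivation signA counitA (derivA σ) := by
  intro a b
  change jordanHom σ ((a : SF 2) * b) 0 1 = jordanHom σ (a : SF 2) 0 1 * counit (b : SF 2) +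
    signHom (a : SF 2) * jordanHom σ (b : SF 2) 0 1
  rw [map_mul, Matrix.mul_apply, Fin.sum_univ_two, (jordanHom_apply σ a).2.1,
    (jordanHom_apply σ b).2.2, add_comm]

theorem counitA_fA (s : Bool) : counitA (fA s) = 0 := counit_f 0 s

theorem signA_fA (s : Bool) : signA (fA s) = 0 := signHom_f 0 s

theorem derivA_fA (σ s : Bool) : derivA σ (fA s) = if s = σ then 1 else 0 := by
  change jordanHom σ (f 0 s) 0 1 = _
  rw [jordanHom_f]
  split_ifs <;> simp_all

theorem counitA_KA : counitA KA = 1 := counit_K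

theorem signA_KA : signA KA = -1 := signHom_K

theorem derivA_KA (σ : Bool) : derivA σ KA = 0 := by
  change jordanHom σ K 0 1 = 0
  simp [jordanHom_K]

theorem counitA_wA (s : Bool) : counitA (wA s) = 1 := by
  rw [wA_eq, map_add, map_smul, map_smul, map_pow, counitA_KA]
  simp only [smul_eq_mul]
  ring

theorem signA_wA (s : Bool) : signA (wA s) = -1 := by
  rw [wA_eq, map_add, map_smul, map_smul, map_pow, signA_KA]
  simp only [smul_eq_mul]
  ring

theorem derivA_KA_pow (σ : Bool) (n : ℕ) : derivA σ (KA ^ n) = 0 := by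
  induction n with
  | zero => rw [pow_zero, (isSkewDerivation_derivA σ).map_one]
  | succ n ih =>
    rw [pow_succ, isSkewDerivation_derivA σ, ih, derivA_KA, zero_mul, mul_zero, add_zero]

theorem derivA_wA (σ s : Bool) : derivA σ (wA s) = 0 := by
  rw [wA_eq, map_add, map_smul, map_smul, derivA_KA, derivA_KA_pow, smul_zero, smul_zero, add_zero]

/-- The characters and skew derivations used here live on grade `0`, where the coassociator is
trivial; slicing with them removes it from the hexagons. -/
theorem counitA_idem1_mul (a : subA) : counitA.toLinearMap (idem1 KA * a) = 0 := by
  change counitA (idem1 KA * a) = 0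
  rw [map_mul, map_idem1, counitA_KA]
  simp [idem1]

theorem signA_idem1_mul (a : subA) : signA.toLinearMap (idem1 KA * a) = 0 := by
  change signA (idem1 KA * a) = 0
  rw [map_mul, map_idem1, signA_KA]
  simp [idem1]

theorem derivA_idem1_mul (σ : Bool) (a : subA) : derivA σ (idem1 KA * a) = 0 := by
  have h : derivA σ (idem1 KA) = 0 := by
    rw [idem1, map_smul, map_sub, derivA_KA_pow, (isSkewDerivation_derivA σ).map_one, sub_zero,
      smul_zero]
  have h2 : signA (idem1 KA) = 0 := by
    have := signA_idem1_mul 1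
    rwa [mul_one] at this
  rw [isSkewDerivation_derivA σ, h, h2, zero_mul, zero_mul, add_zero]

theorem sliceLeft_counitA_Δ (β : ℂ) (a : subA) :
    sliceLeft counitA.toLinearMap ((quasiHopfA β).Δ a) = a := by
  refine subA_induction (p := fun a => sliceLeft counitA.toLinearMap ((quasiHopfA β).Δ a) = a)
    ?_ ?_ ?_ ?_ ?_ a
  · intro s; rw [Δ_wA]; simp [counitA_wA]
  · intro s; rw [Δ_fA]; simp [counitA_wA, counitA_fA]
  · intro c
    rw [AlgHom.commutes, Algebra.TensorProduct.algebraMap_apply]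
    simp [Algebra.smul_def]
  · intro x y hx hy; rw [map_add, map_add, hx, hy]
  · intro x y hx hy; rw [map_mul, sliceLeft_mul, hx, hy]

theorem sliceRight_counitA_Δ (β : ℂ) (a : subA) :
    sliceRight counitA.toLinearMap ((quasiHopfA β).Δ a) = a := by
  refine subA_induction (p := fun a => sliceRight counitA.toLinearMap ((quasiHopfA β).Δ a) = a)
    ?_ ?_ ?_ ?_ ?_ a
  · intro s; rw [Δ_wA]; simp [counitA_wA]
  · intro s; rw [Δ_fA]; simp [counitA_fA]
  · intro c
    rw [AlgHom.commutes, Algebra.TensorProduct.algebraMap_apply]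
    simp
  · intro x y hx hy; rw [map_add, map_add, hx, hy]
  · intro x y hx hy; rw [map_mul, sliceRight_mul, hx, hy]

theorem signA_sliceLeft_signA_Δ (β : ℂ) (a : subA) :
    signA (sliceLeft signA.toLinearMap ((quasiHopfA β).Δ a)) = counitA a := by
  refine subA_induction (p := fun a => signA (sliceLeft signA.toLinearMap ((quasiHopfA β).Δ a)) =
    counitA a) ?_ ?_ ?_ ?_ ?_ a
  · intro s; rw [Δ_wA]; simp [counitA_wA, signA_wA]
  · intro s; rw [Δ_fA]; simp [counitA_fA, signA_fA]
  · intro c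
    rw [AlgHom.commutes, Algebra.TensorProduct.algebraMap_apply]
    simp
  · intro x y hx hy; rw [map_add, map_add, map_add, hx, hy, map_add]
  · intro x y hx hy; rw [map_mul, sliceLeft_mul, map_mul, hx, hy, map_mul]

/-- The automorphism `(id ⊗ χ) Δ` of `A`. -/
def twistA (β : ℂ) : subA →ₗ[ℂ] subA :=
  sliceRight signA.toLinearMap ∘ₗ (quasiHopfA β).Δ.toLinearMap

theorem twistA_apply (β : ℂ) (a : subA) :
    twistA β a = sliceRight signA.toLinearMap ((quasiHopfA β).Δ a) := rfl

theorem twistA_mul (β : ℂ) (a b : subA) : twistA β (a * b) = twistA β a * twistA β b := by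
  rw [twistA_apply, map_mul, sliceRight_mul]; rfl

theorem twistA_wA (β : ℂ) (s : Bool) : twistA β (wA s) = -wA s := by
  rw [twistA_apply, Δ_wA]; simp [signA_wA]

theorem twistA_fA (β : ℂ) (s : Bool) : twistA β (fA s) = fA s := by
  rw [twistA_apply, Δ_fA]; simp [signA_fA]

theorem twistA_one (β : ℂ) : twistA β 1 = 1 := by
  rw [twistA_apply, map_one, Algebra.TensorProduct.one_def]; simp

theorem twistA_idem1 (β : ℂ) : twistA β (idem1 KA) = idem1 KA := by
  rw [idem1_eq, map_smul, map_sub, twistA_mul, twistA_wA, twistA_wA, neg_mul_neg, twistA_one]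

end SF
end

noncomputable section

namespace SF

open FDMod QuasiHopfData

/-! ### The block `A e₁` -/

theorem idem1_KA_ne_zero : idem1 KA ≠ 0 := by
  intro h
  have h1 : idem1 KA = (1 / 2 : ℂ) • (monomialBasis (0, 0, 0) - monomialBasis (2, 0, 0)) := by
    rw [monomialBasis_apply, monomialBasis_apply, idem1]
    simp
  have h2 := congrArg (monomialBasis.coord (0, 0, 0)) (h1.symm.trans h)
  rw [map_smul, map_sub, Module.Basis.coord_apply, Module.Basis.coord_apply,
    Module.Basis.repr_self, Module.Basis.repr_self, map_zero] at h2
  simp at h2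

/-- The primitive idempotents `e₁ f_s f_{-s}`. -/
def blockIdem (s : Bool) : subA := idem1 KA * (fA s * fA (!s))

theorem blockIdem_add (s : Bool) : blockIdem s + blockIdem (!s) = idem1 KA := by
  rw [blockIdem, blockIdem, ← mul_add, Bool.not_not, fA_mul_fA_not, idem1_sq]

theorem fA_not_mul_fA (s : Bool) : fA (!s) * fA s = idem1 KA - fA s * fA (!s) :=
  eq_sub_of_add_eq' (fA_mul_fA_not s)

theorem fA_mul_blockIdem (s : Bool) : fA s * blockIdem s = 0 := by
  rw [blockIdem, ← mul_assoc, ← idem1_central, mul_assoc, ← mul_assoc (fA s), fA_mul_fA, zero_mul,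
    mul_zero]

theorem blockIdem_mul_fA_not (s : Bool) : blockIdem s * fA (!s) = 0 := by
  rw [blockIdem, mul_assoc, mul_assoc, fA_mul_fA, mul_zero, mul_zero]

theorem blockIdem_mul_fA (s : Bool) : blockIdem s * fA s = idem1 KA * fA s := by
  rw [blockIdem, mul_assoc, mul_assoc, fA_not_mul_fA, mul_sub, ← mul_assoc (fA s) (fA s),
    fA_mul_fA, zero_mul, sub_zero, ← idem1_central, ← mul_assoc, idem1_sq]

theorem fA_not_mul_blockIdem (s : Bool) : fA (!s) * blockIdem s = idem1 KA * fA (!s) := by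
  rw [blockIdem, ← mul_assoc, ← idem1_central, mul_assoc, ← mul_assoc (fA (!s)), fA_not_mul_fA,
    sub_mul, mul_assoc (fA s), fA_mul_fA, mul_zero, sub_zero, ← mul_assoc, idem1_sq]

theorem blockIdem_sq (s : Bool) : blockIdem s * blockIdem s = blockIdem s := by
  conv_lhs => enter [2]; rw [blockIdem, ← mul_assoc, idem1_central, mul_assoc]
  rw [← mul_assoc, blockIdem_mul_fA, mul_assoc, ← mul_assoc (fA s), ← idem1_central,
    ← mul_assoc, ← mul_assoc, idem1_sq, mul_assoc]
  rfl

theorem blockIdem_mul_idem1 (s : Bool) : blockIdem s * idem1 KA = blockIdem s := by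
  rw [← idem1_central, blockIdem, ← mul_assoc, idem1_sq]

theorem blockIdem_mul_not (s : Bool) : blockIdem s * blockIdem (!s) = 0 := by
  have h := congrArg (blockIdem s * ·) (blockIdem_add s)
  simp only [mul_add, blockIdem_sq, blockIdem_mul_idem1] at h
  exact left_eq_add.1 h.symm

theorem KA_mul_fA (s : Bool) : KA * fA s = -(fA s * KA) := by rw [fA_mul_KA, neg_neg]

theorem KA_mul_blockIdem (s : Bool) : KA * blockIdem s = blockIdem s * KA := by
  rw [blockIdem, ← mul_assoc, idem1_comm, mul_assoc, mul_assoc, ← mul_assoc KA, KA_mul_fA,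
    neg_mul, mul_assoc (fA s), KA_mul_fA, mul_neg, mul_neg, mul_neg, neg_neg,
    mul_assoc (fA s)]

/-- In this block `K² = -1`, so multiplication by `K` sends coefficients `(a, b)` to `(-b, a)`. -/
theorem blockIdem_mul_KA_pow (s : Bool) (n : ℕ) : ∃ a b : ℂ,
    blockIdem s * KA ^ n = a • blockIdem s + b • (blockIdem s * KA) := by
  induction n with
  | zero => exact ⟨1, 0, by simp⟩
  | succ n ih =>
    obtain ⟨a, b, h⟩ := ih
    refine ⟨-b, a, ?_⟩
    have h2 : blockIdem s * KA * KA = -blockIdem s := by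
      rw [mul_assoc, ← pow_two, ← blockIdem_mul_idem1, mul_assoc, idem1_mul_sq KA_pow, mul_neg]
    rw [pow_succ, ← mul_assoc, h, add_mul, smul_mul_assoc, smul_mul_assoc, h2]
    module

/-- In the corner at this idempotent, monomials with a single fermion die and `f_+ f_-` acts as the
identity, so only powers of `K` remain. -/
theorem blockIdem_mul_mul_blockIdem (x : subA) : ∃ a b : ℂ,
    blockIdem true * x * blockIdem true =
      a • blockIdem true + b • (blockIdem true * KA) := by
  have hx : x ∈ Submodule.span ℂ (Set.range monomial) := span_monomial trivial
  induction hx using Submodule.span_induction with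
  | mem x hx =>
    obtain ⟨⟨m, s, t⟩, rfl⟩ := hx
    have h1 : blockIdem true * monomial (m, s, t) * blockIdem true =
        blockIdem true * (fA true ^ (s : ℕ) * fA false ^ (t : ℕ)) * blockIdem true *
          KA ^ (m : ℕ) := by
      simp only [monomial, mul_assoc]
      rw [((show Commute KA (blockIdem true) from KA_mul_blockIdem true).pow_left _).eq]
    rw [h1]
    obtain ⟨a, b, h⟩ := blockIdem_mul_KA_pow true m
    have hm : blockIdem true * fA false = 0 := blockIdem_mul_fA_not true
    fin_cases s <;> fin_cases t
    · exact ⟨a, b, by simpa [blockIdem_sq] using h⟩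
    · refine ⟨0, 0, ?_⟩
      simp [hm]
    · refine ⟨0, 0, ?_⟩
      simp [mul_assoc (blockIdem true), fA_mul_blockIdem]
    · refine ⟨a, b, ?_⟩
      have h2 : blockIdem true * (fA true * fA false) = blockIdem true := by
        rw [← mul_assoc, blockIdem_mul_fA, mul_assoc]; rfl
      simpa [h2, blockIdem_sq] using h
  | zero => exact ⟨0, 0, by simp⟩
  | add x y _ _ hx hy =>
    obtain ⟨a, b, h⟩ := hx
    obtain ⟨c, d, h'⟩ := hy
    exact ⟨a + c, b + d, by rw [mul_add, add_mul, h, h']; module⟩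
  | smul c x _ hx =>
    obtain ⟨a, b, h⟩ := hx
    exact ⟨c * a, c * b, by rw [mul_smul_comm, smul_mul_assoc, h]; module⟩

/-- The central element `e₁ (f_+ f_- - f_- f_+) K`. -/
def blockZ : subA := (blockIdem true - blockIdem false) * KA

/-- The difference of two orthogonal idempotents squares to their sum `e₁`, and `K² = -1` there. In
particular this element is invertible in the block. -/
theorem blockZ_mul_self : blockZ * blockZ = -idem1 KA := by
  have h1 : (blockIdem true - blockIdem false) * (blockIdem true - blockIdem false) =
      idem1 KA := by
    have h2 : blockIdem true * blockIdem false = 0 := blockIdem_mul_not true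
    have h3 : blockIdem false * blockIdem true = 0 := blockIdem_mul_not false
    rw [sub_mul, mul_sub, mul_sub, h2, h3, blockIdem_sq, blockIdem_sq, sub_zero, zero_sub,
      sub_neg_eq_add]
    exact blockIdem_add true
  have h4 : KA * (blockIdem true - blockIdem false) = (blockIdem true - blockIdem false) * KA := by
    rw [mul_sub, sub_mul, KA_mul_blockIdem, KA_mul_blockIdem]
  rw [blockZ, mul_assoc, ← mul_assoc KA, h4, ← mul_assoc, ← mul_assoc, h1, mul_assoc, ← pow_two,
    idem1_mul_sq KA_pow]

/-- An element commuting with `f_±` and anticommuting with `K` vanishes in the block `A e₁`. -/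
theorem mul_idem1_eq_zero_of_commute {y : subA}
    (hf : ∀ s, y * fA s * idem1 KA = fA s * y * idem1 KA)
    (hK : y * KA = -(KA * y)) : y * idem1 KA = 0 := by
  have hp : ∀ s, y * blockIdem s = blockIdem s * y := by
    intro s
    rw [blockIdem, idem1_central, ← mul_assoc, ← mul_assoc]
    have h1 : y * fA s * fA (!s) * idem1 KA = fA s * (y * fA (!s) * idem1 KA) := by
      rw [mul_assoc _ (fA (!s)), ← idem1_central, ← mul_assoc, hf s, mul_assoc _ (idem1 KA),
        idem1_central, mul_assoc, mul_assoc]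
    rw [h1, hf, mul_assoc _ _ y, idem1_central y]
    simp only [mul_assoc]
  -- `y` commutes with the idempotents and anticommutes with `K`, hence anticommutes with `Z =
  -- blockZ`; but `Z` is central. So `2yZ = 0`, and `Z² = -e₁` concludes.
  have h0 : y * blockZ = -(blockZ * y) := by
    rw [blockZ, ← mul_assoc, mul_sub, hp, hp, ← sub_mul, mul_assoc, hK, mul_neg, mul_assoc]
  have hZf : ∀ s, blockZ * fA s = fA s * blockZ := by
    intro s
    have h2 : (blockIdem true - blockIdem false) * fA s =
        -(fA s * (blockIdem true - blockIdem false)) := by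
      have a1 := fA_mul_blockIdem s
      have a2 := blockIdem_mul_fA_not (!s)
      have a3 := blockIdem_mul_fA s
      have a4 := fA_not_mul_blockIdem (!s)
      rw [Bool.not_not] at a2 a4
      cases s
      · simp only [Bool.not_false] at a2 a4
        rw [sub_mul, mul_sub, a1, a2, a3, a4, sub_zero, zero_sub]
      · simp only [Bool.not_true] at a2 a4
        rw [sub_mul, mul_sub, a1, a2, a3, a4, sub_zero, zero_sub, neg_neg]
    rw [blockZ, mul_assoc, KA_mul_fA, mul_neg, ← mul_assoc, h2, neg_mul, neg_neg, mul_assoc]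
  have hZw : ∀ s, blockZ * wA s = wA s * blockZ := by
    intro s
    have hZK : blockZ * KA = KA * blockZ := by
      rw [blockZ, ← mul_assoc, mul_sub, KA_mul_blockIdem, KA_mul_blockIdem, ← sub_mul]
    have hZK3 : blockZ * KA ^ 3 = KA ^ 3 * blockZ := (Commute.pow_right hZK 3).eq
    rw [wA_eq, mul_add, add_mul, mul_smul_comm, mul_smul_comm, smul_mul_assoc, smul_mul_assoc,
      hZK, hZK3]
  have h3 : (2 : ℂ) • (y * blockZ) = 0 := by
    rw [two_smul]
    conv_lhs => enter [1]; rw [h0]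
    rw [subA_central hZw hZf y, neg_add_cancel]
  have h4 := (smul_eq_zero.1 h3).resolve_left two_ne_zero
  rw [← neg_eq_zero, ← mul_neg, ← blockZ_mul_self, ← mul_assoc, h4, zero_mul]

/-- A central element acts in the block `A e₁` by a scalar if it is fixed by a linear map which
fixes `e₁` and negates the other central element. -/
theorem exists_mul_idem1_eq_smul {x : subA} (hx : ∀ a, x * a = a * x) {T : subA →ₗ[ℂ] subA}
    (hT : T (x * idem1 KA) = x * idem1 KA) (h1 : T (idem1 KA) = idem1 KA)
    (hZ : T blockZ = -blockZ) : ∃ a : ℂ, x * idem1 KA = a • idem1 KA := by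
  obtain ⟨a, b, h⟩ := blockIdem_mul_mul_blockIdem x
  rw [← hx, mul_assoc, blockIdem_sq] at h
  -- `f_- p f_+ = q` carries the coefficients from the corner at `p` to the one at `q`; moving `K`
  -- past a fermion flips the sign of `b`.
  have hq : x * blockIdem false = a • blockIdem false - b • (blockIdem false * KA) := by
    have h2 : blockIdem false = fA false * blockIdem true * fA true := by
      rw [show fA false * blockIdem true = idem1 KA * fA false from fA_not_mul_blockIdem true,
        mul_assoc]
      rfl
    have h3 : x * blockIdem false = fA false * (x * blockIdem true) * fA true := by
      conv_lhs => rw [h2, ← mul_assoc, ← mul_assoc, hx, mul_assoc (fA false)]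
    rw [h3, h, mul_add, add_mul, mul_smul_comm, smul_mul_assoc, mul_smul_comm, smul_mul_assoc, ← h2,
      ← mul_assoc, mul_assoc _ KA, KA_mul_fA, mul_neg, ← mul_assoc, ← h2]
    module
  have h4 : x * idem1 KA = a • idem1 KA + b • blockZ := by
    rw [← blockIdem_add true, mul_add, h, show blockIdem (!true) = blockIdem false from rfl, hq,
      blockZ, sub_mul]
    module
  -- `T` negates the component along `Z` while fixing the whole, so that component vanishes.
  have h5 : (2 : ℂ) • (b • blockZ) = 0 := by
    rw [h4, map_add, map_smul, map_smul, h1, hZ] at hT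
    have := add_left_cancel hT
    rw [two_smul]
    nth_rewrite 1 [← this]
    rw [smul_neg, neg_add_cancel]
  refine ⟨a, ?_⟩
  rw [h4, (smul_eq_zero.1 h5).resolve_left two_ne_zero, add_zero]

theorem twistA_KA (β : ℂ) : twistA β KA = -KA := by
  rw [KA_eq, map_add, map_smul, map_smul, twistA_wA, twistA_wA]
  module

theorem twistA_blockZ (β : ℂ) : twistA β blockZ = -blockZ := by
  have h : ∀ s, twistA β (blockIdem s) = blockIdem s := fun s => by
    rw [blockIdem, twistA_mul, twistA_mul, twistA_idem1, twistA_fA, twistA_fA]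
  rw [blockZ, twistA_mul, map_sub, h, h, twistA_KA, mul_neg]

/-- The antipode exchanges the idempotents `e₁ f_+ f_-` and `e₁ f_- f_+` and fixes `K`. -/
theorem antipode_blockZ (β : ℂ) : (quasiHopfA β).antipode blockZ = -blockZ := by
  have h : ∀ s, (quasiHopfA β).antipode (blockIdem s) = blockIdem (!s) := fun s => by
    have h1 : fA (!s) * wA (!s) * (fA s * wA s) = -(fA (!s) * fA s * KA ^ 2) := by
      rw [mul_assoc, ← mul_assoc (wA _), wA_mul_fA, neg_mul, mul_neg, mul_assoc (fA s),
        wA_comm (!s), wA_mul_not, ← mul_assoc]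
    have h2 : KA ^ 2 * idem1 KA = -idem1 KA := by rw [← idem1_central, idem1_mul_sq KA_pow]
    rw [blockIdem, antipode_mul, antipode_mul, antipode_idem1, antipode_fA, antipode_fA, h1,
      neg_mul, mul_assoc, h2, mul_neg, neg_neg, ← idem1_central, blockIdem, Bool.not_not]
  rw [blockZ, antipode_mul, map_sub, h, h, antipode_KA, mul_sub, KA_mul_blockIdem,
    KA_mul_blockIdem, Bool.not_true, Bool.not_false, sub_mul]
  abel

/-- `Δ(x) (e₁ ⊗ e₁) = 0` implies `x e₀ = 0`. -/
theorem mul_idem0_eq_zero (β : ℂ) {x : subA}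
    (h : (quasiHopfA β).Δ x * (idem1 KA ⊗ₜ idem1 KA) = 0) : x * idem0 KA = 0 := by
  have h0 : (quasiHopfA β).Δ (idem0 KA) = idem0 KA ⊗ₜ idem0 KA + idem1 KA ⊗ₜ idem1 KA := by
    rw [eq_sub_of_add_eq (idem0_add_idem1 KA), map_sub, map_one, Δ_idem1,
      eq_sub_of_add_eq (idem0_add_idem1 KA), Algebra.TensorProduct.one_def]
    simp only [TensorProduct.tmul_sub, TensorProduct.sub_tmul]
    abel
  -- Multiplication by `1 ⊗ e₁` keeps only the summand `e₁ ⊗ e₁` of `Δ(e₀)`; the antipode then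
  -- recovers `x e₀ ⊗ e₁` from this product.
  have h1 : (quasiHopfA β).Δ (x * idem0 KA) * (1 ⊗ₜ idem1 KA) = 0 := by
    rw [map_mul, h0, mul_assoc, add_mul, Algebra.TensorProduct.tmul_mul_tmul,
      Algebra.TensorProduct.tmul_mul_tmul, idem0_mul_idem1, idem1_sq, mul_one, mul_one,
      TensorProduct.tmul_zero, zero_add, h]
  have hp := isHopfPair β true
  have h2 := congrArg (antipodeFold (quasiHopfA β).Δ
    ((quasiHopfA β).S : subA →ₐ[ℂ] subAᵐᵒᵖ)) h1
  rw [antipodeFold_mul _ _ _ _ (hp.antipode_fold _), antipodeFold_tmul, map_one, map_zero,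
    Algebra.TensorProduct.one_def, unopMulRight_tmul, MulOpposite.unop_one, one_mul,
    Algebra.TensorProduct.tmul_mul_tmul, mul_one, one_mul] at h2
  obtain ⟨φ, hφ⟩ := Module.Projective.exists_dual_ne_zero ℂ idem1_KA_ne_zero
  have h3 := congrArg (sliceRight φ) h2
  rw [sliceRight_tmul, map_zero] at h3
  exact (smul_eq_zero.1 h3).resolve_left hφ

end SF
end

noncomputable section

namespace SF

open QuasiHopfData

/-! ### Slices of an R-matrix -/

variable {β : ℂ}

/-- `e₁ ⊗ e₁ ⊗ e₁`. -/
def idem1Cube : subA ⊗[ℂ] (subA ⊗[ℂ] subA) := idem1 KA ⊗ₜ (idem1 KA ⊗ₜ idem1 KA)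

theorem idem1Cube_central (z : subA ⊗[ℂ] (subA ⊗[ℂ] subA)) : idem1Cube * z = z * idem1Cube := by
  have h2 : ∀ w : subA ⊗[ℂ] subA, (idem1 KA ⊗ₜ idem1 KA) * w = w * (idem1 KA ⊗ₜ idem1 KA) := by
    intro w
    induction w with
    | zero => simp
    | add w w' hw hw' => rw [mul_add, hw, hw', add_mul]
    | tmul a b => simp only [Algebra.TensorProduct.tmul_mul_tmul, idem1_central]
  induction z with
  | zero => simp
  | add w w' hw hw' => rw [mul_add, hw, hw', add_mul]
  | tmul a b => simp only [idem1Cube, Algebra.TensorProduct.tmul_mul_tmul, idem1_central, h2]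

theorem idem1Cube_sq : idem1Cube * idem1Cube = idem1Cube := by
  simp only [idem1Cube, Algebra.TensorProduct.tmul_mul_tmul, idem1_sq]

/-- Three central involutions, of which two cancel. -/
theorem coassociator_conj (hβ : β ^ 4 = 1) (X Y : subA ⊗[ℂ] (subA ⊗[ℂ] subA)) :
    (1 + (β ^ 2 - 1) • idem1Cube) * X * (1 + (β ^ 2 - 1) • idem1Cube) * Y *
      (1 + (β ^ 2 - 1) • idem1Cube) = X * Y + (β ^ 2 - 1) • (idem1Cube * (X * Y)) := by
  have hc : ∀ z, (1 + (β ^ 2 - 1) • idem1Cube) * z = z * (1 + (β ^ 2 - 1) • idem1Cube) := by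
    intro z
    rw [add_mul, mul_add, smul_mul_assoc, mul_smul_comm, idem1Cube_central, one_mul, mul_one]
  have hs : (1 + (β ^ 2 - 1) • idem1Cube) * (1 + (β ^ 2 - 1) • idem1Cube) = 1 := by
    simp only [add_mul, mul_add, one_mul, mul_one, smul_mul_assoc, mul_smul_comm, idem1Cube_sq,
      smul_smul, smul_add]
    rw [add_assoc, ← add_smul, ← add_smul, show β ^ 2 - 1 + (β ^ 2 - 1 + (β ^ 2 - 1) * (β ^ 2 - 1)) =
      β ^ 4 - 1 by ring, hβ, sub_self, zero_smul, add_zero]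
  rw [hc X, mul_assoc X, hs, mul_one, ← hc, add_mul, one_mul, smul_mul_assoc]

theorem hexagon_left_eq (hβ : β ^ 4 = 1) {R : subA ⊗[ℂ] subA} (hR : (quasiHopfA β).IsRMatrix R) :
    Algebra.TensorProduct.assoc ℂ ℂ ℂ subA subA subA
        (Algebra.TensorProduct.map (quasiHopfA β).Δ (AlgHom.id ℂ subA) R) =
      leg13 R * leg23 R + (β ^ 2 - 1) • (idem1Cube * (leg13 R * leg23 R)) := by
  rw [hR.hexagon_left, ← coassociator_conj hβ, Φ_eq, Φinv_eq]
  simp [swap12, swap23, idem1Cube]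

theorem hexagon_right_eq (hβ : β ^ 4 = 1) {R : subA ⊗[ℂ] subA}
    (hR : (quasiHopfA β).IsRMatrix R) :
    Algebra.TensorProduct.map (AlgHom.id ℂ subA) (quasiHopfA β).Δ R =
      leg13 R * leg12 R + (β ^ 2 - 1) • (idem1Cube * (leg13 R * leg12 R)) := by
  rw [hR.hexagon_right, ← coassociator_conj hβ, Φ_eq, Φinv_eq]
  simp [swap12, swap23, idem1Cube]

theorem sliceLeft_assoc_tmul {A : Type} [Ring A] [Algebra ℂ A] (φ : A →ₗ[ℂ] ℂ) (z : A ⊗[ℂ] A)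
    (b : A) : sliceLeft φ (Algebra.TensorProduct.assoc ℂ ℂ ℂ A A A (z ⊗ₜ b)) =
      sliceLeft φ z ⊗ₜ b := by
  induction z with
  | zero => simp
  | add w w' hw hw' => rw [TensorProduct.add_tmul, map_add, map_add, hw, hw', map_add,
      TensorProduct.add_tmul]
  | tmul x y => simp [TensorProduct.smul_tmul']

theorem sliceRight_assoc_tmul {A : Type} [Ring A] [Algebra ℂ A] (φ : A →ₗ[ℂ] ℂ) (z : A ⊗[ℂ] A)
    (b : A) : sliceRight φ ((Algebra.TensorProduct.assoc ℂ ℂ ℂ A A A).symm (b ⊗ₜ z)) =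
      b ⊗ₜ sliceRight φ z := by
  induction z with
  | zero => simp
  | add w w' hw hw' => rw [TensorProduct.tmul_add, map_add, map_add, hw, hw', map_add,
      TensorProduct.tmul_add]
  | tmul x y => simp

theorem sliceLeft_rTensor {A : Type} [Ring A] [Algebra ℂ A] (φ : A →ₗ[ℂ] ℂ) (F : A →ₗ[ℂ] A)
    (R : A ⊗[ℂ] A) : sliceLeft φ (F.rTensor A R) = sliceLeft (φ ∘ₗ F) R := by
  rw [sliceLeft, sliceLeft, LinearMap.rTensor_comp]; rfl

variable {R : subA ⊗[ℂ] subA}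

theorem sliceLeft_hexagon_left (hβ : β ^ 4 = 1) (hR : (quasiHopfA β).IsRMatrix R)
    {φ : subA →ₗ[ℂ] ℂ} (hφ : ∀ a, φ (idem1 KA * a) = 0) :
    (sliceLeft φ ∘ₗ (quasiHopfA β).Δ.toLinearMap).rTensor subA R =
      sliceLeft φ (leg13 R * leg23 R) := by
  have h : sliceLeft φ (Algebra.TensorProduct.assoc ℂ ℂ ℂ subA subA subA
      (Algebra.TensorProduct.map (quasiHopfA β).Δ (AlgHom.id ℂ subA) R)) =
      sliceLeft φ (leg13 R * leg23 R) := by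
    rw [hexagon_left_eq hβ hR, map_add, map_smul, idem1Cube, sliceLeft_tmul_mul hφ, smul_zero,
      add_zero]
  rw [← h]
  clear h hR
  induction R with
  | zero => simp
  | add w w' hw hw' => simp only [map_add, hw, hw']
  | tmul x y =>
    rw [Algebra.TensorProduct.map_tmul, sliceLeft_assoc_tmul]; rfl

theorem sliceRight_hexagon_right (hβ : β ^ 4 = 1) (hR : (quasiHopfA β).IsRMatrix R)
    {φ : subA →ₗ[ℂ] ℂ} (hφ : ∀ a, φ (idem1 KA * a) = 0) :
    (sliceRight φ ∘ₗ (quasiHopfA β).Δ.toLinearMap).lTensor subA R =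
      sliceRight φ ((Algebra.TensorProduct.assoc ℂ ℂ ℂ subA subA subA).symm
        (leg13 R * leg12 R)) := by
  have h : sliceRight φ ((Algebra.TensorProduct.assoc ℂ ℂ ℂ subA subA subA).symm
      (Algebra.TensorProduct.map (AlgHom.id ℂ subA) (quasiHopfA β).Δ R)) =
      sliceRight φ ((Algebra.TensorProduct.assoc ℂ ℂ ℂ subA subA subA).symm
        (leg13 R * leg12 R)) := by
    rw [hexagon_right_eq hβ hR, map_add, map_smul, map_mul _ idem1Cube, map_add, map_smul,
      show (Algebra.TensorProduct.assoc ℂ ℂ ℂ subA subA subA).symm idem1Cube =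
        (idem1 KA ⊗ₜ idem1 KA) ⊗ₜ idem1 KA from rfl, sliceRight_tmul_mul hφ, smul_zero, add_zero]
  rw [← h]
  clear h hR
  induction R with
  | zero => simp
  | add w w' hw hw' => simp only [map_add, hw, hw']
  | tmul x y =>
    rw [Algebra.TensorProduct.map_tmul, sliceRight_assoc_tmul]; rfl

theorem Δ_sliceLeft (hβ : β ^ 4 = 1) (hR : (quasiHopfA β).IsRMatrix R)
    {φ : subA →ₗ[ℂ] ℂ} (hφ : ∀ a, φ (idem1 KA * a) = 0) :
    (quasiHopfA β).Δ (sliceLeft φ R) = sliceLeft φ (leg13 R * leg12 R) := by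
  rw [← sliceLeft_map, hexagon_right_eq hβ hR, map_add, map_smul, idem1Cube,
    sliceLeft_tmul_mul hφ, smul_zero, add_zero]

theorem Δ_sliceRight (hβ : β ^ 4 = 1) (hR : (quasiHopfA β).IsRMatrix R)
    {φ : subA →ₗ[ℂ] ℂ} (hφ : ∀ a, φ (idem1 KA * a) = 0) :
    (quasiHopfA β).Δ (sliceRight φ R) =
      sliceRight φ ((Algebra.TensorProduct.assoc ℂ ℂ ℂ subA subA subA).symm
        (leg13 R * leg23 R)) := by
  rw [← sliceRight_map, ← (Algebra.TensorProduct.assoc ℂ ℂ ℂ subA subA subA).symm_apply_apply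
    (Algebra.TensorProduct.map (quasiHopfA β).Δ (AlgHom.id ℂ subA) R), hexagon_left_eq hβ hR,
    map_add, map_smul, map_mul _ idem1Cube, map_add, map_smul,
    show (Algebra.TensorProduct.assoc ℂ ℂ ℂ subA subA subA).symm idem1Cube =
      (idem1 KA ⊗ₜ idem1 KA) ⊗ₜ idem1 KA from rfl, sliceRight_tmul_mul hφ, smul_zero, add_zero]

/-- Slicing the hexagon by the counit gives `R = (1 ⊗ x) R` for the slice `x`, and `R` is
invertible. -/
theorem sliceLeft_counitA (hβ : β ^ 4 = 1) (hR : (quasiHopfA β).IsRMatrix R) :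
    sliceLeft counitA.toLinearMap R = 1 := by
  have h := sliceLeft_hexagon_left hβ hR counitA_idem1_mul
  rw [show sliceLeft counitA.toLinearMap ∘ₗ (quasiHopfA β).Δ.toLinearMap = LinearMap.id from
    LinearMap.ext (sliceLeft_counitA_Δ β), LinearMap.rTensor_id, LinearMap.id_apply, sliceLeft_mul,
    sliceLeft_leg13, sliceLeft_leg23, AlgHom.toLinearMap_apply, map_one, one_smul] at h
  have h2 := hR.isUnit.mul_right_cancel ((one_mul R).trans h)
  have h3 := congrArg (sliceLeft counitA.toLinearMap) h2
  rw [Algebra.TensorProduct.one_def, sliceLeft_tmul, sliceLeft_tmul, AlgHom.toLinearMap_apply,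
    map_one, one_smul, one_smul] at h3
  exact h3.symm

theorem sliceRight_counitA (hβ : β ^ 4 = 1) (hR : (quasiHopfA β).IsRMatrix R) :
    sliceRight counitA.toLinearMap R = 1 := by
  have h := sliceRight_hexagon_right hβ hR counitA_idem1_mul
  rw [show sliceRight counitA.toLinearMap ∘ₗ (quasiHopfA β).Δ.toLinearMap = LinearMap.id from
    LinearMap.ext (sliceRight_counitA_Δ β), LinearMap.lTensor_id, LinearMap.id_apply, map_mul,
    sliceRight_mul, sliceRight_leg13, sliceRight_leg12, AlgHom.toLinearMap_apply, map_one,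
    one_smul] at h
  have h2 := hR.isUnit.mul_right_cancel ((one_mul R).trans h)
  have h3 := congrArg (sliceRight counitA.toLinearMap) h2
  rw [Algebra.TensorProduct.one_def, sliceRight_tmul, sliceRight_tmul, AlgHom.toLinearMap_apply,
    map_one, one_smul, one_smul] at h3
  exact h3.symm

/-- Slicing the hexagon by `χ` in two legs produces on one side the slice by the convolution square
of `χ`, which is the counit. -/
theorem sliceLeft_signA_sq (hβ : β ^ 4 = 1) (hR : (quasiHopfA β).IsRMatrix R) :
    sliceLeft signA.toLinearMap R * sliceLeft signA.toLinearMap R = 1 := by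
  have h := congrArg (sliceLeft signA.toLinearMap) (sliceLeft_hexagon_left hβ hR signA_idem1_mul)
  rw [sliceLeft_mul, sliceLeft_leg13, sliceLeft_leg23, AlgHom.toLinearMap_apply, map_one,
    one_smul, sliceLeft_mul, sliceLeft_tmul, AlgHom.toLinearMap_apply, map_one, one_smul] at h
  rw [← h, ← sliceLeft_counitA hβ hR, sliceLeft_rTensor]
  congr 2
  exact LinearMap.ext (signA_sliceLeft_signA_Δ β)

theorem Δ_sliceLeft_signA (hβ : β ^ 4 = 1) (hR : (quasiHopfA β).IsRMatrix R) :
    (quasiHopfA β).Δ (sliceLeft signA.toLinearMap R) =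
      sliceLeft signA.toLinearMap R ⊗ₜ sliceLeft signA.toLinearMap R := by
  rw [Δ_sliceLeft hβ hR signA_idem1_mul, sliceLeft_mul, sliceLeft_leg13, sliceLeft_leg12,
    Algebra.TensorProduct.tmul_mul_tmul, one_mul, mul_one]

/-- The Leibniz rule applied to the first leg of `R₁₃ R₁₂` yields a skew-primitive element. -/
theorem Δ_sliceLeft_derivA (hβ : β ^ 4 = 1) (hR : (quasiHopfA β).IsRMatrix R) (σ : Bool) :
    (quasiHopfA β).Δ (sliceLeft (derivA σ) R) = 1 ⊗ₜ sliceLeft (derivA σ) R +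
      sliceLeft (derivA σ) R ⊗ₜ sliceLeft signA.toLinearMap R := by
  rw [Δ_sliceLeft hβ hR (derivA_idem1_mul σ), (isSkewDerivation_derivA σ).sliceLeft_mul,
    sliceLeft_leg13, sliceLeft_leg12, sliceLeft_leg13, sliceLeft_leg12, sliceLeft_counitA hβ hR,
    Algebra.TensorProduct.tmul_mul_tmul, Algebra.TensorProduct.tmul_mul_tmul]
  simp only [one_mul, mul_one]

theorem Δ_sliceRight_derivA (hβ : β ^ 4 = 1) (hR : (quasiHopfA β).IsRMatrix R) (σ : Bool) :
    (quasiHopfA β).Δ (sliceRight (derivA σ) R) = sliceRight (derivA σ) R ⊗ₜ 1 +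
      sliceRight signA.toLinearMap R ⊗ₜ sliceRight (derivA σ) R := by
  rw [Δ_sliceRight hβ hR (derivA_idem1_mul σ), map_mul,
    (isSkewDerivation_derivA σ).sliceRight_mul,
    sliceRight_leg13, sliceRight_leg23, sliceRight_leg13, sliceRight_leg23,
    sliceRight_counitA hβ hR,
    Algebra.TensorProduct.tmul_mul_tmul, Algebra.TensorProduct.tmul_mul_tmul]
  simp only [one_mul, mul_one]

theorem comm_Δ_fA (s : Bool) : Algebra.TensorProduct.comm ℂ subA subA ((quasiHopfA β).Δ (fA s)) =
    1 ⊗ₜ fA s + fA s ⊗ₜ wA s := by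
  rw [Δ_fA, map_add]; rfl

/-- In the sliced intertwining relation, `Δ(f)` contributes `χ(ω) f = -f` and its opposite `χ(1) f =
f`. -/
theorem sliceLeft_signA_fA (hR : (quasiHopfA β).IsRMatrix R) (s : Bool) :
    sliceLeft signA.toLinearMap R * fA s = -(fA s * sliceLeft signA.toLinearMap R) := by
  have h := congrArg (sliceLeft signA.toLinearMap) (hR.intertwine (fA s))
  rw [comm_Δ_fA, Δ_fA, sliceLeft_mul, sliceLeft_mul] at h
  simp only [map_add, sliceLeft_tmul, AlgHom.toLinearMap_apply, signA_fA, signA_wA, map_one,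
    one_smul, zero_smul, zero_add, add_zero, neg_smul, mul_neg] at h
  rw [← h, neg_neg]

theorem comm_Δ_wA (s : Bool) : Algebra.TensorProduct.comm ℂ subA subA ((quasiHopfA β).Δ (wA s)) =
    wA s ⊗ₜ wA s := by
  rw [Δ_wA]; rfl

theorem sliceLeft_signA_wA (hR : (quasiHopfA β).IsRMatrix R) (s : Bool) :
    sliceLeft signA.toLinearMap R * wA s = wA s * sliceLeft signA.toLinearMap R := by
  have h := congrArg (sliceLeft signA.toLinearMap) (hR.intertwine (wA s))
  rw [comm_Δ_wA, Δ_wA, sliceLeft_mul, sliceLeft_mul] at h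
  simpa only [sliceLeft_tmul, AlgHom.toLinearMap_apply, signA_wA, one_smul, neg_smul, neg_mul,
    mul_neg, neg_inj] using h

theorem sliceLeft_derivA_wA (hR : (quasiHopfA β).IsRMatrix R) (σ s : Bool) :
    sliceLeft (derivA σ) R * wA s = -(wA s * sliceLeft (derivA σ) R) := by
  have h := congrArg (sliceLeft (derivA σ)) (hR.intertwine (wA s))
  rw [comm_Δ_wA, Δ_wA, (isSkewDerivation_derivA σ).sliceLeft_mul,
    (isSkewDerivation_derivA σ).sliceLeft_mul] at h
  simpa only [sliceLeft_tmul, AlgHom.toLinearMap_apply, signA_wA, derivA_wA, counitA_wA, one_smul,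
    neg_smul, neg_mul, zero_smul, mul_zero, zero_mul, add_zero, zero_add] using h

theorem sliceRight_derivA_wA (hR : (quasiHopfA β).IsRMatrix R) (σ s : Bool) :
    sliceRight (derivA σ) R * wA s = -(wA s * sliceRight (derivA σ) R) := by
  have h := congrArg (sliceRight (derivA σ)) (hR.intertwine (wA s))
  rw [comm_Δ_wA, Δ_wA, (isSkewDerivation_derivA σ).sliceRight_mul,
    (isSkewDerivation_derivA σ).sliceRight_mul] at h
  simpa only [sliceRight_tmul, AlgHom.toLinearMap_apply, signA_wA, derivA_wA, counitA_wA, one_smul,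
    neg_smul, neg_mul, zero_smul, mul_zero, zero_mul, add_zero, zero_add] using h

theorem sliceLeft_derivA_fA (hβ : β ^ 4 = 1) (hR : (quasiHopfA β).IsRMatrix R) (σ s : Bool) :
    sliceLeft (derivA σ) R * fA s = fA s * sliceLeft (derivA σ) R +
      derivA σ (fA s) • (wA s - sliceLeft signA.toLinearMap R) := by
  have h := congrArg (sliceLeft (derivA σ)) (hR.intertwine (fA s))
  rw [comm_Δ_fA, Δ_fA, (isSkewDerivation_derivA σ).sliceLeft_mul,
    (isSkewDerivation_derivA σ).sliceLeft_mul, sliceLeft_counitA hβ hR] at h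
  simp only [map_add, sliceLeft_tmul, AlgHom.toLinearMap_apply, signA_fA, derivA_wA, counitA_wA,
    counitA_fA, (isSkewDerivation_derivA σ).map_one, map_one, one_smul,
    zero_smul, add_zero, zero_add, mul_one, mul_smul_comm] at h
  rw [eq_sub_of_add_eq h, smul_sub]
  abel

theorem sliceRight_derivA_fA (hβ : β ^ 4 = 1) (hR : (quasiHopfA β).IsRMatrix R) (σ s : Bool) :
    sliceRight (derivA σ) R * fA s = -(fA s * sliceRight (derivA σ) R) +
      derivA σ (fA s) • (1 - sliceRight signA.toLinearMap R * wA s) := by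
  have h := congrArg (sliceRight (derivA σ)) (hR.intertwine (fA s))
  rw [comm_Δ_fA, Δ_fA, (isSkewDerivation_derivA σ).sliceRight_mul,
    (isSkewDerivation_derivA σ).sliceRight_mul, sliceRight_counitA hβ hR] at h
  simp only [map_add, sliceRight_tmul, AlgHom.toLinearMap_apply, signA_fA, derivA_wA, signA_wA,
    counitA_fA, (isSkewDerivation_derivA σ).map_one, map_one, one_smul, neg_smul, neg_mul,
    zero_smul, add_zero, zero_add, mul_one, mul_smul_comm] at h
  rw [eq_sub_of_add_eq h, smul_sub]
  abel

end SF
end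

noncomputable section

namespace SF

open QuasiHopfData

/-! ### There is no ribbon structure on `A` -/

variable {β : ℂ} {R : subA ⊗[ℂ] subA}

theorem wA_not_mul_idem1 (s : Bool) : wA (!s) * idem1 KA = -(wA s * idem1 KA) := by
  rw [← wA_mul_KA_sq, mul_assoc, ← idem1_central, idem1_mul_sq KA_pow, mul_neg]

theorem mul_KA_of_mul_wA {x : subA} (h : ∀ s, x * wA s = -(wA s * x)) : x * KA = -(KA * x) := by
  rw [KA_eq, mul_add, add_mul, mul_smul_comm, mul_smul_comm, smul_mul_assoc, smul_mul_assoc, h, h]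
  module

theorem eq_zero_of_blocks {x : subA} (h0 : x * idem0 KA = 0) (h1 : x * idem1 KA = 0) : x = 0 := by
  rw [← mul_one x, ← idem0_add_idem1 KA, mul_add, h0, h1, add_zero]

/-- The skew derivation applied to `r f = -f r` gives `χ(r) = -ε(r)`. -/
theorem signA_sliceLeft_signA (hβ : β ^ 4 = 1) (hR : (quasiHopfA β).IsRMatrix R) :
    signA (sliceLeft signA.toLinearMap R) = -1 := by
  have h := congrArg (derivA true) (sliceLeft_signA_fA hR true)
  have hε : counitA (sliceLeft signA.toLinearMap R) = 1 := by
    have h1 := apply_sliceLeft signA.toLinearMap counitA.toLinearMap R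
    rwa [sliceRight_counitA hβ hR, AlgHom.toLinearMap_apply, AlgHom.toLinearMap_apply,
      map_one] at h1
  rw [map_neg, isSkewDerivation_derivA, isSkewDerivation_derivA, counitA_fA, signA_fA, derivA_fA,
    hε] at h
  simpa using h

/-- `r ω_+` is central, since both factors anticommute with `f_±`, and is fixed by the twist, which
negates both. So it is a scalar on the block, and `r² = 1` makes the scalar `±1`; as `ω_- = -ω_+` on
`e₁`, the sign selects `s`. -/
theorem exists_sliceLeft_signA_mul_idem1 (hβ : β ^ 4 = 1) (hR : (quasiHopfA β).IsRMatrix R) :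
    ∃ s, sliceLeft signA.toLinearMap R * idem1 KA = wA s * idem1 KA := by
  have hsq := sliceLeft_signA_sq hβ hR
  have hw := sliceLeft_signA_wA hR
  have hf := sliceLeft_signA_fA hR
  have hT : twistA β (sliceLeft signA.toLinearMap R) = -sliceLeft signA.toLinearMap R := by
    rw [twistA_apply, Δ_sliceLeft_signA hβ hR, sliceRight_tmul, AlgHom.toLinearMap_apply,
      signA_sliceLeft_signA hβ hR, neg_smul, one_smul]
  set r := sliceLeft signA.toLinearMap R
  have hc : ∀ a, r * wA true * a = a * (r * wA true) := by
    refine subA_central (fun s => ?_) (fun s => ?_)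
    · rw [mul_assoc, wA_comm, ← mul_assoc, hw s, mul_assoc]
    · rw [mul_assoc, wA_mul_fA, mul_neg, ← mul_assoc, hf, neg_mul, neg_neg, mul_assoc]
  obtain ⟨a, ha⟩ := exists_mul_idem1_eq_smul hc (T := twistA β)
    (by rw [twistA_mul, twistA_mul, hT, twistA_wA, neg_mul_neg, twistA_idem1]) (twistA_idem1 β)
    (twistA_blockZ β)
  have hr : r * idem1 KA = a • (wA true * idem1 KA) := by
    rw [← mul_smul_comm, ← ha, hw, mul_assoc, ← mul_assoc, wA_mul_self, one_mul]
  have ha2 : (a * a - 1) • idem1 KA = 0 := by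
    have h1 : idem1 KA = (a * a) • idem1 KA := by
      calc idem1 KA = r * (r * idem1 KA) := by rw [← mul_assoc, hsq, one_mul]
        _ = a • (wA true * (r * idem1 KA)) := by
          rw [hr, mul_smul_comm, ← mul_assoc, hw, mul_assoc, hr]
        _ = (a * a) • idem1 KA := by
          rw [hr, mul_smul_comm, smul_smul, ← mul_assoc, wA_mul_self, one_mul]
    rw [sub_smul, one_smul, ← h1, sub_self]
  have ha3 := (smul_eq_zero.1 ha2).resolve_right idem1_KA_ne_zero
  have ha4 : (a - 1) * (a + 1) = 0 := by linear_combination ha3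
  rcases mul_eq_zero.1 ha4 with h | h
  · refine ⟨true, ?_⟩
    rw [hr, sub_eq_zero.1 h, one_smul]
  · refine ⟨false, ?_⟩
    rw [hr, eq_neg_of_add_eq_zero_left h, neg_smul, one_smul]
    exact (wA_not_mul_idem1 true).symm

section Ribbon

variable {v : subA}

theorem counitA_ribbon (hβ : β ^ 4 = 1) (hR : (quasiHopfA β).IsRMatrix R)
    (hv : (quasiHopfA β).IsRibbonElement R v) : counitA v = 1 := by
  have h := congrArg (sliceRight counitA.toLinearMap) hv.monodromy
  rw [sliceRight_mul, sliceRight_mul, sliceRight_comm, sliceLeft_counitA hβ hR,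
    sliceRight_counitA hβ hR, sliceRight_counitA_Δ, one_mul, one_mul, sliceRight_tmul,
    AlgHom.toLinearMap_apply] at h
  have h1 : (counitA v - 1) • v = 0 := by rw [sub_smul, one_smul, ← h, sub_self]
  exact sub_eq_zero.1 ((smul_eq_zero.1 h1).resolve_right hv.ne_zero)

/-- The skew derivation applied to `f v = v f` gives `ε(v) = χ(v)`. -/
theorem signA_ribbon (hβ : β ^ 4 = 1) (hR : (quasiHopfA β).IsRMatrix R)
    (hv : (quasiHopfA β).IsRibbonElement R v) : signA v = 1 := by
  have h := congrArg (derivA true) (hv.central (fA true))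
  rw [isSkewDerivation_derivA, isSkewDerivation_derivA, counitA_fA, signA_fA, derivA_fA,
    counitA_ribbon hβ hR hv] at h
  simpa using h.symm

/-- The antipode fixes `v` and negates `Z`, so `v` is scalar on the block. Were the scalar zero, the
monodromy identity would give `Δ(v)(e₁ ⊗ e₁) = 0` and kill `v` on grade `0` as well. -/
theorem exists_ribbon_mul_idem1 (hR : (quasiHopfA β).IsRMatrix R)
    (hv : (quasiHopfA β).IsRibbonElement R v) :
    ∃ a : ℂ, a ≠ 0 ∧ v * idem1 KA = a • idem1 KA := by
  obtain ⟨a, ha⟩ := exists_mul_idem1_eq_smul (fun b => (hv.central b).symm)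
    (T := (quasiHopfA β).antipode)
    (by rw [antipode_mul, antipode_idem1, hv.antipode_eq, idem1_central]) (antipode_idem1 β)
    (antipode_blockZ β)
  refine ⟨a, ?_, ha⟩
  rintro rfl
  rw [zero_smul] at ha
  have hM : IsUnit (Algebra.TensorProduct.comm ℂ subA subA R * R) :=
    (hR.isUnit.map (Algebra.TensorProduct.comm ℂ subA subA)).mul hR.isUnit
  refine hv.ne_zero (eq_zero_of_blocks (mul_idem0_eq_zero β ?_) ha)
  refine hM.mul_right_eq_zero.1 ?_
  rw [← mul_assoc, hv.monodromy, Algebra.TensorProduct.tmul_mul_tmul, ha,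
    TensorProduct.tmul_zero]

/-- Slicing the monodromy identity by `χ` gives `r r' T(v) = v`, with `r`, `r'` the left and right
slices and `T` the twist. On the block `v` and `T(v)` are the same non-zero scalar, so `r r' = 1 =
r²`. This is all that the ribbon element contributes. -/
theorem sliceRight_signA_mul_idem1 (hβ : β ^ 4 = 1) (hR : (quasiHopfA β).IsRMatrix R)
    (hv : (quasiHopfA β).IsRibbonElement R v) :
    sliceRight signA.toLinearMap R * idem1 KA = sliceLeft signA.toLinearMap R * idem1 KA := by
  have h := congrArg (sliceRight signA.toLinearMap) hv.monodromy
  rw [sliceRight_mul, sliceRight_mul, sliceRight_comm, ← twistA_apply, sliceRight_tmul,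
    AlgHom.toLinearMap_apply, signA_ribbon hβ hR hv, one_smul] at h
  obtain ⟨a, ha, hva⟩ := exists_ribbon_mul_idem1 hR hv
  have h1 : twistA β v * idem1 KA = a • idem1 KA := by
    have h2 := congrArg (twistA β) hva
    rwa [twistA_mul, map_smul, twistA_idem1] at h2
  have h2 : a • (sliceLeft signA.toLinearMap R * sliceRight signA.toLinearMap R * idem1 KA) =
      a • idem1 KA := by
    rw [← mul_smul_comm, ← h1, ← mul_assoc, h, hva, h1]
  have h3 := smul_right_injective subA ha h2
  conv_rhs => rw [← h3, ← mul_assoc, ← mul_assoc, sliceLeft_signA_sq hβ hR, one_mul]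

end Ribbon

/-- On the block the slice commutes with `f_±`, because `ω_s - r` vanishes there, and anticommutes
with `K`; hence it is zero. Its coproduct then forces zero on grade `0`. -/
theorem sliceLeft_derivA_eq_zero (hβ : β ^ 4 = 1) (hR : (quasiHopfA β).IsRMatrix R) {s : Bool}
    (hr : sliceLeft signA.toLinearMap R * idem1 KA = wA s * idem1 KA) :
    sliceLeft (derivA s) R = 0 := by
  have h1 : sliceLeft (derivA s) R * idem1 KA = 0 := by
    refine mul_idem1_eq_zero_of_commute (fun t => ?_)
      (mul_KA_of_mul_wA (sliceLeft_derivA_wA hR s))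
    rw [sliceLeft_derivA_fA hβ hR, add_mul, derivA_fA]
    split_ifs with h
    · rw [h, smul_mul_assoc, sub_mul, hr, sub_self, smul_zero, add_zero]
    · rw [zero_smul, zero_mul, add_zero]
  refine eq_zero_of_blocks (mul_idem0_eq_zero β ?_) h1
  rw [Δ_sliceLeft_derivA hβ hR, add_mul, Algebra.TensorProduct.tmul_mul_tmul,
    Algebra.TensorProduct.tmul_mul_tmul, h1, TensorProduct.tmul_zero, TensorProduct.zero_tmul,
    add_zero]

/-- On the block `1 - r' ω_{-s} = 1 - K² = 2`, so the slice has the same anticommutators with `f_±`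
as `2 f_s`; comparing coproducts transfers the equality to grade `0`. -/
theorem sliceRight_derivA_not_eq (hβ : β ^ 4 = 1) (hR : (quasiHopfA β).IsRMatrix R) {s : Bool}
    (hr : sliceRight signA.toLinearMap R * idem1 KA = wA s * idem1 KA) :
    sliceRight (derivA (!s)) R = (2 : ℂ) • fA s := by
  have hf := sliceRight_derivA_fA hβ hR (!s)
  have hw := sliceRight_derivA_wA hR (!s)
  have hΔ := Δ_sliceRight_derivA hβ hR (!s)
  set L := sliceRight (derivA (!s)) R
  have hwz : ∀ t, (L - (2 : ℂ) • fA s) * wA t = -(wA t * (L - (2 : ℂ) • fA s)) := by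
    intro t
    rw [sub_mul, mul_sub, hw, smul_mul_assoc, mul_smul_comm, fA_mul_wA]
    module
  have hfz : ∀ t, (L - (2 : ℂ) • fA s) * fA t * idem1 KA =
      -(fA t * (L - (2 : ℂ) • fA s) * idem1 KA) := by
    intro t
    have h1 : derivA (!s) (fA t) • ((1 - sliceRight signA.toLinearMap R * wA t) * idem1 KA) =
        (2 : ℂ) • ((fA s * fA t + fA t * fA s) * idem1 KA) := by
      have h2 : sliceRight signA.toLinearMap R * wA t * idem1 KA = wA s * wA t * idem1 KA := by
        rw [mul_assoc, ← idem1_central (wA t), ← mul_assoc, hr, mul_assoc, idem1_central,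
          ← mul_assoc]
      rw [derivA_fA, sub_mul, h2, one_mul]
      rcases Bool.eq_or_eq_not t s with rfl | rfl
      · rw [if_neg (by simp), zero_smul, fA_mul_fA, add_zero, zero_mul, smul_zero]
      · rw [if_pos rfl, wA_mul_not, ← idem1_central, idem1_mul_sq KA_pow, fA_mul_fA_not, idem1_sq]
        module
    rw [sub_mul, hf, sub_mul, add_mul, smul_mul_assoc _ _ (idem1 KA), h1]
    simp only [add_mul, mul_sub, sub_mul, smul_mul_assoc, mul_smul_comm, neg_mul]
    module
  have hK := mul_KA_of_mul_wA hwz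
  have h1 : (L - (2 : ℂ) • fA s) * idem1 KA = 0 := by
    -- Multiplication by `K` turns anticommutation with `f_±` into commutation.
    have h2 : (L - (2 : ℂ) • fA s) * KA * idem1 KA = 0 := by
      refine mul_idem1_eq_zero_of_commute (fun t => ?_) ?_
      · rw [mul_assoc _ KA, KA_mul_fA, mul_neg, neg_mul, ← mul_assoc, mul_assoc _ KA, idem1_comm,
          ← mul_assoc, hfz, neg_mul, neg_neg, mul_assoc, idem1_central, ← mul_assoc, ← mul_assoc]
      · rw [← mul_assoc KA, ← neg_mul, ← hK]
    have h3 : (L - (2 : ℂ) • fA s) * idem1 KA =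
        (L - (2 : ℂ) • fA s) * KA * idem1 KA * KA ^ 3 := by
      rw [mul_assoc _ (idem1 KA), idem1_central, mul_assoc, ← mul_assoc KA, ← pow_succ', KA_pow,
        one_mul]
    rw [h3, h2, zero_mul]
  refine sub_eq_zero.1 (eq_zero_of_blocks (mul_idem0_eq_zero β ?_) h1)
  have h2 : L * idem1 KA = (2 : ℂ) • (fA s * idem1 KA) := by
    rw [← smul_mul_assoc]; exact sub_eq_zero.1 ((sub_mul _ _ _).symm.trans h1)
  rw [map_sub, map_smul, hΔ, Δ_fA, sub_mul, add_mul, smul_mul_assoc, add_mul]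
  simp only [Algebra.TensorProduct.tmul_mul_tmul, h2, hr, TensorProduct.tmul_smul,
    ← TensorProduct.smul_tmul', one_mul, smul_add, sub_self]

/-- `(d_s ⊗ d_{-s})(R)` is `0` when computed from the left slice and `d_s(2 f_s) = 2` from the right
one. -/
theorem not_admitsRibbonStructure (hβ : β ^ 4 = 1) : ¬ (quasiHopfA β).AdmitsRibbonStructure := by
  rintro ⟨R, v, hR, hv⟩
  obtain ⟨s, hr⟩ := exists_sliceLeft_signA_mul_idem1 hβ hR
  have h := apply_sliceLeft (derivA s) (derivA (!s)) R
  rw [sliceLeft_derivA_eq_zero hβ hR hr, map_zero,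
    sliceRight_derivA_not_eq hβ hR ((sliceRight_signA_mul_idem1 hβ hR hv).trans hr), map_smul,
    derivA_fA, if_pos rfl] at h
  simp at h

end SF

end

/-! ### The main theorem -/

theorem mainTheorem11 (β : ℂ) (hβ : β ^ 4 = 1) :
    -- the elements `(f_1^+)^s (f_1^-)^t K^m` form a basis of `A`
    ∃ b : Module.Basis (Fin 4 × Fin 2 × Fin 2) ℂ SF.subA,
      (∀ m s t, b (m, s, t) =
        SF.fA true ^ (s : ℕ) * SF.fA false ^ (t : ℕ) * SF.KA ^ (m : ℕ)) ∧
      -- let `lamR`, `lamL` be the linear forms with the stated values on this basis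
      ∀ lamR lamL : SF.subA →ₗ[ℂ] ℂ,
        (∀ m s t, lamR (b (m, s, t)) =
          if s = 1 ∧ t = 1 then
            (if m = 1 then 1 else 0) - Complex.I * β ^ 2 * (if m = 3 then 1 else 0)
          else 0) →
        (∀ m s t, lamL (b (m, s, t)) =
          if s = 1 ∧ t = 1 then
            (if m = 1 then 1 else 0) + Complex.I * β ^ 2 * (if m = 3 then 1 else 0)
          else 0) →
        -- they are right, respectively left, symmetrised cointegrals
        (SF.quasiHopfA β).IsRightSymCointegral lamR ∧
        (SF.quasiHopfA β).IsLeftSymCointegral lamL ∧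
        -- there are corresponding modified traces on the projective ideal
        (∃ tR : TraceFamily (A := SF.subA) FDMod.IsProjective,
          tR.IsRightModifiedTrace (SF.quasiHopfA β) ∧ tR.CorrespondsTo lamR) ∧
        (∃ tL : TraceFamily (A := SF.subA) FDMod.IsProjective,
          tL.IsLeftModifiedTrace (SF.quasiHopfA β) ∧ tL.CorrespondsTo lamL) ∧
        (∀ tR tL : TraceFamily (A := SF.subA) FDMod.IsProjective,
          tR.IsRightModifiedTrace (SF.quasiHopfA β) → tR.CorrespondsTo lamR →
          tL.IsLeftModifiedTrace (SF.quasiHopfA β) → tL.CorrespondsTo lamL →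
          -- proportional in grade 0
          (∃ c : ℂ, c ≠ 0 ∧ ∀ (P : FDMod SF.subA) (hP : P.IsProjective), SF.IsGrade0 P →
            ∀ f : FDMod.Hom P P, tR P hP f = c * tL P hP f) ∧
          -- proportional in grade 1
          (∃ c : ℂ, c ≠ 0 ∧ ∀ (P : FDMod SF.subA) (hP : P.IsProjective), SF.IsGrade1 P →
            ∀ f : FDMod.Hom P P, tR P hP f = c * tL P hP f) ∧
          -- not proportional globally
          (¬ ∃ c : ℂ, ∀ (P : FDMod SF.subA) (hP : P.IsProjective),
            ∀ f : FDMod.Hom P P, tR P hP f = c * tL P hP f) ∧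
          -- both pullback traces vanish on projective modules over `Q(2, β)`
          (∀ X : FDMod (SF 2), X.IsProjective →
            ∃ hX : (X.res SF.subA).IsProjective, ∀ f : FDMod.Hom X X,
              tR.pullback X hX f = 0 ∧ tL.pullback X hX f = 0)) ∧
        -- there is no ribbon structure on `A`
        ¬ (SF.quasiHopfA β).AdmitsRibbonStructure := by
  -- Here `𝛃 g = ω_t`; the right cointegral sits at `ω_t` and the left one at `ω_{-t}`.
  obtain ⟨t, ht⟩ := SF.exists_sgn hβ
  refine ⟨SF.monomialBasis, SF.monomialBasis_apply, fun lamR lamL hlamR hlamL => ?_⟩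
  have hI := Complex.I_sq
  have hnt : SF.sgn (!t) = β ^ 2 := by
    have h : SF.sgn (!t) = -SF.sgn t := by cases t <;> simp [SF.sgn]
    rw [h, ht, neg_neg]
  have hR : SF.IsTopForm lamR t (1 - Complex.I * β ^ 2) := by
    refine SF.isTopForm_of_values 1 (-(Complex.I * β ^ 2)) (fun m s t => ?_) ?_ ?_
    · rw [hlamR]
      congr 1
      ring
    · rw [hnt]
      linear_combination β ^ 4 / 2 * hI - hβ / 2
    · rw [ht]
      linear_combination -β ^ 4 / 2 * hI + hβ / 2
  have hL : SF.IsTopForm lamL (!t) (1 + Complex.I * β ^ 2) := by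
    refine SF.isTopForm_of_values 1 (Complex.I * β ^ 2) (fun m s t => ?_) ?_ ?_
    · rw [hlamL]
      congr 1
      ring
    · rw [Bool.not_not, ht]
      linear_combination β ^ 4 / 2 * hI - hβ / 2
    · rw [hnt]
      linear_combination -β ^ 4 / 2 * hI + hβ / 2
  -- The product is `1 + β⁴ = 2`, so both top values are non-zero.
  have hprod : (1 - Complex.I * β ^ 2) * (1 + Complex.I * β ^ 2) = 2 := by
    linear_combination -β ^ 4 * hI + hβ
  have hκR : 1 - Complex.I * β ^ 2 ≠ 0 := left_ne_zero_of_mul (hprod ▸ two_ne_zero)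
  have hκL : 1 + Complex.I * β ^ 2 ≠ 0 := right_ne_zero_of_mul (hprod ▸ two_ne_zero)
  refine ⟨hR.isRightSymCointegral hβ ht hκR, hL.isLeftSymCointegral hβ ht hκL,
    ⟨_, hR.isRightModifiedTrace hβ ht, FDMod.hsTrace_correspondsTo hR.symm⟩,
    ⟨_, hL.isLeftModifiedTrace hβ ht, FDMod.hsTrace_correspondsTo hL.symm⟩, ?_,
    SF.not_admitsRibbonStructure hβ⟩
  intro tR tL htR htRl htL htLl
  refine ⟨SF.exists_proportional htR.1 htRl htL.1 htLl hκR hκL fun a => hR.apply_of_idem0 hL,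
    SF.exists_proportional htR.1 htRl htL.1 htLl (neg_ne_zero.2 hκR) hκL fun a =>
      hR.apply_of_idem1 hL, SF.not_proportional hR hL hκR htRl htLl, fun X hX => ?_⟩
  obtain ⟨n, ⟨b⟩⟩ := hX.exists_dualBasis
  exact ⟨(SF.resDualBasis b).isProjective, fun f =>
    ⟨hR.pullback_eq_zero htR.1 htRl b _ f, hL.pullback_eq_zero htL.1 htLl b _ f⟩⟩
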